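/- Let $n\ge 2$, $0\le k<n$ and $\alpha>0$, and let $\Sigma=\mathbb R^k\times\widetilde\Sigma\subseteq\mathbb R^n$, where $\widetilde\Sigma\subseteq\mathbb R^{n-k}$ is an open convex cone with vertex at the origin that contains no lines. Let $w:\overline\Sigma\to[0,\infty)$ be continuous, not identically zero, $\alpha$-homogeneous (i.e. $w(tx)=t^\alpha w(x)$ for $t>0$, $x\in\overline\Sigma$), with $w^{1/\alpha}$ concave in $\Sigma$. Put $D=n+\alpha$, let $B_r(x_0)$ be the open ball, $B_r=B_r(0)$, and for measurable $E\subseteq\Sigma$ let $$w(E)=\int_E w\,dx,\qquad \mathrm{Per}_w(E)=\sup\Big\{\int_E \mathrm{div}(wX)\,dx:\ X\in C_c^\infty(\Sigma,\mathbb R^n),\ \|X\|_\infty\le 1\Big\}.$$ For $0<w(E)<\infty$ let $$\delta_w(E)=\frac{\mathrm{Per}_w(E)}{c_*\,w(E)^{\frac{D-1}{D}}}-1,\quad c_*=\frac{\mathrm{Per}_w(B_1\cap\Sigma)}{w(B_1\cap\Sigma)^{\frac{D-1}{D}}},\qquad A_w(E)=\inf_{x_0\in\mathbb R^k\times\{0\}}\frac{w\big(E\,\Delta\,(B_r(x_0)\cap\Sigma)\big)}{w(E)},$$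 where $r>0$ is such that $w(E)=w(B_r\cap\Sigma)$. The stability inequality $A_w(E)\le C\,\delta_w(E)^{1/2}$ has a sharp exponent, in the following sense. (1) For every $\beta>\frac12$ there is no constant $C$ such that $A_w(E)\le C\,\delta_w(E)^{\beta}$ for all measurable $E\subseteq\Sigma$ with $0<w(E)<\infty$ and $\mathrm{Per}_w(E)<\infty$. (2) Let $\eta:\partial B_1\cap\Sigma\to\mathbb R$ be a smooth bounded function with $$\int_{\partial B_1\cap\Sigma}|\nabla\eta|^2\,w\,d\mathcal H^{n-1}<\infty,\qquad \int_{\partial B_1\cap\Sigma}\eta\,w\,d\mathcal H^{n-1}=0,$$ where $\nabla$ is the tangential gradient, and assume that $\eta$ is not of the form $\theta\mapsto \ell\cdot\theta$ with $\ell\in\mathbb R^k\times\{0\}$ (if $k=0$ this just says $\eta\not\equiv0$). Let $$E_\varepsilon=\{t\theta:\ \theta\in\partial B_1\cap\Sigma,\ 0<t<1+\varepsilon\eta(\theta)\}.$$ Then there are $\varepsilon_0>0$, $C$ and $c>0$, depending only on $n,k,\alpha,\Sigma,w,\eta$, such that for all $0<\varepsilon<\varepsilon_0$: $1+\varepsilon\eta>0$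 on $\partial B_1\cap\Sigma$, the set $E_\varepsilon\subseteq\Sigma$ is measurable with $0<w(E_\varepsilon)<\infty$ and $\mathrm{Per}_w(E_\varepsilon)<\infty$, and $$|w(E_\varepsilon)-w(B_1\cap\Sigma)|\le C\varepsilon^2,\quad |\mathrm{Per}_w(E_\varepsilon)-\mathrm{Per}_w(B_1\cap\Sigma)|\le C\varepsilon^2,\quad |\delta_w(E_\varepsilon)|\le C\varepsilon^2,\quad A_w(E_\varepsilon)\ge c\,\varepsilon .$$ -/

import Mathlib

open MeasureTheory Set Metric
open scoped ENNReal ContDiff symmDiff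

noncomputable section

namespace WeightedIsop

/-- An open convex cone with vertex at the origin. -/
structure IsOpenConvexCone {n : ℕ} (S : Set (EuclideanSpace ℝ (Fin n))) : Prop where
  isOpen : IsOpen S
  convex : Convex ℝ S
  smul_mem : ∀ t : ℝ, 0 < t → ∀ x ∈ S, t • x ∈ S

/-- The set contains no (full affine) line. -/
def ContainsNoLine {n : ℕ} (S : Set (EuclideanSpace ℝ (Fin n))) : Prop :=
  ¬ ∃ p v : EuclideanSpace ℝ (Fin n), v ≠ 0 ∧ ∀ t : ℝ, p + t • v ∈ S

/-- The product `ℝ^k × T` inside `ℝ^(k+m)`, for `T ⊆ ℝ^m`. -/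
def prodCone (k : ℕ) {m : ℕ} (T : Set (EuclideanSpace ℝ (Fin m))) :
    Set (EuclideanSpace ℝ (Fin (k + m))) :=
  {x | WithLp.toLp 2 (fun j : Fin m => x (Fin.natAdd k j)) ∈ T}

/-- The subspace `ℝ^k × {0}` of `ℝ^(k+m)`. -/
def lineSpace (k m : ℕ) : Set (EuclideanSpace ℝ (Fin (k + m))) :=
  {x | ∀ j : Fin m, x (Fin.natAdd k j) = 0}

/-- Admissible weights on the cone `S`: nonnegative, continuous on the closure of `S`, not
identically zero there, `α`-homogeneous, with `w^(1/α)` concave in `S`. Only the values of `w`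
on the closure of `S` matter. -/
structure IsAdmissibleWeight {n : ℕ} (S : Set (EuclideanSpace ℝ (Fin n))) (α : ℝ)
    (w : EuclideanSpace ℝ (Fin n) → ℝ) : Prop where
  continuousOn : ContinuousOn w (closure S)
  nonneg : ∀ x ∈ closure S, 0 ≤ w x
  ne_zero : ∃ x ∈ closure S, w x ≠ 0
  homogeneous : ∀ t : ℝ, 0 < t → ∀ x ∈ closure S, w (t • x) = t ^ α * w x
  concave : ConcaveOn ℝ S (fun x => w x ^ (1 / α))

/-- The weighted volume `w(E) = ∫_E w dx`. -/
def wVol {n : ℕ} (w : EuclideanSpace ℝ (Fin n) → ℝ) (E : Set (EuclideanSpace ℝ (Fin n))) :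
    ℝ≥0∞ :=
  ∫⁻ x in E, ENNReal.ofReal (w x)

/-- The divergence of a vector field (defined through its Fréchet derivative; for a locally
Lipschitz field this is meaningful at almost every point). -/
def divergence {n : ℕ} (V : EuclideanSpace ℝ (Fin n) → EuclideanSpace ℝ (Fin n))
    (x : EuclideanSpace ℝ (Fin n)) : ℝ :=
  ∑ i : Fin n, (fderiv ℝ V x (EuclideanSpace.single i 1)) i

/-- Smooth vector fields, compactly supported in the open set `S`, of sup norm at most one. -/
def IsTestField {n : ℕ} (S : Set (EuclideanSpace ℝ (Fin n)))
    (X : EuclideanSpace ℝ (Fin n) → EuclideanSpace ℝ (Fin n)) : Prop :=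
  ContDiff ℝ ∞ X ∧ HasCompactSupport X ∧ tsupport X ⊆ S ∧ ∀ x, ‖X x‖ ≤ 1

/-- The weighted perimeter of `E` relative to the cone `S`: the supremum of `∫_E div (w X)` over
all test fields `X`. (Test fields are stable under `X ↦ -X`, so the supremum is nonnegative and
truncating each integral at zero does not change it.) -/
def wPer {n : ℕ} (S : Set (EuclideanSpace ℝ (Fin n))) (w : EuclideanSpace ℝ (Fin n) → ℝ)
    (E : Set (EuclideanSpace ℝ (Fin n))) : ℝ≥0∞ :=
  ⨆ (X : EuclideanSpace ℝ (Fin n) → EuclideanSpace ℝ (Fin n)) (_ : IsTestField S X),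
    ENNReal.ofReal (∫ x in E, divergence (fun y => w y • X y) x)

/-- The isoperimetric constant `c_* = Per_w(B_1 ∩ S) / w(B_1 ∩ S)^((D-1)/D)`, `D = n + α`. -/
def isopConst {n : ℕ} (S : Set (EuclideanSpace ℝ (Fin n))) (α : ℝ)
    (w : EuclideanSpace ℝ (Fin n) → ℝ) : ℝ :=
  (wPer S w (ball 0 1 ∩ S)).toReal /
    (wVol w (ball 0 1 ∩ S)).toReal ^ (((n : ℝ) + α - 1) / ((n : ℝ) + α))

/-- The isoperimetric deficit `Per_w(E) / (c_* w(E)^((D-1)/D)) - 1`, `D = n + α`, for sets `E`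
of finite weighted perimeter with `0 < w(E) < ∞`. -/
def deficit {n : ℕ} (S : Set (EuclideanSpace ℝ (Fin n))) (α : ℝ)
    (w : EuclideanSpace ℝ (Fin n) → ℝ) (E : Set (EuclideanSpace ℝ (Fin n))) : ℝ :=
  (wPer S w E).toReal /
    (isopConst S α w * (wVol w E).toReal ^ (((n : ℝ) + α - 1) / ((n : ℝ) + α))) - 1

/-- The asymmetry: the infimum over centers `x₀ ∈ L` of `w(E ∆ (B_r(x₀) ∩ S)) / w(E)`, where
`r > 0` is such that `w(E) = w(B_r ∩ S)` (such an `r` exists and is unique when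
`0 < w(E) < ∞`). -/
def asymmetry {n : ℕ} (S L : Set (EuclideanSpace ℝ (Fin n)))
    (w : EuclideanSpace ℝ (Fin n) → ℝ) (E : Set (EuclideanSpace ℝ (Fin n))) : ℝ≥0∞ :=
  ⨅ (r : ℝ) (_ : 0 < r ∧ wVol w E = wVol w (ball 0 r ∩ S))
    (x₀ : EuclideanSpace ℝ (Fin n)) (_ : x₀ ∈ L),
    wVol w (E ∆ (ball x₀ r ∩ S)) / wVol w E

/-- The `0`-homogeneous extension `x ↦ η (x / |x|)` of a function on the unit sphere. -/
def radialExt {n : ℕ} (η : EuclideanSpace ℝ (Fin n) → ℝ) (x : EuclideanSpace ℝ (Fin n)) : ℝ :=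
  η (‖x‖⁻¹ • x)

/-- The part of the unit sphere lying in `S`. -/
def sphereIn {n : ℕ} (S : Set (EuclideanSpace ℝ (Fin n))) :
    Set (sphere (0 : EuclideanSpace ℝ (Fin n)) 1) :=
  {θ | (θ : EuclideanSpace ℝ (Fin n)) ∈ S}

/-- Admissible radial perturbations: `η` is a smooth bounded function on `∂B_1 ∩ S` (a function
on a relatively open part of the sphere is smooth iff its `0`-homogeneous extension is), with
`∫ |∇η|² w < ∞` and `∫ η w = 0` over `∂B_1 ∩ S` (at a unit vector the gradient of the
`0`-homogeneous extension is the tangential gradient of `η`). Only the values of `η` on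
`∂B_1 ∩ S` matter, and `toSphere` is the surface measure. -/
structure IsAdmissiblePerturbation {n : ℕ} (S : Set (EuclideanSpace ℝ (Fin n)))
    (w η : EuclideanSpace ℝ (Fin n) → ℝ) : Prop where
  smooth : ContDiffOn ℝ ∞ (radialExt η) S
  bounded : ∃ M : ℝ, ∀ θ ∈ sphere (0 : EuclideanSpace ℝ (Fin n)) 1 ∩ S, |η θ| ≤ M
  energy : IntegrableOn
    (fun θ : sphere (0 : EuclideanSpace ℝ (Fin n)) 1 =>
      ‖fderiv ℝ (radialExt η) (θ : EuclideanSpace ℝ (Fin n))‖ ^ 2 * w θ)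
    (sphereIn S) (volume : Measure (EuclideanSpace ℝ (Fin n))).toSphere
  mean_zero : ∫ θ in sphereIn S, η θ * w θ
    ∂((volume : Measure (EuclideanSpace ℝ (Fin n))).toSphere) = 0

/-- The perturbed ball `E_ε = {t θ : θ ∈ ∂B_1 ∩ S, 0 < t < 1 + ε η(θ)}`. -/
def perturbedBall {n : ℕ} (S : Set (EuclideanSpace ℝ (Fin n)))
    (η : EuclideanSpace ℝ (Fin n) → ℝ) (ε : ℝ) : Set (EuclideanSpace ℝ (Fin n)) :=
  {x | ∃ θ ∈ sphere (0 : EuclideanSpace ℝ (Fin n)) 1 ∩ S, ∃ t : ℝ,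
    0 < t ∧ t < 1 + ε * η θ ∧ x = t • θ}

end WeightedIsop

end

/-! Put D = n + α and let ν be the measure w dσ on the part of the unit sphere inside the cone.
Because w is homogeneous, polar coordinates reduce a star-shaped body with radial function ρ to
integrals over the sphere: its volume is D⁻¹ ∫ ρ^D dν, and its perimeter ought to be ∫ ρ^(D-2) √(ρ²
+ |∇ρ|²) dν. A two-sided estimate of the perimeter is enough: ∫ ρ^(D-1) dν from below
(`le_wPer_starBody`), and the same plus ∫ ρ^(D-3) |∇ρ|²/2 dν from above (`wPer_starBody_le`). Both
follow from `tendsto_shell`, which writes the integral of a divergence as a limit of averages over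
thin shells, so no boundary integral is needed. For ρ = 1 + εη the terms of order ε vanish since η
has mean zero, and the gradient term is ε² times the energy. Hence volume, perimeter and deficit
change by O(ε²).

The asymmetry is bounded below by duality. Let g be η minus its L²(ν) projection onto the functions
⟨ℓ, θ⟩ with ℓ ∈ ℝ^k × {0}; it is bounded, nonzero, orthogonal to these functions, and ∫ ηg dν = ∫ g²
dν > 0. A ball with centre v = O(ε) in ℝ^k × {0} and radius 1 + O(ε²) has radial function 1 + ⟨v, θ⟩
+ O(ε²), so the integral of g(x/|x|) over it has no term of order ε, whereas over E_ε it has the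
term ε ∫ ηg dν. As g is bounded, the symmetric difference has measure at least cε
(`exists_symmDiff_ge`). Centres that are not O(ε) are excluded by comparing first moments of a ball
and its translate (`norm_center_le`); here w is constant along ℝ^k because w^(1/α) is concave and
nonnegative.

For the sharpness of the exponent, take η(θ) = ⟨e, θ⟩ minus its mean, with e a coordinate vector of
the second factor. It is not one of the excluded linear functions when n ≥ 2, and asymmetry of order
ε against a deficit O(ε²) contradicts any exponent β > 1/2. The isoperimetric inequality itself is
not used. -/

namespace WeightedIsop

open Filter Topology NNReal

/-! ### Calculus of locally Lipschitz maps. -/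

section LocallyLipschitz

variable {E F G : Type*} [NormedAddCommGroup E] [NormedAddCommGroup F] [NormedAddCommGroup G]

/-- A map which is Lipschitz on some neighbourhood of the point. -/
def LipschitzNear (f : E → F) (x : E) : Prop :=
  ∃ K : ℝ≥0, ∃ t ∈ 𝓝 x, LipschitzOnWith K f t

theorem LipschitzNear.congr {f g : E → F} {x : E} (hf : LipschitzNear f x) (h : f =ᶠ[𝓝 x] g) :
    LipschitzNear g x := by
  obtain ⟨K, t, ht, hK⟩ := hf
  refine ⟨K, t ∩ {y | f y = g y}, inter_mem ht h, fun y hy z hz => ?_⟩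
  rw [← hy.2, ← hz.2]
  exact hK hy.1 hz.1

theorem LipschitzNear.continuousAt {f : E → F} {x : E} (hf : LipschitzNear f x) :
    ContinuousAt f x := by
  obtain ⟨K, t, ht, hK⟩ := hf
  exact hK.continuousOn.continuousAt ht

theorem LipschitzNear.comp {f : E → F} {g : F → G} {x : E} (hg : LipschitzNear g (f x))
    (hf : LipschitzNear f x) : LipschitzNear (g ∘ f) x := by
  have hc := hf.continuousAt
  obtain ⟨K, t, ht, hK⟩ := hf
  obtain ⟨K', t', ht', hK'⟩ := hg
  refine ⟨K' * K, t ∩ f ⁻¹' t', inter_mem ht (hc ht'), ?_⟩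
  exact hK'.comp (hK.mono inter_subset_left) (fun y hy => hy.2)

theorem LipschitzNear.prodMk {f : E → F} {g : E → G} {x : E} (hf : LipschitzNear f x)
    (hg : LipschitzNear g x) : LipschitzNear (fun y => (f y, g y)) x := by
  obtain ⟨K, t, ht, hK⟩ := hf
  obtain ⟨K', t', ht', hK'⟩ := hg
  exact ⟨_, t ∩ t', inter_mem ht ht',
    (hK.mono inter_subset_left).prodMk (hK'.mono inter_subset_right)⟩

variable [NormedSpace ℝ E] [NormedSpace ℝ F] [NormedSpace ℝ G]

theorem _root_.ContDiffAt.lipschitzNear {f : E → F} {x : E} (hf : ContDiffAt ℝ 1 f x) :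
    LipschitzNear f x := hf.exists_lipschitzOnWith

theorem LipschitzNear.smul {f : E → ℝ} {g : E → F} {x : E} (hf : LipschitzNear f x)
    (hg : LipschitzNear g x) : LipschitzNear (fun y => f y • g y) x := by
  have h : ContDiffAt ℝ 1 (fun p : ℝ × F => p.1 • p.2) (f x, g x) := by fun_prop
  exact LipschitzNear.comp (f := fun y => (f y, g y)) h.lipschitzNear (hf.prodMk hg)

/-- A compactly supported locally Lipschitz map is Lipschitz. -/
theorem exists_lipschitzWith_of_hasCompactSupport [FiniteDimensional ℝ E] {f : E → F}
    (hf : ∀ x, LipschitzNear f x) (hc : HasCompactSupport f) : ∃ K, LipschitzWith K f := by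
  have hcont : Continuous f := continuous_iff_continuousAt.2 fun x => (hf x).continuousAt
  obtain ⟨M, hM⟩ := hc.exists_bound_of_continuous hcont
  have hM0 : 0 ≤ M := (norm_nonneg _).trans (hM 0)
  have hK : IsCompact (cthickening 1 (tsupport f)) := hc.isCompact.cthickening
  obtain ⟨C, hC⟩ := LocallyLipschitzOn.exists_lipschitzOnWith_of_compact hK
    (f := f) (fun x _ => by
      obtain ⟨K, t, ht, hK⟩ := hf x
      exact ⟨K, t, mem_nhdsWithin_of_mem_nhds ht, hK⟩)
  -- Within distance one of the support compactness gives a Lipschitz constant; farther away the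
  -- distance exceeds one and the sup bound takes over.
  have key : ∀ x y, f x ≠ 0 → dist (f x) (f y) ≤ max (C : ℝ) M * dist x y := by
    intro x y hx
    have hx' : x ∈ tsupport f := subset_tsupport _ hx
    by_cases hy : y ∈ cthickening 1 (tsupport f)
    · refine (hC.dist_le_mul x (self_subset_cthickening _ hx') y hy).trans ?_
      gcongr
      exact le_max_left _ _
    · have h1 : 1 < dist x y := by
        by_contra! h
        exact hy (mem_cthickening_of_dist_le y x 1 _ hx' (by rwa [dist_comm]))
      have hy0 : f y = 0 := by
        by_contra h
        exact hy (self_subset_cthickening _ (subset_tsupport _ h))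
      rw [hy0, dist_zero_right]
      calc ‖f x‖ ≤ M * 1 := by rw [mul_one]; exact hM x
        _ ≤ max (C : ℝ) M * dist x y := by
          gcongr
          exact le_max_right _ _
  refine ⟨Real.toNNReal (max (C : ℝ) M), LipschitzWith.of_dist_le_mul fun x y => ?_⟩
  rw [Real.coe_toNNReal _ (le_max_of_le_right hM0)]
  by_cases hx : f x = 0
  · by_cases hy : f y = 0
    · rw [hx, hy, dist_self]
      exact mul_nonneg (le_max_of_le_right hM0) dist_nonneg
    · rw [dist_comm, dist_comm x]
      exact key y x hy
  · exact key x y hx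

/-- The product of a function which is locally Lipschitz in an open set with a `C¹` map compactly
supported there is Lipschitz. -/
theorem exists_lipschitzWith_smul [FiniteDimensional ℝ E] {S : Set E}
    {f : E → ℝ} {g : E → F} (hf : ∀ x ∈ S, LipschitzNear f x) (hg : ∀ x, LipschitzNear g x)
    (hc : HasCompactSupport g) (hgS : tsupport g ⊆ S) :
    ∃ K, LipschitzWith K (fun x => f x • g x) := by
  refine exists_lipschitzWith_of_hasCompactSupport (fun x => ?_) hc.smul_left
  by_cases hx : x ∈ tsupport g
  · exact (hf x (hgS hx)).smul (hg x)
  · have h0 : ContDiffAt ℝ 1 (fun _ : E => (0 : F)) x := contDiffAt_const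
    refine h0.lipschitzNear.congr ?_
    filter_upwards [(isClosed_tsupport g).isOpen_compl.mem_nhds hx] with y hy
    rw [image_eq_zero_of_notMem_tsupport hy, smul_zero]

end LocallyLipschitz

/-! ### Positivity, regularity and translation invariance of the weight. -/

section Weight

variable {n : ℕ} {S : Set (EuclideanSpace ℝ (Fin n))} {α : ℝ}
  {w : EuclideanSpace ℝ (Fin n) → ℝ}

/-- The point x + v divides the segment from x to x + tv with weight 1/t at the far end. Dropping
the nonnegative far value and letting t → ∞ gives monotonicity along rays. -/
theorem _root_.ConcaveOn.le_of_ray {E : Type*} [AddCommGroup E] [Module ℝ E] {S : Set E}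
    {g : E → ℝ} (hg : ConcaveOn ℝ S g) (h0 : ∀ x ∈ S, 0 ≤ g x) {x v : E}
    (hv : ∀ t : ℝ, 0 ≤ t → x + t • v ∈ S) : g x ≤ g (x + v) := by
  have hx : x ∈ S := by simpa using hv 0 le_rfl
  have key : ∀ t : ℝ, 1 ≤ t → (1 - t⁻¹) * g x ≤ g (x + v) := by
    intro t ht
    have ht0 : 0 < t := by linarith
    have ht1 : t⁻¹ ≤ 1 := inv_le_one_of_one_le₀ ht
    have h := hg.2 hx (hv t ht0.le) (sub_nonneg.2 ht1) (inv_nonneg.2 ht0.le) (by ring)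
    have he : (1 - t⁻¹) • x + t⁻¹ • (x + t • v) = x + v := by
      rw [smul_add, smul_smul, inv_mul_cancel₀ ht0.ne', sub_smul]
      simp only [one_smul]
      abel
    rw [he, smul_eq_mul, smul_eq_mul] at h
    have := mul_nonneg (inv_nonneg.2 ht0.le) (h0 _ (hv t ht0.le))
    linarith
  have hlim : Tendsto (fun t : ℝ => (1 - t⁻¹) * g x) atTop (𝓝 ((1 - 0) * g x)) :=
    (tendsto_const_nhds.sub tendsto_inv_atTop_zero).mul_const _
  have := le_of_tendsto hlim ((eventually_ge_atTop 1).mono key)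
  simpa using this

/-- By continuity w is nonzero at some y in the open cone. Prolonging the segment from y slightly
beyond x puts x strictly between y and another point of the cone, and concavity gives a positive
value. -/
theorem IsAdmissibleWeight.pos (hw : IsAdmissibleWeight S α w) (hS : IsOpenConvexCone S)
    (hα : 0 < α) {x : EuclideanSpace ℝ (Fin n)} (hx : x ∈ S) : 0 < w x := by
  obtain ⟨y, hy, hy1⟩ : ∃ y ∈ S, w y ≠ 0 := by
    obtain ⟨x₀, hx₀, hne⟩ := hw.ne_zero
    by_contra! h
    have hcl : closure S ⊆ closure S ∩ w ⁻¹' {0} := by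
      have hcl : IsClosed (closure S ∩ w ⁻¹' {0}) :=
        hw.continuousOn.preimage_isClosed_of_isClosed isClosed_closure isClosed_singleton
      exact closure_minimal (fun z hz => ⟨subset_closure hz, h z hz⟩) hcl
    exact hne (hcl hx₀).2
  have hy0 : 0 < w y := lt_of_le_of_ne (hw.nonneg y (subset_closure hy)) hy1.symm
  obtain ⟨t, ht, hz⟩ : ∃ t : ℝ, 0 < t ∧ x + t • (x - y) ∈ S := by
    have hc : ContinuousAt (fun t : ℝ => x + t • (x - y)) 0 := by fun_prop
    have hn : ∀ᶠ t in 𝓝 (0 : ℝ), x + t • (x - y) ∈ S :=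
      hc (by simpa using hS.isOpen.mem_nhds hx)
    exact ((hn.filter_mono nhdsWithin_le_nhds).and
      (self_mem_nhdsWithin (s := Ioi (0 : ℝ)))).exists.imp fun t ht => ⟨ht.2, ht.1⟩
  have h1 : 0 < 1 + t := by linarith
  have h := hw.concave.2 hz hy (inv_nonneg.2 h1.le) (div_nonneg ht.le h1.le)
    (by field_simp)
  have he : (1 + t)⁻¹ • (x + t • (x - y)) + (t / (1 + t)) • y = x := by
    have : (t / (1 + t)) = (1 + t)⁻¹ * t := by ring
    rw [this, mul_smul, ← smul_add]
    rw [inv_smul_eq_iff₀ h1.ne', add_smul, smul_sub, one_smul]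
    abel
  rw [he] at h
  have hpos : 0 < w x ^ (1 / α) := by
    refine lt_of_lt_of_le ?_ h
    have a1 : 0 ≤ w (x + t • (x - y)) ^ (1 / α) :=
      Real.rpow_nonneg (hw.nonneg _ (subset_closure hz)) _
    have a2 : 0 < w y ^ (1 / α) := Real.rpow_pos_of_pos hy0 _
    have a3 : 0 < t / (1 + t) := div_pos ht h1
    simp only [smul_eq_mul]
    positivity
  rcases (hw.nonneg x (subset_closure hx)).eq_or_lt with h0 | h0
  · rw [← h0, Real.zero_rpow (by positivity)] at hpos
    exact absurd hpos (lt_irrefl _)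
  · exact h0

theorem IsAdmissibleWeight.rpow_rpow (hw : IsAdmissibleWeight S α w) (hα : 0 < α)
    {x : EuclideanSpace ℝ (Fin n)} (hx : x ∈ S) : (w x ^ (1 / α)) ^ α = w x := by
  rw [← Real.rpow_mul (hw.nonneg x (subset_closure hx)), one_div_mul_cancel hα.ne', Real.rpow_one]

/-- The concave function w^(1/α) is locally Lipschitz on the open cone, and its positivity makes the
power s^α smooth where it is applied. -/
theorem IsAdmissibleWeight.lipschitzNear (hw : IsAdmissibleWeight S α w)
    (hS : IsOpenConvexCone S) (hα : 0 < α) {x : EuclideanSpace ℝ (Fin n)} (hx : x ∈ S) :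
    LipschitzNear w x := by
  have h1 : LipschitzNear (fun x => w x ^ (1 / α)) x := by
    obtain ⟨K, t, ht, hK⟩ := hw.concave.locallyLipschitzOn hS.isOpen hx
    rw [nhdsWithin_eq_nhds.2 (hS.isOpen.mem_nhds hx)] at ht
    exact ⟨K, t, ht, hK⟩
  have h2 : ContDiffAt ℝ 1 (fun s : ℝ => s ^ α) (w x ^ (1 / α)) :=
    Real.contDiffAt_rpow_const_of_ne (Real.rpow_pos_of_pos (hw.pos hS hα hx) _).ne'
  refine (LipschitzNear.comp (f := fun x => w x ^ (1 / α)) h2.lipschitzNear h1).congr ?_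
  filter_upwards [hS.isOpen.mem_nhds hx] with y hy
  exact hw.rpow_rpow hα hy

/-- An admissible weight is constant along the lines contained in the cone. -/
theorem IsAdmissibleWeight.add_eq (hw : IsAdmissibleWeight S α w) (hα : 0 < α)
    {x v : EuclideanSpace ℝ (Fin n)} (hv : ∀ t : ℝ, x + t • v ∈ S) : w (x + v) = w x := by
  have h0 : ∀ y ∈ S, 0 ≤ w y ^ (1 / α) := fun y hy =>
    Real.rpow_nonneg (hw.nonneg y (subset_closure hy)) _
  have hx : x ∈ S := by simpa using hv 0
  have hxv : x + v ∈ S := by simpa using hv 1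
  -- Monotonicity along a ray, used in both directions of the line, gives equality.
  have h1 := hw.concave.le_of_ray h0 (x := x) (v := v) fun t _ => hv t
  have h2 := hw.concave.le_of_ray h0 (x := x + v) (v := -v) fun t _ => by
    have := hv (1 - t)
    convert this using 1
    rw [sub_smul, one_smul, smul_neg]
    abel
  rw [add_neg_cancel_right] at h2
  rw [← hw.rpow_rpow hα hx, ← hw.rpow_rpow hα hxv, le_antisymm h2 h1]

end Weight

/-! ### The product cone and its invariant directions. -/

section ProdCone

variable {k m : ℕ} {T : Set (EuclideanSpace ℝ (Fin m))}

theorem isOpenConvexCone_prodCone (hT : IsOpenConvexCone T) :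
    IsOpenConvexCone (prodCone k T) where
  isOpen := hT.isOpen.preimage (by fun_prop)
  convex := by
    intro x hx y hy a b ha hb hab
    exact hT.convex hx hy ha hb hab
  smul_mem := fun t ht x hx => hT.smul_mem t ht _ hx

/-- An open cone containing the origin is the whole space. Having the origin outside the cone makes
the projection onto the sphere smooth in it. -/
theorem zero_notMem_of_containsNoLine (hm : 1 ≤ m) (hT : IsOpenConvexCone T)
    (hTl : ContainsNoLine T) : (0 : EuclideanSpace ℝ (Fin m)) ∉ T := by
  intro h0
  have huniv : ∀ x, x ∈ T := by
    intro x
    have hc : ContinuousAt (fun t : ℝ => t • x) 0 := by fun_prop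
    have hn : ∀ᶠ t in 𝓝 (0 : ℝ), t • x ∈ T := hc (by simpa using hT.isOpen.mem_nhds h0)
    obtain ⟨t, ht, ht0⟩ := ((hn.filter_mono nhdsWithin_le_nhds).and
      (self_mem_nhdsWithin (s := Ioi (0 : ℝ)))).exists
    have := hT.smul_mem t⁻¹ (inv_pos.2 ht0) _ ht
    rwa [smul_smul, inv_mul_cancel₀ (ne_of_gt ht0), one_smul] at this
  exact hTl ⟨0, EuclideanSpace.single ⟨0, hm⟩ 1, by simp, fun t => huniv _⟩

theorem zero_notMem_prodCone (hm : 1 ≤ m) (hT : IsOpenConvexCone T)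
    (hTl : ContainsNoLine T) : (0 : EuclideanSpace ℝ (Fin (k + m))) ∉ prodCone k T := by
  intro h
  exact zero_notMem_of_containsNoLine hm hT hTl h

theorem add_mem_prodCone {x v : EuclideanSpace ℝ (Fin (k + m))} (hx : x ∈ prodCone k T)
    (hv : v ∈ lineSpace k m) : x + v ∈ prodCone k T := by
  have hv' : ∀ j : Fin m, v (Fin.natAdd k j) = 0 := hv
  simpa [prodCone, hv'] using hx

/-- `ℝ^k × {0}` as a linear subspace. -/
def lineSubmodule (k m : ℕ) : Submodule ℝ (EuclideanSpace ℝ (Fin (k + m))) where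
  carrier := lineSpace k m
  add_mem' := fun {a b} ha hb j => by
    have h1 := ha j
    have h2 := hb j
    simp [h1, h2]
  zero_mem' := fun j => rfl
  smul_mem' := fun c x hx j => by
    have h1 := hx j
    simp [h1]

end ProdCone

/-! ### Polar coordinates for a homogeneous weight. -/

section Polar

/-- Integration in polar coordinates. -/
theorem lintegral_polar {n : ℕ} (hn : 1 ≤ n) {f : EuclideanSpace ℝ (Fin n) → ℝ≥0∞}
    (hf : Measurable f) :
    ∫⁻ x, f x = ∫⁻ θ : sphere (0 : EuclideanSpace ℝ (Fin n)) 1,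
      (∫⁻ r in Ioi (0 : ℝ), ENNReal.ofReal (r ^ (n - 1)) *
        f (r • (θ : EuclideanSpace ℝ (Fin n))))
      ∂(volume : Measure (EuclideanSpace ℝ (Fin n))).toSphere := by
  have : Nonempty (Fin n) := ⟨⟨0, hn⟩⟩
  let E := EuclideanSpace ℝ (Fin n)
  have hmp := (volume : Measure E).measurePreserving_homeomorphUnitSphereProd
  have hd : Module.finrank ℝ E = n := finrank_euclideanSpace_fin
  rw [hd] at hmp
  have hme : MeasurableEmbedding ((↑) : ({0}ᶜ : Set E) → E) :=
    MeasurableEmbedding.subtype_coe (measurableSet_singleton 0).compl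
  have h1 : ∫⁻ x, f x = ∫⁻ x : ({0}ᶜ : Set E), f x ∂(volume.comap Subtype.val) := by
    rw [lintegral_subtype_comap (measurableSet_singleton (0 : E)).compl,
      restrict_compl_singleton]
  have h2 : ∫⁻ x : ({0}ᶜ : Set E), f x ∂(volume.comap Subtype.val) =
      ∫⁻ p, f ((homeomorphUnitSphereProd E).symm p)
        ∂((volume : Measure E).toSphere.prod (Measure.volumeIoiPow (n - 1))) := by
    rw [← hmp.lintegral_comp_emb (homeomorphUnitSphereProd E).measurableEmbedding]
    simp
  rw [h1, h2, lintegral_prod]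
  · refine lintegral_congr fun θ => ?_
    have hm : Measurable fun r : Ioi (0 : ℝ) => ENNReal.ofReal ((r : ℝ) ^ (n - 1)) := by fun_prop
    rw [Measure.volumeIoiPow, lintegral_withDensity_eq_lintegral_mul _ hm]
    · simp only [Pi.mul_apply, homeomorphUnitSphereProd_symm_apply_coe]
      rw [lintegral_subtype_comap measurableSet_Ioi
        (fun r => ENNReal.ofReal (r ^ (n - 1)) * f (r • (θ : E)))]
    · simp only [homeomorphUnitSphereProd_symm_apply_coe]
      fun_prop
  · exact (hf.comp (measurable_subtype_coe.comp
      (homeomorphUnitSphereProd E).symm.measurable)).aemeasurable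

theorem lintegral_Ioo_rpow {D R : ℝ} (hD : 0 < D) (hR : 0 ≤ R) :
    ∫⁻ r in Ioo 0 R, ENNReal.ofReal (r ^ (D - 1)) = ENNReal.ofReal (R ^ D / D) := by
  rw [Measure.restrict_congr_set Ioo_ae_eq_Ioc, ← ofReal_integral_eq_lintegral_ofReal,
    ← intervalIntegral.integral_of_le hR, integral_rpow (Or.inl (by linarith))]
  · rw [sub_add_cancel, Real.zero_rpow hD.ne', sub_zero]
  · exact (intervalIntegral.intervalIntegrable_rpow' (by linarith)).1
  · filter_upwards [ae_restrict_mem measurableSet_Ioc] with y hy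
    exact Real.rpow_nonneg hy.1.le _

variable {n : ℕ}

/-- The radial projection onto the unit sphere. -/
noncomputable def dir (x : EuclideanSpace ℝ (Fin n)) : EuclideanSpace ℝ (Fin n) := ‖x‖⁻¹ • x

@[fun_prop]
theorem measurable_dir : Measurable (dir : EuclideanSpace ℝ (Fin n) → _) := by
  unfold dir; fun_prop

theorem dir_smul {r : ℝ} (hr : 0 < r) (x : EuclideanSpace ℝ (Fin n)) : dir (r • x) = dir x := by
  rw [dir, dir, norm_smul, Real.norm_eq_abs, abs_of_pos hr, smul_smul, mul_inv, mul_right_comm,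
    inv_mul_cancel₀ hr.ne', one_mul]

theorem dir_of_norm_eq_one {x : EuclideanSpace ℝ (Fin n)} (hx : ‖x‖ = 1) : dir x = x := by
  simp [dir, hx]

theorem norm_dir {x : EuclideanSpace ℝ (Fin n)} (hx : x ≠ 0) : ‖dir x‖ = 1 := by
  rw [dir, norm_smul, norm_inv, norm_norm, inv_mul_cancel₀ (norm_ne_zero_iff.2 hx)]

theorem norm_smul_dir (x : EuclideanSpace ℝ (Fin n)) : ‖x‖ • dir x = x := by
  by_cases hx : x = 0
  · simp [hx]
  · rw [dir, smul_smul, mul_inv_cancel₀ (norm_ne_zero_iff.2 hx), one_smul]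

variable {S : Set (EuclideanSpace ℝ (Fin n))}

theorem IsOpenConvexCone.smul_mem_iff (hS : IsOpenConvexCone S) {t : ℝ} (ht : 0 < t)
    {x : EuclideanSpace ℝ (Fin n)} : t • x ∈ S ↔ x ∈ S := by
  refine ⟨fun h => ?_, hS.smul_mem t ht x⟩
  have := hS.smul_mem t⁻¹ (inv_pos.2 ht) _ h
  rwa [smul_smul, inv_mul_cancel₀ ht.ne', one_smul] at this

theorem IsOpenConvexCone.dir_mem (hS : IsOpenConvexCone S) (h0 : (0 : EuclideanSpace ℝ (Fin n)) ∉ S)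
    {x : EuclideanSpace ℝ (Fin n)} (hx : x ∈ S) : dir x ∈ S := by
  have hx0 : x ≠ 0 := fun h => h0 (h ▸ hx)
  exact hS.smul_mem _ (inv_pos.2 (norm_pos_iff.2 hx0)) _ hx

theorem measurable_indicator_of_continuousOn {β : Type*} [TopologicalSpace β] [Zero β]
    [MeasurableSpace β] [BorelSpace β]
    (hS : IsOpen S) {f : EuclideanSpace ℝ (Fin n) → β} (hf : ContinuousOn f S) :
    Measurable (S.indicator f) := by
  classical
  rw [← piecewise_eq_indicator]
  exact hf.measurable_piecewise continuousOn_const hS.measurableSet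

variable {α : ℝ} {w : EuclideanSpace ℝ (Fin n) → ℝ}

variable (S w) in
/-- The density `w` in the cone, extended by zero. -/
noncomputable def coneDensity (x : EuclideanSpace ℝ (Fin n)) : ℝ≥0∞ :=
  S.indicator (fun x => ENNReal.ofReal (w x)) x

variable (S w) in
/-- The measure `w dx` on the cone. -/
noncomputable def coneMeasure : Measure (EuclideanSpace ℝ (Fin n)) :=
  volume.withDensity (coneDensity S w)

variable (S w) in
/-- The measure `w dσ` on the part of the unit sphere lying in the cone. -/
noncomputable def sphereMeasure : Measure (sphere (0 : EuclideanSpace ℝ (Fin n)) 1) :=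
  (volume : Measure (EuclideanSpace ℝ (Fin n))).toSphere.withDensity
    (fun θ => coneDensity S w θ)

variable (S) in
/-- The star-shaped body in the cone `S` with radial function `R`. -/
def starBody (R : EuclideanSpace ℝ (Fin n) → ℝ) : Set (EuclideanSpace ℝ (Fin n)) :=
  {x | x ∈ S ∧ ‖x‖ < R (dir x)}

theorem IsAdmissibleWeight.measurable_coneDensity (hw : IsAdmissibleWeight S α w)
    (hS : IsOpenConvexCone S) : Measurable (coneDensity S w) :=
  measurable_indicator_of_continuousOn hS.isOpen
    (ENNReal.continuous_ofReal.comp_continuousOn (hw.continuousOn.mono subset_closure))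

theorem wVol_eq_coneMeasure {E : Set (EuclideanSpace ℝ (Fin n))}
    (hE : MeasurableSet E) (hES : E ⊆ S) : wVol w E = coneMeasure S w E := by
  rw [wVol, coneMeasure, withDensity_apply _ hE]
  refine setLIntegral_congr_fun hE fun x hx => ?_
  simp [coneDensity, hES hx]

theorem measurableSet_starBody (hS : IsOpenConvexCone S) {R : EuclideanSpace ℝ (Fin n) → ℝ}
    (hR : Measurable R) : MeasurableSet (starBody S R) :=
  hS.isOpen.measurableSet.inter (measurableSet_lt measurable_norm (hR.comp measurable_dir))

/-- Integrals of functions of the direction over star-shaped bodies. -/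
theorem IsAdmissibleWeight.lintegral_starBody (hw : IsAdmissibleWeight S α w)
    (hS : IsOpenConvexCone S) (hn : 1 ≤ n) (hα : 0 < α)
    {R : EuclideanSpace ℝ (Fin n) → ℝ} (hR : Measurable R)
    (hR0 : ∀ θ ∈ S, ‖θ‖ = 1 → 0 ≤ R θ)
    {g : EuclideanSpace ℝ (Fin n) → ℝ≥0∞} (hg : Measurable g) :
    ∫⁻ x in starBody S R, g (dir x) ∂(coneMeasure S w) =
      ∫⁻ θ : sphere (0 : EuclideanSpace ℝ (Fin n)) 1,
        g θ * ENNReal.ofReal (R θ ^ ((n : ℝ) + α) / ((n : ℝ) + α)) ∂(sphereMeasure S w) := by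
  have hd := hw.measurable_coneDensity hS
  have hE := measurableSet_starBody hS hR
  have hgd : Measurable fun x => g (dir x) := hg.comp measurable_dir
  have hD : 0 < (n : ℝ) + α := by positivity
  rw [← lintegral_indicator hE, coneMeasure,
    lintegral_withDensity_eq_lintegral_mul _ hd (hgd.indicator hE),
    lintegral_polar hn (hd.mul (hgd.indicator hE)), sphereMeasure,
    lintegral_withDensity_eq_lintegral_mul _ (show Measurable fun
      θ : sphere (0 : EuclideanSpace ℝ (Fin n)) 1 => coneDensity S w θ from
        hd.comp measurable_subtype_coe) (by fun_prop)]
  refine lintegral_congr fun θ => ?_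
  have hθ1 : ‖(θ : EuclideanSpace ℝ (Fin n))‖ = 1 := by simp
  by_cases hθ : (θ : EuclideanSpace ℝ (Fin n)) ∈ S
  -- On the ray through θ the body is the interval (0, R θ), and homogeneity turns r^(n-1) w(rθ)
  -- into r^(D-1) w(θ).
  · have h1 : ∀ r ∈ Ioi (0 : ℝ), ENNReal.ofReal (r ^ (n - 1)) *
        (coneDensity S w * (starBody S R).indicator fun x => g (dir x))
          (r • (θ : EuclideanSpace ℝ (Fin n))) =
        (Ioo 0 (R θ)).indicator (fun r => ENNReal.ofReal (r ^ ((n : ℝ) + α - 1))) r *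
          (ENNReal.ofReal (w θ) * g θ) := by
      intro r hr
      have hr0 : 0 < r := hr
      have hrS := hS.smul_mem r hr0 _ hθ
      have hmem : r • (θ : EuclideanSpace ℝ (Fin n)) ∈ starBody S R ↔ r ∈ Ioo 0 (R θ) := by
        simp only [starBody, mem_ofPred_eq, hrS, true_and, dir_smul hr0, dir_of_norm_eq_one hθ1,
          norm_smul, hθ1, mul_one, Real.norm_eq_abs, abs_of_pos hr0, mem_Ioo, hr0]
      rw [Pi.mul_apply, coneDensity, indicator_of_mem hrS,
        hw.homogeneous r hr0 _ (subset_closure hθ)]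
      by_cases hm : r ∈ Ioo 0 (R θ)
      · rw [indicator_of_mem (hmem.2 hm), indicator_of_mem hm, dir_smul hr0,
          dir_of_norm_eq_one hθ1, ENNReal.ofReal_mul (by positivity), ← mul_assoc, ← mul_assoc,
          ← ENNReal.ofReal_mul (by positivity), ← Real.rpow_natCast, ← Real.rpow_add hr0,
          mul_assoc]
        congr 3
        rw [Nat.cast_sub hn, Nat.cast_one]
        ring
      · rw [indicator_of_notMem (fun h => hm (hmem.1 h)), indicator_of_notMem hm]
        simp
    rw [setLIntegral_congr_fun measurableSet_Ioi h1, lintegral_mul_const'' _ (Measurable.aemeasurable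
        (Measurable.indicator (by fun_prop) measurableSet_Ioo)),
      lintegral_indicator measurableSet_Ioo, Measure.restrict_restrict measurableSet_Ioo,
      inter_eq_left.2 Ioo_subset_Ioi_self, lintegral_Ioo_rpow hD (hR0 _ hθ hθ1)]
    simp only [Pi.mul_apply, coneDensity, indicator_of_mem hθ]
    ring
  · have h1 : ∀ r ∈ Ioi (0 : ℝ), ENNReal.ofReal (r ^ (n - 1)) *
        (coneDensity S w * (starBody S R).indicator fun x => g (dir x))
          (r • (θ : EuclideanSpace ℝ (Fin n))) = 0 := by
      intro r hr
      have : r • (θ : EuclideanSpace ℝ (Fin n)) ∉ S := fun h => hθ ((hS.smul_mem_iff hr).1 h)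
      simp [coneDensity, this]
    rw [setLIntegral_congr_fun measurableSet_Ioi h1]
    simp [coneDensity, hθ]

theorem IsAdmissibleWeight.coneMeasure_starBody (hw : IsAdmissibleWeight S α w)
    (hS : IsOpenConvexCone S) (hn : 1 ≤ n) (hα : 0 < α)
    {R : EuclideanSpace ℝ (Fin n) → ℝ} (hR : Measurable R)
    (hR0 : ∀ θ ∈ S, ‖θ‖ = 1 → 0 ≤ R θ) :
    coneMeasure S w (starBody S R) =
      ∫⁻ θ : sphere (0 : EuclideanSpace ℝ (Fin n)) 1,
        ENNReal.ofReal (R θ ^ ((n : ℝ) + α) / ((n : ℝ) + α)) ∂(sphereMeasure S w) := by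
  simpa using hw.lintegral_starBody hS hn hα hR hR0 (g := fun _ => 1) measurable_const

theorem IsAdmissibleWeight.ae_mem_sphereMeasure (hw : IsAdmissibleWeight S α w)
    (hS : IsOpenConvexCone S) :
    ∀ᵐ θ : sphere (0 : EuclideanSpace ℝ (Fin n)) 1 ∂(sphereMeasure S w), (θ : EuclideanSpace ℝ (Fin n)) ∈ S := by
  have hm : Measurable fun θ : sphere (0 : EuclideanSpace ℝ (Fin n)) 1 => coneDensity S w θ :=
    (hw.measurable_coneDensity hS).comp measurable_subtype_coe
  rw [sphereMeasure, ae_withDensity_iff hm]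
  refine ae_of_all _ fun θ hθ => ?_
  by_contra h
  exact hθ (by simp [coneDensity, h])

theorem IsAdmissibleWeight.isFiniteMeasure_sphereMeasure (hw : IsAdmissibleWeight S α w) :
    IsFiniteMeasure (sphereMeasure S w) := by
  have hK : IsCompact (sphere (0 : EuclideanSpace ℝ (Fin n)) 1 ∩ closure S) :=
    (isCompact_sphere 0 1).inter_right isClosed_closure
  obtain ⟨M, hM⟩ := hK.exists_bound_of_continuousOn (hw.continuousOn.mono inter_subset_right)
  refine isFiniteMeasure_withDensity (ne_of_lt ?_)
  refine lt_of_le_of_lt (lintegral_mono (g := fun _ => ENNReal.ofReal M) fun θ => ?_) ?_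
  · by_cases h : (θ : EuclideanSpace ℝ (Fin n)) ∈ S
    · simp only [coneDensity, indicator_of_mem h]
      exact ENNReal.ofReal_le_ofReal ((le_abs_self _).trans (hM _ ⟨θ.2, subset_closure h⟩))
    · simp [coneDensity, h]
  · rw [lintegral_const]
    exact ENNReal.mul_lt_top ENNReal.ofReal_lt_top (measure_lt_top _ _)

/-- Bochner integrals of functions of the direction over star-shaped bodies. -/
theorem IsAdmissibleWeight.integral_starBody (hw : IsAdmissibleWeight S α w)
    (hS : IsOpenConvexCone S) (hn : 1 ≤ n) (hα : 0 < α)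
    {R : EuclideanSpace ℝ (Fin n) → ℝ} (hR : Measurable R)
    (hR0 : ∀ θ ∈ S, ‖θ‖ = 1 → 0 ≤ R θ)
    {g : EuclideanSpace ℝ (Fin n) → ℝ} (hg : Measurable g) :
    ∫ x in starBody S R, g (dir x) ∂(coneMeasure S w) =
      ∫ θ : sphere (0 : EuclideanSpace ℝ (Fin n)) 1,
        R θ ^ ((n : ℝ) + α) / ((n : ℝ) + α) * g θ ∂(sphereMeasure S w) := by
  have hD : 0 < (n : ℝ) + α := by positivity
  have hm : Measurable fun θ : sphere (0 : EuclideanSpace ℝ (Fin n)) 1 =>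
      (R θ ^ ((n : ℝ) + α) / ((n : ℝ) + α)) := by fun_prop
  -- The identity for nonnegative functions says that two pushforward measures coincide; this form
  -- transfers to Bochner integrals of signed functions with no integrability assumption.
  have hmap : ((coneMeasure S w).restrict (starBody S R)).map dir =
      ((sphereMeasure S w).withDensity
        (fun θ => ENNReal.ofReal (R θ ^ ((n : ℝ) + α) / ((n : ℝ) + α)))).map Subtype.val := by
    refine Measure.ext_of_lintegral _ fun f hf => ?_
    rw [lintegral_map hf measurable_dir, lintegral_map hf measurable_subtype_coe,
      hw.lintegral_starBody hS hn hα hR hR0 hf, lintegral_withDensity_eq_lintegral_mul _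
        hm.ennreal_ofReal (show Measurable fun θ : sphere (0 : EuclideanSpace ℝ (Fin n)) 1 =>
          f θ from hf.comp measurable_subtype_coe)]
    exact lintegral_congr fun θ => mul_comm _ _
  rw [← integral_map measurable_dir.aemeasurable hg.aestronglyMeasurable, hmap,
    integral_map measurable_subtype_coe.aemeasurable hg.aestronglyMeasurable]
  rw [integral_withDensity_eq_integral_toReal_smul hm.ennreal_ofReal
    (ae_of_all _ fun _ => ENNReal.ofReal_lt_top)]
  refine integral_congr_ae ?_
  filter_upwards [hw.ae_mem_sphereMeasure hS] with θ hθ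
  have hθ1 : ‖(θ : EuclideanSpace ℝ (Fin n))‖ = 1 := by simp
  have := hR0 _ hθ hθ1
  rw [ENNReal.toReal_ofReal (by positivity), smul_eq_mul]

end Polar

/-! ### Integration by parts and thin shells. -/

section IntegrationByParts

variable {n : ℕ} {S : Set (EuclideanSpace ℝ (Fin n))}

/-- Smooth cutoff functions between a compact set and an open set. -/
theorem exists_smooth_cutoff (hS : IsOpen S) {K : Set (EuclideanSpace ℝ (Fin n))}
    (hK : IsCompact K) (hKS : K ⊆ S) :
    ∃ χ : EuclideanSpace ℝ (Fin n) → ℝ, ContDiff ℝ ∞ χ ∧ HasCompactSupport χ ∧ tsupport χ ⊆ S ∧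
      (∀ᶠ x in 𝓝ˢ K, χ x = 1) ∧ ∀ x, χ x ∈ Icc (0 : ℝ) 1 := by
  obtain ⟨L, hL, hKL, hLS⟩ := exists_compact_between hK hS hKS
  obtain ⟨f, h1, h0, hf⟩ := exists_contMDiffMap_one_nhds_of_subset_interior
    (n := (⊤ : ℕ∞)) (modelWithCornersSelf ℝ (EuclideanSpace ℝ (Fin n))) hK.isClosed hKL
  have hsupp : tsupport f ⊆ L := by
    refine closure_minimal (fun x hx => ?_) hL.isClosed
    by_contra h
    exact hx (h0 x h)
  exact ⟨f, f.contMDiff.contDiff, hL.of_isClosed_subset (isClosed_tsupport _) hsupp,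
    hsupp.trans hLS, h1, hf⟩

theorem fderiv_coord {V : EuclideanSpace ℝ (Fin n) → EuclideanSpace ℝ (Fin n)}
    {x : EuclideanSpace ℝ (Fin n)} (hV : DifferentiableAt ℝ V x) (i : Fin n)
    (v : EuclideanSpace ℝ (Fin n)) :
    lineDeriv ℝ (fun y => V y i) x v = (fderiv ℝ V x v) i := by
  have h : HasFDerivAt (fun y => V y i)
      ((EuclideanSpace.proj i : EuclideanSpace ℝ (Fin n) →L[ℝ] ℝ).comp (fderiv ℝ V x)) x :=
    (EuclideanSpace.proj i : EuclideanSpace ℝ (Fin n) →L[ℝ] ℝ).hasFDerivAt.comp x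
      hV.hasFDerivAt
  rw [h.differentiableAt.lineDeriv_eq_fderiv, h.fderiv]
  rfl

/-- Integration by parts for compactly supported Lipschitz functions and fields. -/
theorem integral_mul_divergence {f : EuclideanSpace ℝ (Fin n) → ℝ}
    {V : EuclideanSpace ℝ (Fin n) → EuclideanSpace ℝ (Fin n)} {C C' : ℝ≥0}
    (hf : LipschitzWith C f) (hfc : HasCompactSupport f)
    (hV : LipschitzWith C' V) (hVc : HasCompactSupport V) :
    ∫ x, f x * divergence V x = -∫ x, fderiv ℝ f x (V x) := by
  let e : Fin n → EuclideanSpace ℝ (Fin n) := fun i => EuclideanSpace.single i 1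
  have hVi : ∀ i, LipschitzWith C' fun x => V x i := fun i => by
    have h : LipschitzWith 1 fun y : EuclideanSpace ℝ (Fin n) => y i :=
      LipschitzWith.of_dist_le_mul fun x y => by
        rw [NNReal.coe_one, one_mul, dist_eq_norm, dist_eq_norm]
        exact EuclideanSpace.norm_eq (x - y) ▸ by
          rw [← Real.sqrt_sq (norm_nonneg (x i - y i))]
          apply Real.sqrt_le_sqrt
          exact Finset.single_le_sum (f := fun j => ‖(x - y) j‖ ^ 2)
            (fun j _ => sq_nonneg _) (Finset.mem_univ i)
    simpa [Function.comp_def] using h.comp hV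
  have hVic : ∀ i, HasCompactSupport fun x => V x i := fun i =>
    hVc.comp_left (g := fun y : EuclideanSpace ℝ (Fin n) => y i) rfl
  have hfi : Integrable f := hf.continuous.integrable_of_hasCompactSupport hfc
  have hVint : ∀ i, Integrable fun x => V x i := fun i =>
    (hVi i).continuous.integrable_of_hasCompactSupport (hVic i)
  have h1 : ∫ x, f x * divergence V x =
      ∑ i, ∫ x, lineDeriv ℝ (fun x => V x i) x (e i) * f x := by
    have hI : ∀ i, Integrable fun x => lineDeriv ℝ (fun x => V x i) x (e i) * f x := fun i =>
      hfi.mul_of_top_right ((hVi i).memLp_lineDeriv (e i))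
    rw [← integral_finsetSum _ fun i _ => hI i]
    refine integral_congr_ae ?_
    -- Rademacher's theorem: the divergence is the sum of the directional derivatives of the
    -- components almost everywhere.
    filter_upwards [hV.ae_differentiableAt] with x hx
    rw [divergence, Finset.mul_sum]
    refine Finset.sum_congr rfl fun i _ => ?_
    rw [fderiv_coord hx, mul_comm]
  have h2 : ∫ x, fderiv ℝ f x (V x) = ∑ i, ∫ x, lineDeriv ℝ f x (e i) * V x i := by
    have hI : ∀ i, Integrable fun x => lineDeriv ℝ f x (e i) * V x i := fun i =>
      (hVint i).mul_of_top_right (hf.memLp_lineDeriv (e i))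
    rw [← integral_finsetSum _ fun i _ => hI i]
    refine integral_congr_ae ?_
    filter_upwards [hf.ae_differentiableAt] with x hx
    have hVx : V x = ∑ i, V x i • e i := by
      simpa [e] using ((EuclideanSpace.basisFun (Fin n) ℝ).sum_repr (V x)).symm
    conv_lhs => rw [hVx]
    rw [map_sum]
    refine Finset.sum_congr rfl fun i _ => ?_
    rw [map_smul, hx.lineDeriv_eq_fderiv, smul_eq_mul, mul_comm]
  rw [h1, h2, ← Finset.sum_neg_distrib]
  refine Finset.sum_congr rfl fun i _ => ?_
  rw [hf.integral_lineDeriv_mul_eq (hVi i) (hVic i), ← integral_neg]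
  refine integral_congr_ae (ae_of_all _ fun x => ?_)
  simp only [lineDeriv_neg]
  ring

/-- The piecewise linear function equal to one below `1 - δ` and to zero above `1`. -/
noncomputable def ramp (δ s : ℝ) : ℝ := max 0 (min 1 ((1 - s) / δ))

theorem lipschitzNear_ramp (δ s : ℝ) : LipschitzNear (ramp δ) s := by
  have h : LocallyLipschitz (ramp δ) := by
    have h1 : ContDiff ℝ 1 fun s : ℝ => (1 - s) / δ := by fun_prop
    exact (h1.locallyLipschitz.const_min 1).const_max 0
  obtain ⟨K, t, ht, hK⟩ := h s
  exact ⟨K, t, ht, hK⟩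

theorem ramp_mem_Icc (δ s : ℝ) : ramp δ s ∈ Icc (0 : ℝ) 1 :=
  ⟨le_max_left _ _, max_le zero_le_one (min_le_left _ _)⟩

theorem ramp_eq_zero {δ s : ℝ} (hδ : 0 < δ) (hs : 1 ≤ s) : ramp δ s = 0 := by
  have : (1 - s) / δ ≤ 0 := div_nonpos_of_nonpos_of_nonneg (by linarith) hδ.le
  exact max_eq_left ((min_le_right _ _).trans this)

theorem ramp_eq_one {δ s : ℝ} (hδ : 0 < δ) (hs : s ≤ 1 - δ) : ramp δ s = 1 := by
  have : 1 ≤ (1 - s) / δ := by rw [le_div_iff₀ hδ]; linarith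
  rw [ramp, min_eq_left this, max_eq_right zero_le_one]

theorem ramp_eq_div {δ s : ℝ} (hδ : 0 < δ) (hs : s ∈ Ioo (1 - δ) 1) :
    ramp δ s = (1 - s) / δ := by
  have h1 : (1 - s) / δ ≤ 1 := by rw [div_le_one hδ]; linarith [hs.1]
  have h0 : 0 ≤ (1 - s) / δ := div_nonneg (by linarith [hs.2]) hδ.le
  rw [ramp, min_eq_right h1, max_eq_right h0]

/-- Where φ ≤ 1 - δ the composite takes its maximal value one, and where φ ≥ 1 its minimal value
zero, so `fderiv` vanishes there, also at the corners, where it may only have its default value. The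
formula thus holds at every point and no null set has to be discarded. -/
theorem fderiv_ramp_comp {φ : EuclideanSpace ℝ (Fin n) → ℝ} {x : EuclideanSpace ℝ (Fin n)}
    (hφ : DifferentiableAt ℝ φ x) {δ : ℝ} (hδ : 0 < δ) (v : EuclideanSpace ℝ (Fin n)) :
    fderiv ℝ (fun y => ramp δ (φ y)) x v =
      -({y | φ y ∈ Ioo (1 - δ) 1}.indicator (fun y => δ⁻¹ * fderiv ℝ φ y v) x) := by
  rcases le_or_gt (φ x) (1 - δ) with h | h
  · have hm : IsLocalMax (fun y => ramp δ (φ y)) x := Eventually.of_forall fun y => by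
      simp only [ramp_eq_one hδ h]
      exact (ramp_mem_Icc _ _).2
    rw [hm.fderiv_eq_zero, indicator_of_notMem (fun hx => absurd hx.1 (not_lt.2 h))]
    simp
  rcases le_or_gt 1 (φ x) with h' | h'
  · have hm : IsLocalMin (fun y => ramp δ (φ y)) x := Eventually.of_forall fun y => by
      simp only [ramp_eq_zero hδ h']
      exact (ramp_mem_Icc _ _).1
    rw [hm.fderiv_eq_zero, indicator_of_notMem (fun hx => absurd hx.2 (not_lt.2 h'))]
    simp
  · have heq : (fun y => ramp δ (φ y)) =ᶠ[𝓝 x] fun y => (1 - φ y) / δ := by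
      filter_upwards [hφ.continuousAt (isOpen_Ioo.mem_nhds ⟨h, h'⟩)] with y hy
      exact ramp_eq_div hδ hy
    have hd : HasFDerivAt (fun y => (1 - φ y) / δ) (δ⁻¹ • (-fderiv ℝ φ x)) x := by
      have := (hφ.hasFDerivAt.const_sub 1).const_smul δ⁻¹
      refine this.congr_of_eventuallyEq (Eventually.of_forall fun y => ?_)
      simp [div_eq_inv_mul]
    rw [heq.fderiv_eq, hd.fderiv, indicator_of_mem (show x ∈ {y | φ y ∈ Ioo (1 - δ) 1} from
      ⟨h, h'⟩)]
    simp

variable {w : EuclideanSpace ℝ (Fin n) → ℝ}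

theorem IsTestField.exists_lipschitzWith (hw : ∀ x ∈ S, LipschitzNear w x)
    {X : EuclideanSpace ℝ (Fin n) → EuclideanSpace ℝ (Fin n)} (hX : IsTestField S X) :
    ∃ K, LipschitzWith K (fun x => w x • X x) :=
  exists_lipschitzWith_smul hw
    (fun x => (hX.1.contDiffAt.of_le (by exact_mod_cast le_top)).lipschitzNear)
    hX.2.1 hX.2.2.1

theorem IsTestField.hasCompactSupport_smul
    {X : EuclideanSpace ℝ (Fin n) → EuclideanSpace ℝ (Fin n)} (hX : IsTestField S X) :
    HasCompactSupport (fun x => w x • X x) := HasCompactSupport.smul_left (f := w) hX.2.1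

theorem divergence_eq_zero {V : EuclideanSpace ℝ (Fin n) → EuclideanSpace ℝ (Fin n)}
    {x : EuclideanSpace ℝ (Fin n)} (hx : x ∉ tsupport V) : divergence V x = 0 := by
  have h : fderiv ℝ V x = 0 := by
    by_contra h
    exact hx (support_fderiv_subset ℝ h)
  simp [divergence, h]

theorem integrable_divergence {V : EuclideanSpace ℝ (Fin n) → EuclideanSpace ℝ (Fin n)}
    {C : ℝ≥0} (hV : LipschitzWith C V) (hVc : HasCompactSupport V) :
    Integrable (divergence V) := by
  refine integrable_finsetSum _ fun i _ => ?_
  have hm : Measurable fun x => (fderiv ℝ V x (EuclideanSpace.single i 1)) i :=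
    (EuclideanSpace.proj i : EuclideanSpace ℝ (Fin n) →L[ℝ] ℝ).measurable.comp
      (measurable_fderiv_apply_const ℝ V _)
  rw [← integrableOn_iff_integrable_of_support_subset (s := tsupport V)]
  · refine IntegrableOn.of_bound hVc.isCompact.measure_lt_top hm.aestronglyMeasurable C
      (ae_of_all _ fun x => ?_)
    calc ‖(fderiv ℝ V x (EuclideanSpace.single i 1)) i‖
        ≤ ‖fderiv ℝ V x (EuclideanSpace.single i 1)‖ := PiLp.norm_apply_le _ i
      _ ≤ ‖fderiv ℝ V x‖ * ‖EuclideanSpace.single i (1 : ℝ)‖ := ContinuousLinearMap.le_opNorm _ _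
      _ ≤ C := by
        rw [PiLp.norm_single, norm_one, mul_one]
        exact norm_fderiv_le_of_lipschitz ℝ hV
  · intro x hx
    by_contra h
    have : fderiv ℝ V x = 0 := by
      by_contra h'
      exact h (support_fderiv_subset ℝ h')
    exact hx (by simp [this])

/-- The ramp of φ is controlled only inside the cone and has no compact support. Multiplying it by a
cutoff equal to one near the support of X makes it globally Lipschitz and changes neither integral.
-/
theorem integral_ramp_mul_divergence (hS : IsOpen S) (hw : ∀ x ∈ S, LipschitzNear w x)
    {φ : EuclideanSpace ℝ (Fin n) → ℝ} (hφ : ContDiffOn ℝ 1 φ S)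
    {X : EuclideanSpace ℝ (Fin n) → EuclideanSpace ℝ (Fin n)} (hX : IsTestField S X)
    {δ : ℝ} (hδ : 0 < δ) :
    ∫ x, ramp δ (φ x) * divergence (fun y => w y • X y) x =
      δ⁻¹ * ∫ x in {x | x ∈ S ∧ φ x ∈ Ioo (1 - δ) 1}, w x * fderiv ℝ φ x (X x) := by
  obtain ⟨C', hV⟩ := hX.exists_lipschitzWith hw
  have hVc : HasCompactSupport fun x => w x • X x := hX.hasCompactSupport_smul
  have hφd : ∀ x ∈ S, ContDiffAt ℝ 1 φ x := fun x hx => hφ.contDiffAt (hS.mem_nhds hx)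
  obtain ⟨χ, hχ, hχc, hχS, hχ1, -⟩ := exists_smooth_cutoff hS hX.2.1.isCompact hX.2.2.1
  obtain ⟨C, hf⟩ := exists_lipschitzWith_smul (S := S) (f := fun x => ramp δ (φ x)) (g := χ)
    (fun x hx => (lipschitzNear_ramp δ (φ x)).comp (hφd x hx).lipschitzNear)
    (fun x => (hχ.contDiffAt.of_le (by exact_mod_cast le_top)).lipschitzNear) hχc hχS
  have hsub : tsupport (fun x => w x • X x) ⊆ tsupport X := tsupport_smul_subset_right _ _
  have hibp := integral_mul_divergence hf
    (HasCompactSupport.smul_left (f := fun x => ramp δ (φ x)) hχc) hV hVc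
  have h1 : ∫ x, ramp δ (φ x) * divergence (fun y => w y • X y) x =
      ∫ x, ramp δ (φ x) • χ x * divergence (fun y => w y • X y) x := by
    refine integral_congr_ae (ae_of_all _ fun x => ?_)
    by_cases hx : x ∈ tsupport X
    · have : χ x = 1 := hχ1.self_of_nhdsSet x hx
      simp [this]
    · simp [divergence_eq_zero fun h => hx (hsub h)]
  have hmeas : MeasurableSet {x | x ∈ S ∧ φ x ∈ Ioo (1 - δ) 1} :=
    (hφ.continuousOn.isOpen_inter_preimage hS isOpen_Ioo).measurableSet
  rw [h1, hibp, ← integral_const_mul, ← integral_indicator hmeas, ← integral_neg]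
  refine integral_congr_ae (ae_of_all _ fun x => ?_)
  by_cases hx : x ∈ tsupport X
  · have hxS := hX.2.2.1 hx
    have heq : (fun x => ramp δ (φ x) • χ x) =ᶠ[𝓝 x] fun x => ramp δ (φ x) := by
      filter_upwards [hχ1.filter_mono (nhds_le_nhdsSet hx)] with y hy
      simp [hy]
    simp only
    rw [heq.fderiv_eq, fderiv_ramp_comp ((hφd x hxS).differentiableAt one_ne_zero) hδ]
    by_cases hm : φ x ∈ Ioo (1 - δ) 1
    · rw [indicator_of_mem (show x ∈ {y | φ y ∈ Ioo (1 - δ) 1} from hm),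
        indicator_of_mem (show x ∈ {x | x ∈ S ∧ φ x ∈ Ioo (1 - δ) 1} from ⟨hxS, hm⟩), map_smul,
        smul_eq_mul, neg_neg]
    · rw [indicator_of_notMem (show x ∉ {y | φ y ∈ Ioo (1 - δ) 1} from hm),
        indicator_of_notMem (show x ∉ {x | x ∈ S ∧ φ x ∈ Ioo (1 - δ) 1} from fun h => hm h.2),
        neg_zero, neg_zero]
  · have : X x = 0 := image_eq_zero_of_notMem_tsupport hx
    simp [this, indicator]

/-- The integral of a divergence over a sublevel set as the limit of integrals over thin shells. -/
theorem tendsto_shell (hS : IsOpen S) (hw : ∀ x ∈ S, LipschitzNear w x)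
    {φ : EuclideanSpace ℝ (Fin n) → ℝ} (hφ : ContDiffOn ℝ 1 φ S)
    {X : EuclideanSpace ℝ (Fin n) → EuclideanSpace ℝ (Fin n)} (hX : IsTestField S X) :
    Tendsto (fun δ : ℝ =>
      δ⁻¹ * ∫ x in {x | x ∈ S ∧ φ x ∈ Ioo (1 - δ) 1}, w x * fderiv ℝ φ x (X x)) (𝓝[>] 0)
      (𝓝 (∫ x in {x | x ∈ S ∧ φ x < 1}, divergence (fun y => w y • X y) x)) := by
  obtain ⟨C', hV⟩ := hX.exists_lipschitzWith hw
  have hVc : HasCompactSupport fun x => w x • X x := hX.hasCompactSupport_smul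
  have hsub : tsupport (fun x => w x • X x) ⊆ S :=
    (tsupport_smul_subset_right _ _).trans hX.2.2.1
  have hint := integrable_divergence hV hVc
  have hmeas : MeasurableSet {x | x ∈ S ∧ φ x < 1} :=
    (hφ.continuousOn.isOpen_inter_preimage hS isOpen_Iio).measurableSet
  have heq : ∀ δ ∈ Ioi (0 : ℝ), δ⁻¹ * ∫ x in {x | x ∈ S ∧ φ x ∈ Ioo (1 - δ) 1},
      w x * fderiv ℝ φ x (X x) =
        ∫ x, S.indicator (fun x => ramp δ (φ x)) x * divergence (fun y => w y • X y) x := by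
    intro δ hδ
    rw [← integral_ramp_mul_divergence hS hw hφ hX hδ]
    refine integral_congr_ae (ae_of_all _ fun x => ?_)
    by_cases hx : x ∈ S
    · simp [hx]
    · simp [divergence_eq_zero fun h => hx (hsub h)]
  rw [← integral_indicator hmeas]
  refine Tendsto.congr' (f₁ := fun δ => ∫ x, S.indicator (fun x => ramp δ (φ x)) x *
    divergence (fun y => w y • X y) x) ?_ ?_
  · filter_upwards [self_mem_nhdsWithin] with δ hδ
    exact (heq δ hδ).symm
  -- The ramps take values in [0, 1] and converge pointwise to the indicator of φ < 1. The indicator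
  -- of `S` secures measurability and is harmless, the field being supported in `S`.
  refine tendsto_integral_filter_of_dominated_convergence
    (fun x => ‖divergence (fun y => w y • X y) x‖) ?_ ?_ hint.norm ?_
  · refine Eventually.of_forall fun δ => AEStronglyMeasurable.mul ?_ hint.aestronglyMeasurable
    have hc : ContinuousOn (fun x => ramp δ (φ x)) S := fun x hx =>
      (((lipschitzNear_ramp δ (φ x)).continuousAt).comp_continuousWithinAt
        (hφ.continuousOn x hx))
    exact (measurable_indicator_of_continuousOn hS hc).aestronglyMeasurable
  · refine Eventually.of_forall fun δ => ae_of_all _ fun x => ?_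
    rw [norm_mul]
    refine mul_le_of_le_one_left (norm_nonneg _) ?_
    by_cases hx : x ∈ S
    · rw [indicator_of_mem hx, Real.norm_eq_abs, abs_of_nonneg (ramp_mem_Icc _ _).1]
      exact (ramp_mem_Icc _ _).2
    · simp [hx]
  · refine ae_of_all _ fun x => ?_
    by_cases hx : x ∈ S
    · simp only [indicator_of_mem hx]
      rcases lt_or_ge (φ x) 1 with h | h
      · rw [indicator_of_mem (show x ∈ {x | x ∈ S ∧ φ x < 1} from ⟨hx, h⟩)]
        refine tendsto_const_nhds.congr' ?_
        filter_upwards [Ioc_mem_nhdsGT (sub_pos.2 h)] with δ hδ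
        rw [ramp_eq_one hδ.1 (by linarith [hδ.2]), one_mul]
      · rw [indicator_of_notMem (fun hx => absurd hx.2 (not_lt.2 h))]
        refine tendsto_const_nhds.congr' ?_
        filter_upwards [self_mem_nhdsWithin] with δ hδ
        rw [ramp_eq_zero hδ h, zero_mul]
    · rw [indicator_of_notMem (fun h => hx h.1)]
      simp [hx]

end IntegrationByParts

/-! ### Integrals over shells in the cone. -/

section ConeIntegrals

variable {n : ℕ} {S : Set (EuclideanSpace ℝ (Fin n))} {α : ℝ}
  {w : EuclideanSpace ℝ (Fin n) → ℝ}

theorem IsAdmissibleWeight.setIntegral_coneMeasure (hw : IsAdmissibleWeight S α w)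
    (hS : IsOpenConvexCone S) {A : Set (EuclideanSpace ℝ (Fin n))} (hA : MeasurableSet A)
    (hAS : A ⊆ S) (f : EuclideanSpace ℝ (Fin n) → ℝ) :
    ∫ x in A, f x ∂(coneMeasure S w) = ∫ x in A, w x * f x := by
  have hm := hw.measurable_coneDensity hS
  have hfin : ∀ x, coneDensity S w x < ⊤ := fun x => by
    by_cases hx : x ∈ S <;> simp [coneDensity, hx]
  rw [coneMeasure, setIntegral_withDensity_eq_setIntegral_toReal_smul hm
    (ae_of_all _ hfin) _ hA]
  refine setIntegral_congr_fun hA fun x hx => ?_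
  simp only [coneDensity, indicator_of_mem (hAS hx), smul_eq_mul,
    ENNReal.toReal_ofReal (hw.nonneg x (subset_closure (hAS hx)))]

theorem IsAdmissibleWeight.integrableOn_starBody (hw : IsAdmissibleWeight S α w)
    (hS : IsOpenConvexCone S) (hn : 1 ≤ n) (hα : 0 < α)
    {R : EuclideanSpace ℝ (Fin n) → ℝ} (hR : Measurable R)
    (hR0 : ∀ θ ∈ S, ‖θ‖ = 1 → 0 ≤ R θ)
    {g : EuclideanSpace ℝ (Fin n) → ℝ} (hg : Measurable g)
    (hi : Integrable (fun θ : sphere (0 : EuclideanSpace ℝ (Fin n)) 1 =>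
      R θ ^ ((n : ℝ) + α) / ((n : ℝ) + α) * g θ) (sphereMeasure S w)) :
    IntegrableOn (fun x => g (dir x)) (starBody S R) (coneMeasure S w) := by
  have hD : 0 < (n : ℝ) + α := by positivity
  refine ⟨(hg.comp measurable_dir).aestronglyMeasurable, ?_⟩
  have h := hw.lintegral_starBody hS hn hα hR hR0 (g := fun x => ‖g x‖ₑ) hg.enorm
  rw [hasFiniteIntegral_iff_enorm, h]
  refine lt_of_le_of_lt (le_of_eq ?_) hi.2
  refine lintegral_congr_ae ?_
  filter_upwards [hw.ae_mem_sphereMeasure hS] with θ hθ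
  have hθ1 : ‖(θ : EuclideanSpace ℝ (Fin n))‖ = 1 := by simp
  have := hR0 _ hθ hθ1
  have h1 : 0 ≤ R θ ^ ((n : ℝ) + α) / ((n : ℝ) + α) := by positivity
  rw [enorm_mul, mul_comm, Real.enorm_of_nonneg h1]

/-- Integrals of functions of the direction over the shell between a star-shaped body and a
dilated copy of it. -/
theorem IsAdmissibleWeight.integral_shell (hw : IsAdmissibleWeight S α w)
    (hS : IsOpenConvexCone S) (hn : 1 ≤ n) (hα : 0 < α)
    {R : EuclideanSpace ℝ (Fin n) → ℝ} (hR : Measurable R)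
    (hR0 : ∀ θ ∈ S, ‖θ‖ = 1 → 0 ≤ R θ) (h0 : (0 : EuclideanSpace ℝ (Fin n)) ∉ S)
    {g : EuclideanSpace ℝ (Fin n) → ℝ} (hg : Measurable g)
    (hi : Integrable (fun θ : sphere (0 : EuclideanSpace ℝ (Fin n)) 1 =>
      R θ ^ ((n : ℝ) + α) / ((n : ℝ) + α) * g θ) (sphereMeasure S w))
    {s : ℝ} (hs0 : 0 ≤ s) (hs1 : s ≤ 1) :
    ∫ x in starBody S R \ starBody S (fun x => s * R x), g (dir x) ∂(coneMeasure S w) =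
      (1 - s ^ ((n : ℝ) + α)) * ∫ θ : sphere (0 : EuclideanSpace ℝ (Fin n)) 1,
        R θ ^ ((n : ℝ) + α) / ((n : ℝ) + α) * g θ ∂(sphereMeasure S w) := by
  have hsub : starBody S (fun x => s * R x) ⊆ starBody S R := fun x hx => by
    have hx0 : x ≠ 0 := fun h => h0 (h ▸ hx.1)
    have h1 := hR0 _ (hS.dir_mem h0 hx.1) (norm_dir hx0)
    exact ⟨hx.1, hx.2.trans_le (mul_le_of_le_one_left h1 hs1)⟩
  rw [setIntegral_sdiff (measurableSet_starBody hS (hR.const_mul s))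
    (hw.integrableOn_starBody hS hn hα hR hR0 hg hi) hsub,
    hw.integral_starBody hS hn hα hR hR0 hg,
    hw.integral_starBody hS hn hα (hR.const_mul s) (fun θ h1 h2 => mul_nonneg hs0 (hR0 θ h1 h2)) hg,
    sub_mul, one_mul, ← integral_const_mul]
  congr 1
  refine integral_congr_ae ?_
  filter_upwards [hw.ae_mem_sphereMeasure hS] with θ hθ
  have hθ1 : ‖(θ : EuclideanSpace ℝ (Fin n))‖ = 1 := by simp
  rw [Real.mul_rpow hs0 (hR0 _ hθ hθ1)]
  ring

end ConeIntegrals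

/-! ### The gauge |x| / ρ(x) of a star-shaped body. -/

section Radial

variable {n : ℕ} {S : Set (EuclideanSpace ℝ (Fin n))}

/-- Radial functions of star-shaped bodies close to the unit ball. -/
structure IsRadialFunction (S : Set (EuclideanSpace ℝ (Fin n)))
    (ρ : EuclideanSpace ℝ (Fin n) → ℝ) : Prop where
  contDiffOn : ContDiffOn ℝ 1 ρ S
  homogeneous : ∀ t : ℝ, 0 < t → ∀ x ∈ S, ρ (t • x) = ρ x
  lower : ∀ x ∈ S, 1 / 2 ≤ ρ x
  upper : ∀ x ∈ S, ρ x ≤ 3 / 2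

variable {ρ : EuclideanSpace ℝ (Fin n) → ℝ}

theorem IsRadialFunction.pos (hρ : IsRadialFunction S ρ) {x : EuclideanSpace ℝ (Fin n)}
    (hx : x ∈ S) : 0 < ρ x := by linarith [hρ.lower x hx]

theorem IsRadialFunction.apply_dir (hρ : IsRadialFunction S ρ)
    (h0 : (0 : EuclideanSpace ℝ (Fin n)) ∉ S) {x : EuclideanSpace ℝ (Fin n)}
    (hx : x ∈ S) : ρ (dir x) = ρ x :=
  hρ.homogeneous _ (inv_pos.2 (norm_pos_iff.2 fun h => h0 (h ▸ hx))) x hx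

theorem IsRadialFunction.hasFDerivAt (hρ : IsRadialFunction S ρ) (hS : IsOpenConvexCone S)
    {x : EuclideanSpace ℝ (Fin n)} (hx : x ∈ S) : HasFDerivAt ρ (fderiv ℝ ρ x) x :=
  ((hρ.contDiffOn.contDiffAt (hS.isOpen.mem_nhds hx)).differentiableAt one_ne_zero).hasFDerivAt

/-- Euler's relation in degree zero: ρ is constant along the ray through x. -/
theorem IsRadialFunction.fderiv_self (hρ : IsRadialFunction S ρ) (hS : IsOpenConvexCone S)
    {x : EuclideanSpace ℝ (Fin n)} (hx : x ∈ S) : fderiv ℝ ρ x x = 0 := by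
  have h1 : HasDerivAt (fun t : ℝ => t • x) ((1 : ℝ) • x) 1 :=
    (hasDerivAt_id (1 : ℝ)).smul_const x
  have h2 : HasFDerivAt ρ (fderiv ℝ ρ x) ((1 : ℝ) • x) := by
    rw [one_smul]; exact hρ.hasFDerivAt hS hx
  have h3 := h2.comp_hasDerivAt (1 : ℝ) h1
  have h4 : HasDerivAt (ρ ∘ fun t : ℝ => t • x) 0 1 := by
    refine (hasDerivAt_const (1 : ℝ) (ρ x)).congr_of_eventuallyEq ?_
    filter_upwards [lt_mem_nhds one_pos] with t ht
    exact hρ.homogeneous t ht x hx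
  simpa using h3.unique h4

theorem IsRadialFunction.fderiv_smul (hρ : IsRadialFunction S ρ) (hS : IsOpenConvexCone S)
    {x : EuclideanSpace ℝ (Fin n)} (hx : x ∈ S) {t : ℝ} (ht : 0 < t) :
    fderiv ℝ ρ x = t • fderiv ℝ ρ (t • x) := by
  have h1 : HasFDerivAt (fun y : EuclideanSpace ℝ (Fin n) => t • y)
      (t • ContinuousLinearMap.id ℝ (EuclideanSpace ℝ (Fin n))) x :=
    (hasFDerivAt_id x).const_smul t
  have h2 := (hρ.hasFDerivAt hS (hS.smul_mem t ht x hx)).comp x h1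
  have h3 : HasFDerivAt (ρ ∘ fun y => t • y) (fderiv ℝ ρ x) x := by
    refine (hρ.hasFDerivAt hS hx).congr_of_eventuallyEq ?_
    filter_upwards [hS.isOpen.mem_nhds hx] with y hy
    exact hρ.homogeneous t ht y hy
  rw [h3.unique h2]
  ext v
  simp

/-- The derivative is homogeneous of degree -1. This is what makes the bound for the gradient of the
gauge depend on the direction only. -/
theorem IsRadialFunction.norm_fderiv_dir (hρ : IsRadialFunction S ρ) (hS : IsOpenConvexCone S)
    (h0 : (0 : EuclideanSpace ℝ (Fin n)) ∉ S)
    {x : EuclideanSpace ℝ (Fin n)} (hx : x ∈ S) :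
    ‖fderiv ℝ ρ (dir x)‖ = ‖x‖ * ‖fderiv ℝ ρ x‖ := by
  have hx0 : 0 < ‖x‖ := norm_pos_iff.2 fun h => h0 (h ▸ hx)
  have h := hρ.fderiv_smul hS (hS.dir_mem h0 hx) hx0
  rw [norm_smul_dir] at h
  rw [h, norm_smul, norm_norm]

theorem IsRadialFunction.hasFDerivAt_gauge (hρ : IsRadialFunction S ρ) (hS : IsOpenConvexCone S)
    (h0 : (0 : EuclideanSpace ℝ (Fin n)) ∉ S) {x : EuclideanSpace ℝ (Fin n)} (hx : x ∈ S) :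
    HasFDerivAt (fun y => ‖y‖ / ρ y)
      ((ρ x)⁻¹ • innerSL ℝ (dir x) - (‖x‖ / ρ x ^ 2) • fderiv ℝ ρ x) x := by
  have hx0 : x ≠ 0 := fun h => h0 (h ▸ hx)
  have hn : HasFDerivAt (fun y : EuclideanSpace ℝ (Fin n) => ‖y‖) (innerSL ℝ (dir x)) x := by
    have h1 := (hasStrictFDerivAt_norm_sq x).hasFDerivAt.sqrt
      (pow_ne_zero 2 (norm_ne_zero_iff.2 hx0))
    simp only [Real.sqrt_sq (norm_nonneg _)] at h1
    refine h1.congr_fderiv ?_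
    ext v
    have hxn : ‖x‖ ≠ 0 := norm_ne_zero_iff.2 hx0
    simp [dir]
    field_simp
  have h2 := hn.mul ((hasDerivAt_inv (hρ.pos hx).ne').comp_hasFDerivAt x (hρ.hasFDerivAt hS hx))
  refine (h2.congr_of_eventuallyEq (Eventually.of_forall fun y => div_eq_mul_inv _ _)).congr_fderiv
    ?_
  ext v
  simp
  ring

/-- Decompose v = su + z with z orthogonal to u. As L kills u, the quantity is as - bL(z), which by
Cauchy–Schwarz is at most √(a² + b²‖L‖²). The bound is the elementary majorant √(a² + y²) ≤ a +
y²/(2a), exact to second order, so that no square root enters the perimeter integral. -/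
theorem abs_inner_sub_le {E : Type*} [NormedAddCommGroup E] [InnerProductSpace ℝ E] {u : E}
    (hu : ‖u‖ = 1) (L : E →L[ℝ] ℝ) (hL : L u = 0) {a b : ℝ} (ha : 0 < a) (v : E)
    (hv : ‖v‖ ≤ 1) :
    |a * inner ℝ u v - b * L v| ≤ a + (b * ‖L‖) ^ 2 / (2 * a) := by
  set s := inner ℝ u v with hs
  set z := v - s • u with hz
  have h1 : L v = L z := by simp [hz, hL]
  have h2 : ‖z‖ ^ 2 = ‖v‖ ^ 2 - s ^ 2 := by
    rw [hz, norm_sub_sq_real, norm_smul, hu, inner_smul_right, real_inner_comm, ← hs,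
      Real.norm_eq_abs, mul_one, sq_abs]
    ring
  have h3 : |L z| ≤ ‖L‖ * ‖z‖ := L.le_opNorm z
  have h4 : L z ^ 2 ≤ ‖L‖ ^ 2 * ‖z‖ ^ 2 := by
    rw [← mul_pow, ← sq_abs (L z)]
    exact pow_le_pow_left₀ (abs_nonneg _) h3 2
  have h5 : ‖v‖ ^ 2 ≤ 1 := pow_le_one₀ (norm_nonneg _) hv
  have h6 : 0 ≤ a + (b * ‖L‖) ^ 2 / (2 * a) := by positivity
  refine abs_le_of_sq_le_sq ?_ h6
  have h7 : (a + (b * ‖L‖) ^ 2 / (2 * a)) ^ 2 = a ^ 2 + (b * ‖L‖) ^ 2 +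
      ((b * ‖L‖) ^ 2 / (2 * a)) ^ 2 := by
    field_simp
    ring
  -- Cauchy–Schwarz in the plane, with |L z| ≤ ‖L‖ ‖z‖.
  have h8 : (a * s - b * L z) ^ 2 ≤ (a ^ 2 + (b * ‖L‖) ^ 2) * (s ^ 2 + ‖z‖ ^ 2) := by
    have e1 : (b * L z) ^ 2 ≤ (b * ‖L‖) ^ 2 * ‖z‖ ^ 2 := by
      rw [mul_pow, mul_pow, mul_assoc]
      exact mul_le_mul_of_nonneg_left h4 (sq_nonneg b)
    have e2 : |b * L z| ≤ |b| * ‖L‖ * ‖z‖ := by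
      rw [abs_mul, mul_assoc]
      exact mul_le_mul_of_nonneg_left h3 (abs_nonneg b)
    have e3 : -(2 * (a * s) * (b * L z)) ≤ 2 * (a * |s|) * (|b| * ‖L‖ * ‖z‖) := by
      calc -(2 * (a * s) * (b * L z)) ≤ |2 * (a * s) * (b * L z)| := neg_le_abs _
        _ = 2 * (a * |s|) * |b * L z| := by
          rw [abs_mul, abs_mul, abs_mul a, abs_of_pos ha, abs_two]
        _ ≤ _ := mul_le_mul_of_nonneg_left e2 (by positivity)
    have e4 : 2 * (a * |s|) * (|b| * ‖L‖ * ‖z‖) ≤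
        (a * ‖z‖) ^ 2 + (|s| * (|b| * ‖L‖)) ^ 2 := by
      nlinarith [sq_nonneg (a * ‖z‖ - |s| * (|b| * ‖L‖))]
    have e5 : (|s| * (|b| * ‖L‖)) ^ 2 = s ^ 2 * (b * ‖L‖) ^ 2 := by
      rw [mul_pow, mul_pow, mul_pow, sq_abs, sq_abs]
    nlinarith
  rw [h1, h7]
  have h9 : (a ^ 2 + (b * ‖L‖) ^ 2) * (s ^ 2 + ‖z‖ ^ 2) ≤ a ^ 2 + (b * ‖L‖) ^ 2 := by
    refine mul_le_of_le_one_right (by positivity) ?_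
    rw [h2]; linarith
  nlinarith [sq_nonneg ((b * ‖L‖) ^ 2 / (2 * a))]

theorem IsRadialFunction.contDiffOn_gauge (hρ : IsRadialFunction S ρ)
    (h0 : (0 : EuclideanSpace ℝ (Fin n)) ∉ S) : ContDiffOn ℝ 1 (fun y => ‖y‖ / ρ y) S :=
  (contDiffOn_id.norm ℝ fun _ hx h => h0 (h ▸ hx)).div hρ.contDiffOn fun _ hx => (hρ.pos hx).ne'

/-- The radial part of the gradient of the gauge has size 1/ρ and the tangential part |x| |∇ρ| / ρ².
The resulting bound is a function of the direction, hence can be integrated over a shell in polar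
coordinates. -/
theorem IsRadialFunction.abs_fderiv_gauge_le (hρ : IsRadialFunction S ρ)
    (hS : IsOpenConvexCone S) (h0 : (0 : EuclideanSpace ℝ (Fin n)) ∉ S)
    {x : EuclideanSpace ℝ (Fin n)} (hx : x ∈ S) {v : EuclideanSpace ℝ (Fin n)} (hv : ‖v‖ ≤ 1) :
    |fderiv ℝ (fun y => ‖y‖ / ρ y) x v| ≤
      (ρ (dir x))⁻¹ + ‖fderiv ℝ ρ (dir x)‖ ^ 2 / (2 * ρ (dir x) ^ 3) := by
  have hx0 : x ≠ 0 := fun h => h0 (h ▸ hx)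
  have hp := hρ.pos hx
  have hL : fderiv ℝ ρ x (dir x) = 0 := by rw [dir, map_smul, hρ.fderiv_self hS hx, smul_zero]
  have h := abs_inner_sub_le (norm_dir hx0) (fderiv ℝ ρ x) hL (inv_pos.2 hp) v hv
    (b := ‖x‖ / ρ x ^ 2)
  rw [(hρ.hasFDerivAt_gauge hS h0 hx).fderiv, hρ.norm_fderiv_dir hS h0 hx, hρ.apply_dir h0 hx]
  refine (le_of_eq ?_).trans (h.trans (le_of_eq ?_))
  · simp
  · field_simp

theorem IsRadialFunction.fderiv_gauge_self (hρ : IsRadialFunction S ρ)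
    (hS : IsOpenConvexCone S) (h0 : (0 : EuclideanSpace ℝ (Fin n)) ∉ S)
    {x : EuclideanSpace ℝ (Fin n)} (hx : x ∈ S) :
    fderiv ℝ (fun y => ‖y‖ / ρ y) x (dir x) = (ρ (dir x))⁻¹ := by
  have hx0 : x ≠ 0 := fun h => h0 (h ▸ hx)
  have hL : fderiv ℝ ρ x (dir x) = 0 := by rw [dir, map_smul, hρ.fderiv_self hS hx, smul_zero]
  rw [(hρ.hasFDerivAt_gauge hS h0 hx).fderiv, hρ.apply_dir h0 hx]
  simp [hL, norm_dir hx0]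

end Radial

/-! ### Two-sided perimeter bounds for star-shaped bodies. -/

section Perimeter

variable {n : ℕ} {S : Set (EuclideanSpace ℝ (Fin n))} {α : ℝ}
  {w ρ : EuclideanSpace ℝ (Fin n) → ℝ}

theorem IsRadialFunction.measurable_indicator (hρ : IsRadialFunction S ρ)
    (hS : IsOpenConvexCone S) : Measurable (S.indicator ρ) :=
  measurable_indicator_of_continuousOn hS.isOpen hρ.contDiffOn.continuousOn

theorem IsRadialFunction.indicator_nonneg (hρ : IsRadialFunction S ρ) :
    ∀ θ ∈ S, ‖θ‖ = 1 → 0 ≤ S.indicator ρ θ := fun θ hθ _ => by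
  rw [indicator_of_mem hθ]
  exact (hρ.pos hθ).le

theorem IsRadialFunction.indicator_dir (hρ : IsRadialFunction S ρ) (hS : IsOpenConvexCone S)
    (h0 : (0 : EuclideanSpace ℝ (Fin n)) ∉ S) {x : EuclideanSpace ℝ (Fin n)} (hx : x ∈ S) :
    S.indicator ρ (dir x) = ρ x := by
  rw [indicator_of_mem (hS.dir_mem h0 hx), hρ.apply_dir h0 hx]

theorem IsRadialFunction.gauge_lt_iff (hρ : IsRadialFunction S ρ) (hS : IsOpenConvexCone S)
    (h0 : (0 : EuclideanSpace ℝ (Fin n)) ∉ S) {x : EuclideanSpace ℝ (Fin n)} (hx : x ∈ S)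
    (s : ℝ) : ‖x‖ / ρ x < s ↔ x ∈ starBody S (fun x => s * S.indicator ρ x) := by
  rw [div_lt_iff₀ (hρ.pos hx)]
  simp only [starBody, mem_ofPred_eq, hx, true_and, hρ.indicator_dir hS h0 hx]

theorem IsRadialFunction.sublevel_eq (hρ : IsRadialFunction S ρ) (hS : IsOpenConvexCone S)
    (h0 : (0 : EuclideanSpace ℝ (Fin n)) ∉ S) :
    {x | x ∈ S ∧ ‖x‖ / ρ x < 1} = starBody S (S.indicator ρ) := by
  ext x
  by_cases hx : x ∈ S
  · simp only [mem_ofPred_eq, hx, true_and, hρ.gauge_lt_iff hS h0 hx, one_mul]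
  · simp only [mem_ofPred_eq, hx, false_and, starBody]

/-- Bernoulli's inequality; it bounds the volume of a shell by its thickness uniformly, as the upper
perimeter bound requires. -/
theorem one_sub_rpow_le {D δ : ℝ} (hD : 1 ≤ D) (hδ : δ ≤ 1) : 1 - (1 - δ) ^ D ≤ D * δ := by
  have := one_add_mul_self_le_rpow_one_add (s := -δ) (by linarith) hD
  rw [← sub_eq_add_neg] at this
  linarith

/-- The correction δ² lets a half-closed shell fit inside the open shell of thickness δ without
changing the limit. -/
theorem tendsto_one_sub_rpow (D : ℝ) :
    Tendsto (fun δ : ℝ => δ⁻¹ * (1 - (1 - (δ - δ ^ 2)) ^ D)) (𝓝[>] 0) (𝓝 D) := by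
  have h1 : HasDerivAt (fun δ : ℝ => 1 - (δ - δ ^ 2)) (-1) 0 := by
    have := ((hasDerivAt_id (0 : ℝ)).sub (hasDerivAt_pow 2 (0 : ℝ))).const_sub 1
    simpa using this
  have h2 : HasDerivAt (fun δ : ℝ => 1 - (1 - (δ - δ ^ 2)) ^ D) D 0 := by
    have := (h1.rpow_const (p := D) (Or.inl (by norm_num))).const_sub 1
    simpa using this
  have h3 := h2.tendsto_slope_zero_right
  simpa using h3

/-- Every test field has norm at most one, so its shell averages are at most those of the gradient
bound for the gauge. In polar coordinates the average is at most the stated integral for each δ ≤ 1,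
and so is its limit. The integrand is ρ^(D-1) + ρ^(D-3)|∇ρ|²/2. -/
theorem IsAdmissibleWeight.wPer_starBody_le (hw : IsAdmissibleWeight S α w)
    (hS : IsOpenConvexCone S) (hn : 1 ≤ n) (hα : 0 < α)
    (h0 : (0 : EuclideanSpace ℝ (Fin n)) ∉ S) (hρ : IsRadialFunction S ρ)
    (hi : Integrable (fun θ : sphere (0 : EuclideanSpace ℝ (Fin n)) 1 =>
      ρ θ ^ ((n : ℝ) + α) * ((ρ θ)⁻¹ + ‖fderiv ℝ ρ θ‖ ^ 2 / (2 * ρ θ ^ 3)))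
      (sphereMeasure S w)) :
    wPer S w (starBody S (S.indicator ρ)) ≤ ENNReal.ofReal
      (∫ θ : sphere (0 : EuclideanSpace ℝ (Fin n)) 1,
        ρ θ ^ ((n : ℝ) + α) * ((ρ θ)⁻¹ + ‖fderiv ℝ ρ θ‖ ^ 2 / (2 * ρ θ ^ 3))
        ∂(sphereMeasure S w)) := by
  have hn1 : (1 : ℝ) ≤ n := by exact_mod_cast hn
  have hD1 : 1 ≤ (n : ℝ) + α := by linarith
  have hD : 0 < (n : ℝ) + α := by linarith
  have hwL : ∀ x ∈ S, LipschitzNear w x := fun x hx => hw.lipschitzNear hS hα hx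
  set G : EuclideanSpace ℝ (Fin n) → ℝ :=
    S.indicator fun x => (ρ x)⁻¹ + ‖fderiv ℝ ρ x‖ ^ 2 / (2 * ρ x ^ 3) with hG
  have hGm : Measurable G := by
    have hd : ContinuousOn (fderiv ℝ ρ) S :=
      hρ.contDiffOn.continuousOn_fderiv_of_isOpen hS.isOpen le_rfl
    have hc := hρ.contDiffOn.continuousOn
    refine measurable_indicator_of_continuousOn hS.isOpen ?_
    refine (hc.inv₀ fun x hx => (hρ.pos hx).ne').add
      ((hd.norm.pow 2).div (continuousOn_const.mul (hc.pow 3)) fun x hx => ?_)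
    have := hρ.pos hx
    positivity
  have hRm := hρ.measurable_indicator hS
  set J : ℝ := ∫ θ : sphere (0 : EuclideanSpace ℝ (Fin n)) 1,
        ρ θ ^ ((n : ℝ) + α) * ((ρ θ)⁻¹ + ‖fderiv ℝ ρ θ‖ ^ 2 / (2 * ρ θ ^ 3))
        ∂(sphereMeasure S w) with hJ
  have hae : (fun θ : sphere (0 : EuclideanSpace ℝ (Fin n)) 1 =>
      ((n : ℝ) + α)⁻¹ * (ρ θ ^ ((n : ℝ) + α) *
        ((ρ θ)⁻¹ + ‖fderiv ℝ ρ θ‖ ^ 2 / (2 * ρ θ ^ 3)))) =ᵐ[sphereMeasure S w]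
      fun θ => S.indicator ρ θ ^ ((n : ℝ) + α) / ((n : ℝ) + α) * G θ := by
    filter_upwards [hw.ae_mem_sphereMeasure hS] with θ hθ
    rw [hG, indicator_of_mem hθ, indicator_of_mem hθ]
    ring
  have hi' := (hi.const_mul ((n : ℝ) + α)⁻¹).congr hae
  have hJ' : ∫ θ : sphere (0 : EuclideanSpace ℝ (Fin n)) 1,
      S.indicator ρ θ ^ ((n : ℝ) + α) / ((n : ℝ) + α) * G θ ∂(sphereMeasure S w) =
      ((n : ℝ) + α)⁻¹ * J := by
    rw [← integral_congr_ae hae, integral_const_mul]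
  have hJ0 : 0 ≤ J := by
    refine integral_nonneg_of_ae ?_
    filter_upwards [hw.ae_mem_sphereMeasure hS] with θ hθ
    have := hρ.pos hθ
    simp only [Pi.zero_apply]
    positivity
  refine iSup₂_le fun X hX => ENNReal.ofReal_le_ofReal ?_
  have hlim := tendsto_shell hS.isOpen hwL (hρ.contDiffOn_gauge h0) hX
  rw [← hρ.sublevel_eq hS h0]
  refine le_of_tendsto hlim ?_
  filter_upwards [Ioc_mem_nhdsGT one_pos] with δ hδ
  have hmeas : MeasurableSet {x | x ∈ S ∧ ‖x‖ / ρ x ∈ Ioo (1 - δ) 1} :=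
    ((hρ.contDiffOn_gauge h0).continuousOn.isOpen_inter_preimage hS.isOpen
      isOpen_Ioo).measurableSet
  have hsub : {x | x ∈ S ∧ ‖x‖ / ρ x ∈ Ioo (1 - δ) 1} ⊆
      starBody S (S.indicator ρ) \ starBody S (fun x => (1 - δ) * S.indicator ρ x) := by
    rintro x ⟨hx, h1, h2⟩
    rw [hρ.gauge_lt_iff hS h0 hx] at h2
    simp only [one_mul] at h2
    exact ⟨h2, fun h => absurd ((hρ.gauge_lt_iff hS h0 hx _).2 h) (not_lt.2 h1.le)⟩
  have hGint : IntegrableOn (fun x => G (dir x)) (starBody S (S.indicator ρ) \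
      starBody S (fun x => (1 - δ) * S.indicator ρ x)) (coneMeasure S w) :=
    (hw.integrableOn_starBody hS hn hα hRm hρ.indicator_nonneg hGm hi').mono_set sdiff_subset
  have hG0 : ∀ x, 0 ≤ G x := fun x => by
    refine Set.indicator_nonneg (fun x hx => ?_) x
    have := hρ.pos hx
    positivity
  rw [← hw.setIntegral_coneMeasure hS hmeas (fun x hx => hx.1)
    (fun x => fderiv ℝ (fun y => ‖y‖ / ρ y) x (X x))]
  have hle : ∫ x in {x | x ∈ S ∧ ‖x‖ / ρ x ∈ Ioo (1 - δ) 1},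
      fderiv ℝ (fun y => ‖y‖ / ρ y) x (X x) ∂(coneMeasure S w) ≤
      ∫ x in starBody S (S.indicator ρ) \ starBody S (fun x => (1 - δ) * S.indicator ρ x),
        G (dir x) ∂(coneMeasure S w) := by
    refine (Real.le_norm_self _).trans ?_
    refine (norm_integral_le_of_norm_le (hGint.mono_set hsub) ?_).trans
      (setIntegral_mono_set hGint (ae_of_all _ fun x => hG0 _)
        (Eventually.of_forall hsub))
    filter_upwards [ae_restrict_mem hmeas] with x hx
    rw [hG, indicator_of_mem (hS.dir_mem h0 hx.1)]
    exact hρ.abs_fderiv_gauge_le hS h0 hx.1 (hX.2.2.2 x)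
  rw [hw.integral_shell hS hn hα hRm hρ.indicator_nonneg h0 hGm hi' (by linarith [hδ.2])
    (by linarith [hδ.1]), hJ'] at hle
  calc _ ≤ δ⁻¹ * ((1 - (1 - δ) ^ ((n : ℝ) + α)) * (((n : ℝ) + α)⁻¹ * J)) := by
        have := hδ.1
        gcongr
    _ ≤ δ⁻¹ * ((((n : ℝ) + α) * δ) * (((n : ℝ) + α)⁻¹ * J)) := by
        have := hδ.1
        gcongr
        exact one_sub_rpow_le hD1 hδ.2
    _ = J := by
        have := hδ.1.ne'
        field_simp

/-- The competitor is the radial field x/|x|, along which the gauge has derivative 1/ρ, so ρ^D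
becomes ρ^(D-1). Test fields must be compactly supported in the open cone; hence the cutoff, and the
restriction to a compact set of directions. -/
theorem IsAdmissibleWeight.setIntegral_le_wPer (hw : IsAdmissibleWeight S α w)
    (hS : IsOpenConvexCone S) (hn : 1 ≤ n) (hα : 0 < α)
    (h0 : (0 : EuclideanSpace ℝ (Fin n)) ∉ S) (hρ : IsRadialFunction S ρ)
    {K : Set (sphere (0 : EuclideanSpace ℝ (Fin n)) 1)} (hK : IsCompact K) (hKS : K ⊆ sphereIn S) :
    ENNReal.ofReal (∫ θ in K, ρ θ ^ ((n : ℝ) + α - 1) ∂(sphereMeasure S w)) ≤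
      wPer S w (starBody S (S.indicator ρ)) := by
  have hD : 0 < (n : ℝ) + α := by positivity
  have hwL : ∀ x ∈ S, LipschitzNear w x := fun x hx => hw.lipschitzNear hS hα hx
  have hfin := hw.isFiniteMeasure_sphereMeasure
  have hRm := hρ.measurable_indicator hS
  let K₁ : Set (EuclideanSpace ℝ (Fin n)) := Subtype.val '' K
  have hK₁ : IsCompact K₁ := hK.image continuous_subtype_val
  have hK₁S : K₁ ⊆ S := by rintro _ ⟨θ, hθ, rfl⟩; exact hKS hθ
  -- `L` contains the shell points with direction in `K`: for δ ≤ 1/2 their norm exceeds (1 - δ)ρ ≥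
  -- 1/4 and is below ρ ≤ 3/2.
  let L : Set (EuclideanSpace ℝ (Fin n)) :=
    (fun p : ℝ × EuclideanSpace ℝ (Fin n) => p.1 • p.2) '' (Icc (1 / 4) 2 ×ˢ K₁)
  have hL : IsCompact L := (isCompact_Icc.prod hK₁).image (by fun_prop)
  have hLS : L ⊆ S := by
    rintro _ ⟨⟨t, x⟩, ⟨ht, hx⟩, rfl⟩
    exact hS.smul_mem t (by linarith [ht.1]) x (hK₁S hx)
  obtain ⟨χ, hχ, hχc, hχS, hχ1, hχI⟩ := exists_smooth_cutoff hS.isOpen hL hLS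
  have hX : IsTestField S fun x => χ x • dir x := by
    refine ⟨?_, HasCompactSupport.smul_right (f := χ) hχc,
      (tsupport_smul_subset_left χ _).trans hχS, fun x => ?_⟩
    · refine contDiff_iff_contDiffAt.2 fun x => ?_
      by_cases hx : x ∈ tsupport χ
      · have hx0 : x ≠ 0 := fun h => h0 (h ▸ hχS hx)
        exact hχ.contDiffAt.smul (((contDiffAt_norm ℝ hx0).inv
          (norm_ne_zero_iff.2 hx0)).smul contDiffAt_id)
      · refine contDiffAt_const (c := 0) |>.congr_of_eventuallyEq ?_
        filter_upwards [(isClosed_tsupport χ).isOpen_compl.mem_nhds hx] with y hy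
        rw [image_eq_zero_of_notMem_tsupport hy, zero_smul]
    · rw [norm_smul, Real.norm_eq_abs, abs_of_nonneg (hχI x).1]
      have h1 : ‖dir x‖ ≤ 1 := by
        by_cases hx : x = 0
        · simp [hx, dir]
        · exact (norm_dir hx).le
      exact mul_le_one₀ (hχI x).2 (norm_nonneg _) h1
  refine le_trans (ENNReal.ofReal_le_ofReal ?_) (le_iSup₂
    (f := fun X (_ : IsTestField S X) => ENNReal.ofReal (∫ x in starBody S (S.indicator ρ),
      divergence (fun y => w y • X y) x)) (fun x => χ x • dir x) hX)
  have hlim := tendsto_shell hS.isOpen hwL (hρ.contDiffOn_gauge h0) hX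
  rw [← hρ.sublevel_eq hS h0]
  set g : EuclideanSpace ℝ (Fin n) → ℝ := K₁.indicator fun x => (S.indicator ρ x)⁻¹ with hg
  have hgm : Measurable g := hRm.inv.indicator hK₁.isClosed.measurableSet
  set J : ℝ := ∫ θ in K, ρ θ ^ ((n : ℝ) + α - 1) ∂(sphereMeasure S w) with hJ
  have hae : (fun θ : sphere (0 : EuclideanSpace ℝ (Fin n)) 1 =>
      ((n : ℝ) + α)⁻¹ * K.indicator (fun θ => ρ θ ^ ((n : ℝ) + α - 1)) θ) =ᵐ[sphereMeasure S w]
      fun θ => S.indicator ρ θ ^ ((n : ℝ) + α) / ((n : ℝ) + α) * g θ := by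
    filter_upwards [hw.ae_mem_sphereMeasure hS] with θ hθ
    have hp := hρ.pos hθ
    by_cases hθK : θ ∈ K
    · rw [hg, indicator_of_mem hθ, indicator_of_mem hθK,
        indicator_of_mem (show (θ : EuclideanSpace ℝ (Fin n)) ∈ K₁ from ⟨θ, hθK, rfl⟩),
        indicator_of_mem hθ, Real.rpow_sub_one hp.ne']
      ring
    · have : (θ : EuclideanSpace ℝ (Fin n)) ∉ K₁ := by
        rintro ⟨θ', h1, h2⟩
        exact hθK (Subtype.ext h2 ▸ h1)
      rw [hg, indicator_of_notMem hθK, indicator_of_notMem this]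
      simp
  have hJi : Integrable (K.indicator (fun θ => ρ θ ^ ((n : ℝ) + α - 1))) (sphereMeasure S w) := by
    rw [integrable_indicator_iff hK.isClosed.measurableSet]
    refine ContinuousOn.integrableOn_compact hK ?_
    have hc : ContinuousOn (fun θ : sphere (0 : EuclideanSpace ℝ (Fin n)) 1 => ρ θ) K :=
      hρ.contDiffOn.continuousOn.comp continuous_subtype_val.continuousOn fun θ hθ => hKS hθ
    exact hc.rpow_const fun θ hθ => Or.inl (hρ.pos (hKS hθ)).ne'
  have hi' := (hJi.const_mul ((n : ℝ) + α)⁻¹).congr hae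
  have hJ' : ∫ θ : sphere (0 : EuclideanSpace ℝ (Fin n)) 1,
      S.indicator ρ θ ^ ((n : ℝ) + α) / ((n : ℝ) + α) * g θ ∂(sphereMeasure S w) =
      ((n : ℝ) + α)⁻¹ * J := by
    rw [← integral_congr_ae hae, integral_const_mul, integral_indicator hK.isClosed.measurableSet]
  have hlim' : Tendsto (fun δ : ℝ => δ⁻¹ * (1 - (1 - (δ - δ ^ 2)) ^ ((n : ℝ) + α)) *
      (((n : ℝ) + α)⁻¹ * J)) (𝓝[>] 0) (𝓝 J) := by
    have := (tendsto_one_sub_rpow ((n : ℝ) + α)).mul_const (((n : ℝ) + α)⁻¹ * J)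
    rwa [mul_inv_cancel_left₀ hD.ne'] at this
  refine le_of_tendsto_of_tendsto hlim' hlim ?_
  filter_upwards [Ioc_mem_nhdsGT (show (0 : ℝ) < 1 / 2 by norm_num)] with δ hδ
  have hδ0 := hδ.1
  have hδ2 : δ ^ 2 < δ := by nlinarith [hδ.2]
  have hmeas : MeasurableSet {x | x ∈ S ∧ ‖x‖ / ρ x ∈ Ioo (1 - δ) 1} :=
    ((hρ.contDiffOn_gauge h0).continuousOn.isOpen_inter_preimage hS.isOpen
      isOpen_Ioo).measurableSet
  -- This difference of bodies contains its inner boundary; the thickness δ - δ² keeps it within the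
  -- open shell.
  set B := starBody S (S.indicator ρ) \ starBody S (fun x => (1 - (δ - δ ^ 2)) * S.indicator ρ x)
    with hB
  have hsub : B ⊆ {x | x ∈ S ∧ ‖x‖ / ρ x ∈ Ioo (1 - δ) 1} := by
    rintro x ⟨h1, h2⟩
    have hx : x ∈ S := h1.1
    have h1' : ‖x‖ / ρ x < 1 := (hρ.gauge_lt_iff hS h0 hx 1).2 (by simpa using h1)
    refine ⟨hx, lt_of_not_ge fun h => h2 ?_, h1'⟩
    have h3 : 0 < δ ^ 2 := by positivity
    exact (hρ.gauge_lt_iff hS h0 hx _).1 (by linarith)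
  have hBm : MeasurableSet B :=
    (measurableSet_starBody hS hRm).diff (measurableSet_starBody hS (hRm.const_mul _))
  have hder : ∀ x ∈ S, fderiv ℝ (fun y => ‖y‖ / ρ y) x (χ x • dir x) = χ x * (ρ x)⁻¹ := by
    intro x hx
    rw [map_smul, hρ.fderiv_gauge_self hS h0 hx, hρ.apply_dir h0 hx, smul_eq_mul]
  have hfμ : coneMeasure S w {x | x ∈ S ∧ ‖x‖ / ρ x ∈ Ioo (1 - δ) 1} < ⊤ := by
    refine lt_of_le_of_lt (measure_mono (t := starBody S (S.indicator ρ)) fun x hx => ?_) ?_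
    · simpa using (hρ.gauge_lt_iff hS h0 hx.1 1).1 hx.2.2
    · rw [hw.coneMeasure_starBody hS hn hα hRm hρ.indicator_nonneg]
      refine lt_of_le_of_lt (lintegral_mono_ae (g := fun _ => ENNReal.ofReal
        ((3 / 2 : ℝ) ^ ((n : ℝ) + α) / ((n : ℝ) + α))) ?_) ?_
      · filter_upwards [hw.ae_mem_sphereMeasure hS] with θ hθ
        rw [indicator_of_mem hθ]
        have h1 := (hρ.pos hθ).le
        have h2 := hρ.upper _ hθ
        gcongr
      · rw [lintegral_const]
        exact ENNReal.mul_lt_top ENNReal.ofReal_lt_top (measure_lt_top _ _)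
  have hint : IntegrableOn (fun x => χ x * (ρ x)⁻¹) {x | x ∈ S ∧ ‖x‖ / ρ x ∈ Ioo (1 - δ) 1}
      (coneMeasure S w) := by
    refine IntegrableOn.of_bound hfμ ?_ 2 ?_
    · have hc : ContinuousOn (fun x => χ x * (ρ x)⁻¹) S :=
        hχ.continuous.continuousOn.mul
          (hρ.contDiffOn.continuousOn.inv₀ fun x hx => (hρ.pos hx).ne')
      exact (hc.mono fun x hx => hx.1).aestronglyMeasurable hmeas
    · filter_upwards [ae_restrict_mem hmeas] with x hx
      have hp := hρ.pos hx.1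
      have h1 : (ρ x)⁻¹ ≤ 2 := by
        rw [inv_le_comm₀ hp two_pos]
        linarith [hρ.lower x hx.1]
      rw [Real.norm_eq_abs, abs_of_nonneg (mul_nonneg (hχI x).1 (inv_nonneg.2 hp.le))]
      exact (mul_le_of_le_one_left (inv_nonneg.2 hp.le) (hχI x).2).trans h1
  have hle : ∫ x in B, g (dir x) ∂(coneMeasure S w) ≤
      ∫ x in {x | x ∈ S ∧ ‖x‖ / ρ x ∈ Ioo (1 - δ) 1}, χ x * (ρ x)⁻¹ ∂(coneMeasure S w) := by
    refine le_trans (setIntegral_mono_on ?_ (hint.mono_set hsub) hBm fun x hx => ?_)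
      (setIntegral_mono_set hint ?_ (Eventually.of_forall hsub))
    · exact (hw.integrableOn_starBody hS hn hα hRm hρ.indicator_nonneg hgm hi').mono_set
        sdiff_subset
    · obtain ⟨hxS, h1, h2⟩ := hsub hx
      have hp := hρ.pos hxS
      by_cases hxK : dir x ∈ K₁
      · have hxL : x ∈ L := by
          refine ⟨(‖x‖, dir x), ⟨⟨?_, ?_⟩, hxK⟩, norm_smul_dir x⟩
          · rw [lt_div_iff₀ hp] at h1
            have := hρ.lower x hxS
            nlinarith [hδ.2]
          · rw [div_lt_iff₀ hp] at h2
            linarith [hρ.upper x hxS]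
        rw [hg, indicator_of_mem hxK, hρ.indicator_dir hS h0 hxS, hχ1.self_of_nhdsSet x hxL,
          one_mul]
      · rw [hg, indicator_of_notMem hxK]
        exact mul_nonneg (hχI x).1 (inv_nonneg.2 hp.le)
    · filter_upwards [ae_restrict_mem hmeas] with x hx
      exact mul_nonneg (hχI x).1 (inv_nonneg.2 (hρ.pos hx.1).le)
  rw [hw.integral_shell hS hn hα hRm hρ.indicator_nonneg h0 hgm hi' (by nlinarith [hδ.2])
    (by linarith), hJ'] at hle
  rw [← hw.setIntegral_coneMeasure hS hmeas (fun x hx => hx.1)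
    (fun x => fderiv ℝ (fun y => ‖y‖ / ρ y) x (χ x • dir x)), mul_assoc]
  refine mul_le_mul_of_nonneg_left ?_ (inv_nonneg.2 hδ0.le)
  rw [setIntegral_congr_fun hmeas fun x hx => hder x hx.1]
  exact hle

/-- Inner regularity of the finite measure ν exhausts the directions in the cone by compact sets,
and ρ^(D-1) is bounded, so the directions left out contribute arbitrarily little. -/
theorem IsAdmissibleWeight.le_wPer_starBody (hw : IsAdmissibleWeight S α w)
    (hS : IsOpenConvexCone S) (hn : 1 ≤ n) (hα : 0 < α)
    (h0 : (0 : EuclideanSpace ℝ (Fin n)) ∉ S) (hρ : IsRadialFunction S ρ) :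
    ENNReal.ofReal (∫ θ : sphere (0 : EuclideanSpace ℝ (Fin n)) 1,
      ρ θ ^ ((n : ℝ) + α - 1) ∂(sphereMeasure S w)) ≤
      wPer S w (starBody S (S.indicator ρ)) := by
  have hn1 : (1 : ℝ) ≤ n := by exact_mod_cast hn
  have hfin := hw.isFiniteMeasure_sphereMeasure
  set M : ℝ := (3 / 2 : ℝ) ^ ((n : ℝ) + α - 1) with hM
  have hM0 : 0 < M := by positivity
  have hb : ∀ᵐ θ : sphere (0 : EuclideanSpace ℝ (Fin n)) 1 ∂(sphereMeasure S w),
      ‖ρ θ ^ ((n : ℝ) + α - 1)‖ ≤ M := by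
    filter_upwards [hw.ae_mem_sphereMeasure hS] with θ hθ
    have h1 := (hρ.pos hθ).le
    rw [Real.norm_eq_abs, abs_of_nonneg (by positivity)]
    exact Real.rpow_le_rpow h1 (hρ.upper _ hθ) (by linarith)
  have hm : AEStronglyMeasurable (fun θ : sphere (0 : EuclideanSpace ℝ (Fin n)) 1 =>
      ρ θ ^ ((n : ℝ) + α - 1)) (sphereMeasure S w) := by
    have h1 : Measurable fun θ : sphere (0 : EuclideanSpace ℝ (Fin n)) 1 =>
        S.indicator ρ θ ^ ((n : ℝ) + α - 1) :=
      ((hρ.measurable_indicator hS).comp measurable_subtype_coe).pow_const _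
    refine h1.aestronglyMeasurable.congr ?_
    filter_upwards [hw.ae_mem_sphereMeasure hS] with θ hθ
    rw [indicator_of_mem hθ]
  have hint : Integrable (fun θ : sphere (0 : EuclideanSpace ℝ (Fin n)) 1 =>
      ρ θ ^ ((n : ℝ) + α - 1)) (sphereMeasure S w) := Integrable.of_bound hm M hb
  have hSo : MeasurableSet (sphereIn S) := (hS.isOpen.preimage continuous_subtype_val).measurableSet
  refine ENNReal.le_of_forall_pos_le_add fun ε hε _ => ?_
  obtain ⟨K, hKS, hK, hKε⟩ := hSo.exists_isCompact_sdiff_lt (μ := sphereMeasure S w)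
    (measure_ne_top _ _) (ε := ENNReal.ofReal (ε / M)) (by simp; positivity)
  have hKc : sphereMeasure S w Kᶜ < ENNReal.ofReal (ε / M) := by
    refine lt_of_le_of_lt (measure_mono_ae ?_) hKε
    filter_upwards [hw.ae_mem_sphereMeasure hS] with θ hθ h
    exact ⟨hθ, h⟩
  have hsplit := integral_add_compl hK.isClosed.measurableSet hint
  have hc : ∫ θ in Kᶜ, ρ θ ^ ((n : ℝ) + α - 1) ∂(sphereMeasure S w) ≤ ε := by
    refine (Real.le_norm_self _).trans ((norm_setIntegral_le_of_norm_le_const_ae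
      (measure_lt_top _ _) (C := M) ?_).trans ?_)
    · exact ae_restrict_of_ae hb
    · have : (sphereMeasure S w).real Kᶜ ≤ ε / M := by
        rw [Measure.real]
        exact ENNReal.toReal_le_of_le_ofReal (by positivity) hKc.le
      calc M * (sphereMeasure S w).real Kᶜ ≤ M * (ε / M) := by gcongr
        _ = ε := by field_simp
  rw [← hsplit]
  refine (ENNReal.ofReal_add_le).trans ?_
  refine add_le_add (hw.setIntegral_le_wPer hS hn hα h0 hρ hK hKS) ?_
  calc ENNReal.ofReal _ ≤ ENNReal.ofReal ε := ENNReal.ofReal_le_ofReal hc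
    _ = ε := ENNReal.ofReal_coe_nnreal

end Perimeter

/-! ### First-order expansion of powers with quadratic error. -/

section Taylor

/-- First order Taylor bound for real powers near one, with a constant for the derivative too. -/
theorem exists_rpow_taylor (p : ℝ) : ∃ C : ℝ, 0 ≤ C ∧ ∀ u : ℝ, |u| ≤ 1 / 2 →
    |(1 + u) ^ p - 1 - p * u| ≤ C * u ^ 2 := by
  -- Applied with q = p - 1, this bounds the derivative of the remainder; a second use of the mean
  -- value inequality gives the quadratic error.
  have hlip : ∀ q : ℝ, ∃ C : ℝ, 0 ≤ C ∧ ∀ u : ℝ, |u| ≤ 1 / 2 → |(1 + u) ^ q - 1| ≤ C * |u| := by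
    intro q
    have hcont : ContinuousOn (fun u : ℝ => q * (1 + u) ^ (q - 1)) (Icc (-(1 / 2)) (1 / 2)) := by
      refine continuousOn_const.mul (ContinuousOn.rpow_const (by fun_prop) fun u hu => Or.inl ?_)
      have := hu.1
      linarith
    obtain ⟨C, hC⟩ := isCompact_Icc.exists_bound_of_continuousOn hcont
    have hC0 : 0 ≤ C := (norm_nonneg _).trans (hC 0 (by constructor <;> norm_num))
    refine ⟨C, hC0, fun u hu => ?_⟩
    have hd : ∀ v ∈ Icc (-(1 / 2) : ℝ) (1 / 2),
        HasDerivWithinAt (fun v : ℝ => (1 + v) ^ q) (q * (1 + v) ^ (q - 1))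
          (Icc (-(1 / 2)) (1 / 2)) v := fun v hv => by
      have h1 : HasDerivAt (fun v : ℝ => 1 + v) 1 v := (hasDerivAt_id v).const_add 1
      have h2 := h1.rpow_const (p := q) (Or.inl (by linarith [hv.1]))
      simpa using h2.hasDerivWithinAt
    have h := (convex_Icc (-(1 / 2) : ℝ) (1 / 2)).norm_image_sub_le_of_norm_hasDerivWithin_le hd hC
      (show (0 : ℝ) ∈ Icc (-(1 / 2) : ℝ) (1 / 2) by constructor <;> norm_num) (abs_le.1 hu)
    simpa using h
  obtain ⟨C, hC0, hC⟩ := hlip (p - 1)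
  refine ⟨|p| * C, by positivity, fun u hu => ?_⟩
  have hsub : Icc (-|u|) |u| ⊆ Icc (-(1 / 2) : ℝ) (1 / 2) := Icc_subset_Icc (by linarith) hu
  have hd : ∀ v ∈ Icc (-|u|) |u|, HasDerivWithinAt (fun v : ℝ => (1 + v) ^ p - 1 - p * v)
      (p * ((1 + v) ^ (p - 1) - 1)) (Icc (-|u|) |u|) v := fun v hv => by
    have h1 : HasDerivAt (fun v : ℝ => 1 + v) 1 v := (hasDerivAt_id v).const_add 1
    have h2 := h1.rpow_const (p := p) (Or.inl (by linarith [(hsub hv).1]))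
    have h3 := (h2.sub_const 1).sub ((hasDerivAt_id v).const_mul p)
    refine (h3.congr_deriv ?_).hasDerivWithinAt
    ring
  have hb : ∀ v ∈ Icc (-|u|) |u|, ‖p * ((1 + v) ^ (p - 1) - 1)‖ ≤ |p| * (C * |u|) := fun v hv => by
    rw [norm_mul, Real.norm_eq_abs, Real.norm_eq_abs]
    have h1 : |v| ≤ |u| := abs_le.2 hv
    refine mul_le_mul_of_nonneg_left ((hC v (h1.trans hu)).trans ?_) (abs_nonneg p)
    gcongr
  have h := (convex_Icc (-|u|) |u|).norm_image_sub_le_of_norm_hasDerivWithin_le hd hb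
    (show (0 : ℝ) ∈ Icc (-|u|) |u| by constructor <;> simp)
    (show u ∈ Icc (-|u|) |u| from ⟨neg_abs_le u, le_abs_self u⟩)
  simp only [add_zero, Real.one_rpow, sub_self, mul_zero, sub_zero, Real.norm_eq_abs] at h
  calc _ ≤ |p| * (C * |u|) * |u| := h
    _ = |p| * C * u ^ 2 := by rw [← sq_abs u]; ring

/-- The linear term stays explicit because the uses depend on it: it vanishes for ψ = 1 by mean
zero, reduces to the error of linearization for balls when ψ is the dual function, and detects the
perturbation in the last case. The constant is uniform in u. -/
theorem exists_integral_rpow_taylor {Ω : Type*} [MeasurableSpace Ω] (ν : Measure Ω)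
    [IsFiniteMeasure ν] (p : ℝ) {ψ : Ω → ℝ} (hψ : AEStronglyMeasurable ψ ν) {M : ℝ}
    (hM : ∀ᵐ θ ∂ν, ‖ψ θ‖ ≤ M) :
    ∃ C : ℝ, 0 ≤ C ∧ ∀ (u : Ω → ℝ) (κ : ℝ), AEMeasurable u ν → κ ≤ 1 / 2 →
      (∀ᵐ θ ∂ν, |u θ| ≤ κ) →
      |∫ θ, (1 + u θ) ^ p * ψ θ ∂ν - ∫ θ, ψ θ ∂ν - p * ∫ θ, u θ * ψ θ ∂ν| ≤ C * κ ^ 2 := by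
  obtain ⟨C, hC0, hC⟩ := exists_rpow_taylor p
  refine ⟨C * |M| * ν.real univ, by positivity, fun u κ hu hκ hb => ?_⟩
  have hψi : Integrable ψ ν := Integrable.of_bound hψ M hM
  have hui : Integrable (fun θ => u θ * ψ θ) ν := by
    refine Integrable.of_bound (hu.aestronglyMeasurable.mul hψ) (κ * |M|) ?_
    filter_upwards [hM, hb] with θ h1 h2
    rw [norm_mul]
    exact mul_le_mul h2 (h1.trans (le_abs_self M)) (norm_nonneg _) ((abs_nonneg _).trans h2)
  have hbound : ∀ᵐ θ ∂ν, ‖(1 + u θ) ^ p * ψ θ - ψ θ - p * (u θ * ψ θ)‖ ≤ C * |M| * κ ^ 2 := by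
    filter_upwards [hM, hb] with θ h1 h2
    have e : (1 + u θ) ^ p * ψ θ - ψ θ - p * (u θ * ψ θ) =
        ((1 + u θ) ^ p - 1 - p * u θ) * ψ θ := by ring
    rw [e, norm_mul, mul_right_comm]
    refine mul_le_mul ((hC _ (h2.trans hκ)).trans ?_) (h1.trans (le_abs_self M)) (norm_nonneg _)
      (by positivity)
    refine mul_le_mul_of_nonneg_left ?_ hC0
    rw [← sq_abs]
    exact pow_le_pow_left₀ (abs_nonneg _) h2 2
  have hmi : AEStronglyMeasurable (fun θ => (1 + u θ) ^ p * ψ θ) ν :=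
    ((hu.const_add 1).pow_const p).aestronglyMeasurable.mul hψ
  have hri : Integrable (fun θ => (1 + u θ) ^ p * ψ θ - ψ θ - p * (u θ * ψ θ)) ν :=
    Integrable.of_bound ((hmi.sub hψ).sub (hui.aestronglyMeasurable.const_mul p)) _ hbound
  have h1i : Integrable (fun θ => (1 + u θ) ^ p * ψ θ) ν := by
    refine ((hri.add (hui.const_mul p)).add hψi).congr (ae_of_all _ fun θ => ?_)
    simp only [Pi.add_apply]
    ring
  have hsub : Integrable (fun θ => (1 + u θ) ^ p * ψ θ - ψ θ) ν := h1i.sub hψi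
  rw [← integral_const_mul, ← integral_sub h1i hψi, ← integral_sub hsub (hui.const_mul p)]
  refine (norm_integral_le_of_norm_le_const hbound).trans (le_of_eq ?_)
  ring

end Taylor

/-! ### The weighted measure on the sphere and volumes of balls. -/

section SphereMeasure

variable {n : ℕ} {S : Set (EuclideanSpace ℝ (Fin n))} {α : ℝ}
  {w : EuclideanSpace ℝ (Fin n) → ℝ}

theorem IsAdmissibleWeight.measurable_sphereDensity (hw : IsAdmissibleWeight S α w)
    (hS : IsOpenConvexCone S) :
    Measurable fun θ : sphere (0 : EuclideanSpace ℝ (Fin n)) 1 => coneDensity S w θ :=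
  (hw.measurable_coneDensity hS).comp measurable_subtype_coe

theorem coneDensity_lt_top (x : EuclideanSpace ℝ (Fin n)) : coneDensity S w x < ⊤ := by
  by_cases hx : x ∈ S <;> simp [coneDensity, hx]

theorem measurableSet_sphereIn (hS : IsOpenConvexCone S) : MeasurableSet (sphereIn S) :=
  (hS.isOpen.preimage continuous_subtype_val).measurableSet

theorem IsAdmissibleWeight.toReal_sphereDensity_smul (hw : IsAdmissibleWeight S α w)
    (f : sphere (0 : EuclideanSpace ℝ (Fin n)) 1 → ℝ) :
    (fun θ : sphere (0 : EuclideanSpace ℝ (Fin n)) 1 => (coneDensity S w θ).toReal • f θ) =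
      (sphereIn S).indicator fun θ => f θ * w θ := by
  ext θ
  by_cases hθ : (θ : EuclideanSpace ℝ (Fin n)) ∈ S
  · rw [indicator_of_mem (show θ ∈ sphereIn S from hθ), coneDensity, indicator_of_mem hθ,
      ENNReal.toReal_ofReal (hw.nonneg _ (subset_closure hθ)), smul_eq_mul, mul_comm]
  · rw [indicator_of_notMem (show θ ∉ sphereIn S from hθ), coneDensity, indicator_of_notMem hθ]
    simp

theorem IsAdmissibleWeight.integrable_sphereMeasure_iff (hw : IsAdmissibleWeight S α w)
    (hS : IsOpenConvexCone S) (f : sphere (0 : EuclideanSpace ℝ (Fin n)) 1 → ℝ) :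
    Integrable f (sphereMeasure S w) ↔ IntegrableOn (fun θ => f θ * w θ) (sphereIn S)
      (volume : Measure (EuclideanSpace ℝ (Fin n))).toSphere := by
  rw [sphereMeasure, integrable_withDensity_iff_integrable_smul'
    (hw.measurable_sphereDensity hS) (ae_of_all _ fun θ => coneDensity_lt_top _),
    hw.toReal_sphereDensity_smul, integrable_indicator_iff (measurableSet_sphereIn hS)]

theorem IsAdmissibleWeight.integral_sphereMeasure (hw : IsAdmissibleWeight S α w)
    (hS : IsOpenConvexCone S) (f : sphere (0 : EuclideanSpace ℝ (Fin n)) 1 → ℝ) :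
    ∫ θ, f θ ∂(sphereMeasure S w) = ∫ θ in sphereIn S, f θ * w θ
      ∂(volume : Measure (EuclideanSpace ℝ (Fin n))).toSphere := by
  rw [sphereMeasure, integral_withDensity_eq_integral_toReal_smul
    (hw.measurable_sphereDensity hS) (ae_of_all _ fun θ => coneDensity_lt_top _),
    hw.toReal_sphereDensity_smul, integral_indicator (measurableSet_sphereIn hS)]

/-- A function continuous in the cone which vanishes almost everywhere on the sphere vanishes
there. -/
theorem IsAdmissibleWeight.eq_zero_of_ae (hw : IsAdmissibleWeight S α w)
    (hS : IsOpenConvexCone S) (hα : 0 < α) {f : EuclideanSpace ℝ (Fin n) → ℝ}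
    (hf : ContinuousOn f S)
    (h : ∀ᵐ θ : sphere (0 : EuclideanSpace ℝ (Fin n)) 1 ∂(sphereMeasure S w), f θ = 0)
    {θ : EuclideanSpace ℝ (Fin n)} (hθ : θ ∈ S) (hθ1 : ‖θ‖ = 1) : f θ = 0 := by
  -- The set where f is nonzero is relatively open. Since w > 0 there, it is null for the surface
  -- measure too, and the surface measure charges nonempty open sets.
  let U : Set (sphere (0 : EuclideanSpace ℝ (Fin n)) 1) :=
    Subtype.val ⁻¹' (S ∩ f ⁻¹' {0}ᶜ)
  have hU : IsOpen U :=
    (hf.isOpen_inter_preimage hS.isOpen isOpen_compl_singleton).preimage continuous_subtype_val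
  rw [sphereMeasure, ae_withDensity_iff (hw.measurable_sphereDensity hS)] at h
  have hU0 : (volume : Measure (EuclideanSpace ℝ (Fin n))).toSphere U = 0 := by
    rw [measure_eq_zero_iff_ae_notMem]
    filter_upwards [h] with y hy hyU
    refine hyU.2 (hy ?_)
    rw [coneDensity, indicator_of_mem hyU.1]
    simpa using hw.pos hS hα hyU.1
  have hemp := hU.measure_eq_zero_iff _ |>.1 hU0
  by_contra hne
  have : (⟨θ, by simpa using hθ1⟩ : sphere (0 : EuclideanSpace ℝ (Fin n)) 1) ∈ U := ⟨hθ, hne⟩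
  rw [hemp] at this
  exact this

theorem IsAdmissibleWeight.exists_unit_mem (hw : IsAdmissibleWeight S α w)
    (hS : IsOpenConvexCone S) (h0 : (0 : EuclideanSpace ℝ (Fin n)) ∉ S) :
    ∃ θ ∈ S, ‖θ‖ = 1 := by
  obtain ⟨x, hx, -⟩ := hw.ne_zero
  obtain ⟨y, hy⟩ : S.Nonempty := closure_nonempty_iff.1 ⟨x, hx⟩
  exact ⟨dir y, hS.dir_mem h0 hy, norm_dir fun h => h0 (h ▸ hy)⟩

theorem IsAdmissibleWeight.sphereMeasure_real_pos (hw : IsAdmissibleWeight S α w)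
    (hS : IsOpenConvexCone S) (hα : 0 < α) (h0 : (0 : EuclideanSpace ℝ (Fin n)) ∉ S) :
    0 < (sphereMeasure S w).real univ := by
  have hfin := hw.isFiniteMeasure_sphereMeasure
  refine ENNReal.toReal_pos (fun h => ?_) (measure_ne_top _ _)
  obtain ⟨θ, hθ, hθ1⟩ := hw.exists_unit_mem hS h0
  rw [Measure.measure_univ_eq_zero] at h
  have := hw.eq_zero_of_ae hS hα (f := fun _ => 1) continuousOn_const (by rw [h]; simp) hθ hθ1
  exact one_ne_zero this

theorem ball_inter_eq_starBody (r : ℝ) : ball 0 r ∩ S = starBody S (fun _ => r) := by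
  ext x
  simp [starBody, and_comm]

/-- The volume of a star-shaped body. -/
theorem IsAdmissibleWeight.coneMeasure_real_starBody (hw : IsAdmissibleWeight S α w)
    (hS : IsOpenConvexCone S) (hn : 1 ≤ n) (hα : 0 < α)
    {R : EuclideanSpace ℝ (Fin n) → ℝ} (hR : Measurable R)
    (hR0 : ∀ θ ∈ S, ‖θ‖ = 1 → 0 ≤ R θ) :
    (coneMeasure S w).real (starBody S R) =
      (∫ θ : sphere (0 : EuclideanSpace ℝ (Fin n)) 1, R θ ^ ((n : ℝ) + α) ∂(sphereMeasure S w)) /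
        ((n : ℝ) + α) := by
  have h := hw.integral_starBody hS hn hα hR hR0 (g := fun _ => 1) measurable_const
  simp only [mul_one, integral_const, smul_eq_mul, measureReal_restrict_apply MeasurableSet.univ,
    univ_inter] at h
  rw [h, integral_div]

theorem IsAdmissibleWeight.coneMeasure_starBody_lt_top (hw : IsAdmissibleWeight S α w)
    (hS : IsOpenConvexCone S) (hn : 1 ≤ n) (hα : 0 < α)
    {R : EuclideanSpace ℝ (Fin n) → ℝ} (hR : Measurable R)
    (hR0 : ∀ θ ∈ S, ‖θ‖ = 1 → 0 ≤ R θ) {M : ℝ} (hM : ∀ θ ∈ S, ‖θ‖ = 1 → R θ ≤ M) :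
    coneMeasure S w (starBody S R) < ⊤ := by
  have hfin := hw.isFiniteMeasure_sphereMeasure
  have hD : 0 < (n : ℝ) + α := by positivity
  rw [hw.coneMeasure_starBody hS hn hα hR hR0]
  refine lt_of_le_of_lt (lintegral_mono_ae (g := fun _ => ENNReal.ofReal
    (M ^ ((n : ℝ) + α) / ((n : ℝ) + α))) ?_) ?_
  · filter_upwards [hw.ae_mem_sphereMeasure hS] with θ hθ
    have hθ1 : ‖(θ : EuclideanSpace ℝ (Fin n))‖ = 1 := by simp
    have h1 := hR0 _ hθ hθ1
    have h2 := hM _ hθ hθ1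
    gcongr
  · rw [lintegral_const]
    exact ENNReal.mul_lt_top ENNReal.ofReal_lt_top (measure_lt_top _ _)

theorem IsAdmissibleWeight.coneMeasure_real_ball (hw : IsAdmissibleWeight S α w)
    (hS : IsOpenConvexCone S) (hn : 1 ≤ n) (hα : 0 < α) {r : ℝ} (hr : 0 ≤ r) :
    (coneMeasure S w).real (ball 0 r ∩ S) =
      r ^ ((n : ℝ) + α) * ((sphereMeasure S w).real univ / ((n : ℝ) + α)) := by
  rw [ball_inter_eq_starBody, hw.coneMeasure_real_starBody hS hn hα measurable_const
    fun _ _ _ => hr, integral_const, smul_eq_mul]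
  ring

theorem IsAdmissibleWeight.coneMeasure_ball_lt_top (hw : IsAdmissibleWeight S α w)
    (hS : IsOpenConvexCone S) (hn : 1 ≤ n) (hα : 0 < α) (r : ℝ) :
    coneMeasure S w (ball 0 r ∩ S) < ⊤ := by
  rcases le_or_gt 0 r with hr | hr
  · rw [ball_inter_eq_starBody]
    exact hw.coneMeasure_starBody_lt_top hS hn hα measurable_const (fun _ _ _ => hr)
      fun _ _ _ => le_rfl
  · simp [ball_eq_empty.2 hr.le]

end SphereMeasure

/-! ### Second-order bounds for volume, perimeter and deficit. -/

section Perturbation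

variable {n : ℕ} {S : Set (EuclideanSpace ℝ (Fin n))} {α : ℝ}
  {w η : EuclideanSpace ℝ (Fin n) → ℝ}

theorem radialExt_eq (η : EuclideanSpace ℝ (Fin n) → ℝ) (x : EuclideanSpace ℝ (Fin n)) :
    radialExt η x = η (dir x) := rfl

theorem radialExt_of_norm_eq_one (η : EuclideanSpace ℝ (Fin n) → ℝ) {x : EuclideanSpace ℝ (Fin n)}
    (hx : ‖x‖ = 1) : radialExt η x = η x := by
  rw [radialExt_eq, dir_of_norm_eq_one hx]

theorem radialExt_coe_sphere (η : EuclideanSpace ℝ (Fin n) → ℝ)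
    (θ : sphere (0 : EuclideanSpace ℝ (Fin n)) 1) : radialExt η θ = η θ :=
  radialExt_of_norm_eq_one η (by simp)

theorem radialExt_smul (η : EuclideanSpace ℝ (Fin n) → ℝ) {t : ℝ} (ht : 0 < t)
    (x : EuclideanSpace ℝ (Fin n)) : radialExt η (t • x) = radialExt η x := by
  rw [radialExt_eq, radialExt_eq, dir_smul ht]

theorem IsAdmissiblePerturbation.exists_bound (hη : IsAdmissiblePerturbation S w η)
    (hS : IsOpenConvexCone S) (h0 : (0 : EuclideanSpace ℝ (Fin n)) ∉ S) :
    ∃ M : ℝ, 0 < M ∧ ∀ x ∈ S, |radialExt η x| ≤ M := by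
  obtain ⟨M, hM⟩ := hη.bounded
  refine ⟨max M 1, lt_max_of_lt_right one_pos, fun x hx => ?_⟩
  have hx0 : x ≠ 0 := fun h => h0 (h ▸ hx)
  exact (hM (dir x) ⟨by simpa using norm_dir hx0, hS.dir_mem h0 hx⟩).trans (le_max_left _ _)

theorem IsAdmissiblePerturbation.isRadialFunction (hη : IsAdmissiblePerturbation S w η)
    {M : ℝ} (hM : ∀ x ∈ S, |radialExt η x| ≤ M) {ε : ℝ} (hε : 0 < ε) (hεM : ε * M ≤ 1 / 2) :
    IsRadialFunction S (fun x => 1 + ε * radialExt η x) where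
  contDiffOn := contDiffOn_const.add (contDiffOn_const.mul
    (hη.smooth.of_le (by exact_mod_cast le_top)))
  homogeneous := fun t ht x _ => by simp only [radialExt_smul η ht]
  lower := fun x hx => by
    have h1 := (abs_le.1 (hM x hx)).1
    nlinarith
  upper := fun x hx => by
    have h1 := (abs_le.1 (hM x hx)).2
    nlinarith

theorem perturbedBall_eq_starBody (hS : IsOpenConvexCone S)
    (h0 : (0 : EuclideanSpace ℝ (Fin n)) ∉ S) (ε : ℝ) :
    perturbedBall S η ε = starBody S (S.indicator fun x => 1 + ε * radialExt η x) := by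
  ext x
  constructor
  · rintro ⟨θ, ⟨hθ1, hθ⟩, t, ht, htη, rfl⟩
    have hn : ‖θ‖ = 1 := by simpa using hθ1
    refine ⟨hS.smul_mem t ht θ hθ, ?_⟩
    rw [dir_smul ht, dir_of_norm_eq_one hn, indicator_of_mem hθ, norm_smul, hn, mul_one,
      Real.norm_eq_abs, abs_of_pos ht, radialExt_of_norm_eq_one η hn]
    exact htη
  · rintro ⟨hx, hlt⟩
    have hx0 : x ≠ 0 := fun h => h0 (h ▸ hx)
    have hd := hS.dir_mem h0 hx
    rw [indicator_of_mem hd, radialExt_of_norm_eq_one η (norm_dir hx0)] at hlt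
    exact ⟨dir x, ⟨by simpa using norm_dir hx0, hd⟩, ‖x‖, norm_pos_iff.2 hx0, hlt,
      (norm_smul_dir x).symm⟩

theorem aemeasurable_sphereMeasure (hw : IsAdmissibleWeight S α w) (hS : IsOpenConvexCone S)
    {f : EuclideanSpace ℝ (Fin n) → ℝ} (hf : ContinuousOn f S) :
    AEMeasurable (fun θ : sphere (0 : EuclideanSpace ℝ (Fin n)) 1 => f θ) (sphereMeasure S w) := by
  refine ⟨fun θ => S.indicator f θ,
    (measurable_indicator_of_continuousOn hS.isOpen hf).comp measurable_subtype_coe, ?_⟩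
  filter_upwards [hw.ae_mem_sphereMeasure hS] with θ hθ
  rw [indicator_of_mem hθ]

theorem IsAdmissiblePerturbation.integral_eq_zero (hη : IsAdmissiblePerturbation S w η)
    (hw : IsAdmissibleWeight S α w) (hS : IsOpenConvexCone S) :
    ∫ θ : sphere (0 : EuclideanSpace ℝ (Fin n)) 1, radialExt η θ ∂(sphereMeasure S w) = 0 := by
  rw [hw.integral_sphereMeasure hS]
  simp only [radialExt_coe_sphere]
  exact hη.mean_zero

theorem IsAdmissiblePerturbation.integrable_energy (hη : IsAdmissiblePerturbation S w η)
    (hw : IsAdmissibleWeight S α w) (hS : IsOpenConvexCone S) :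
    Integrable (fun θ : sphere (0 : EuclideanSpace ℝ (Fin n)) 1 =>
      ‖fderiv ℝ (radialExt η) θ‖ ^ 2) (sphereMeasure S w) :=
  (hw.integrable_sphereMeasure_iff hS _).2 hη.energy

/-- Integrals of powers of the radial function of the perturbed ball. -/
theorem IsAdmissiblePerturbation.exists_integral_rpow (hη : IsAdmissiblePerturbation S w η)
    (hw : IsAdmissibleWeight S α w) (hS : IsOpenConvexCone S)
    {M : ℝ} (hM : ∀ x ∈ S, |radialExt η x| ≤ M) (p : ℝ) :
    ∃ C : ℝ, 0 ≤ C ∧ ∀ ε : ℝ, 0 < ε → ε * M ≤ 1 / 2 →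
      |∫ θ : sphere (0 : EuclideanSpace ℝ (Fin n)) 1, (1 + ε * radialExt η θ) ^ p
        ∂(sphereMeasure S w) - (sphereMeasure S w).real univ| ≤ C * ε ^ 2 := by
  have hfin := hw.isFiniteMeasure_sphereMeasure
  obtain ⟨C, hC0, hC⟩ := exists_integral_rpow_taylor (sphereMeasure S w) p (ψ := fun _ => 1)
    aestronglyMeasurable_const (M := 1) (by simp)
  refine ⟨C * M ^ 2, by positivity, fun ε hε hεM => ?_⟩
  have h := hC (fun θ => ε * radialExt η θ) (ε * M)
    ((aemeasurable_sphereMeasure hw hS hη.smooth.continuousOn).const_mul ε) hεM (by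
      filter_upwards [hw.ae_mem_sphereMeasure hS] with θ hθ
      rw [abs_mul, abs_of_pos hε]
      exact mul_le_mul_of_nonneg_left (hM θ hθ) hε.le)
  simp only [mul_one, integral_const_mul, hη.integral_eq_zero hw hS, mul_zero, sub_zero,
    integral_const, smul_eq_mul] at h
  refine h.trans (le_of_eq ?_)
  ring

/-- The volume is D⁻¹ ∫ (1 + εη)^D dν, whose term of order ε is ε ∫ η dν = 0. -/
theorem IsAdmissiblePerturbation.exists_volume_bound (hη : IsAdmissiblePerturbation S w η)
    (hw : IsAdmissibleWeight S α w) (hS : IsOpenConvexCone S) (hn : 1 ≤ n) (hα : 0 < α)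
    (h0 : (0 : EuclideanSpace ℝ (Fin n)) ∉ S)
    {M : ℝ} (hM : ∀ x ∈ S, |radialExt η x| ≤ M) :
    ∃ C : ℝ, 0 ≤ C ∧ ∀ ε : ℝ, 0 < ε → ε * M ≤ 1 / 2 →
      |(coneMeasure S w).real (perturbedBall S η ε) - (coneMeasure S w).real (ball 0 1 ∩ S)|
        ≤ C * ε ^ 2 := by
  have hD : 0 < (n : ℝ) + α := by positivity
  obtain ⟨C, hC0, hC⟩ := hη.exists_integral_rpow hw hS hM ((n : ℝ) + α)
  refine ⟨C / ((n : ℝ) + α), by positivity, fun ε hε hεM => ?_⟩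
  have hρ := hη.isRadialFunction hM hε hεM
  rw [perturbedBall_eq_starBody hS h0, hw.coneMeasure_real_starBody hS hn hα
    (hρ.measurable_indicator hS) hρ.indicator_nonneg, hw.coneMeasure_real_ball hS hn hα zero_le_one,
    Real.one_rpow, one_mul, div_sub_div_same, abs_div, abs_of_pos hD, div_mul_eq_mul_div]
  refine div_le_div_of_nonneg_right (le_trans (le_of_eq ?_) (hC ε hε hεM)) hD.le
  congr 2
  refine integral_congr_ae ?_
  filter_upwards [hw.ae_mem_sphereMeasure hS] with θ hθ
  rw [indicator_of_mem hθ]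

/-- The weighted perimeter of the unit ball. -/
theorem IsAdmissibleWeight.wPer_ball (hw : IsAdmissibleWeight S α w)
    (hS : IsOpenConvexCone S) (hn : 1 ≤ n) (hα : 0 < α)
    (h0 : (0 : EuclideanSpace ℝ (Fin n)) ∉ S) :
    wPer S w (ball 0 1 ∩ S) = ENNReal.ofReal ((sphereMeasure S w).real univ) := by
  have hρ : IsRadialFunction S (fun _ => 1) :=
    ⟨contDiffOn_const, fun _ _ _ _ => rfl, fun _ _ => by norm_num, fun _ _ => by norm_num⟩
  have hfin := hw.isFiniteMeasure_sphereMeasure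
  have hE : ball 0 1 ∩ S = starBody S (S.indicator fun _ => 1) := by
    rw [ball_inter_eq_starBody]
    ext x
    refine and_congr_right fun hx => ?_
    rw [indicator_of_mem (hS.dir_mem h0 hx)]
  rw [hE]
  refine le_antisymm ?_ ?_
  · have := hw.wPer_starBody_le hS hn hα h0 hρ (by simp)
    simpa using this
  · have := hw.le_wPer_starBody hS hn hα h0 hρ
    simpa using this

/-- Both perimeter bounds contain ∫ (1 + εη)^(D-1) dν, which differs from ν of the sphere by O(ε²)
since η has mean zero. They differ by the gradient term alone, which is ε² times the energy up to a
constant. -/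
theorem IsAdmissiblePerturbation.exists_perimeter_bound (hη : IsAdmissiblePerturbation S w η)
    (hw : IsAdmissibleWeight S α w) (hS : IsOpenConvexCone S) (hn : 1 ≤ n) (hα : 0 < α)
    (h0 : (0 : EuclideanSpace ℝ (Fin n)) ∉ S)
    {M : ℝ} (hM : ∀ x ∈ S, |radialExt η x| ≤ M) :
    ∃ C : ℝ, 0 ≤ C ∧ ∀ ε : ℝ, 0 < ε → ε * M ≤ 1 / 2 →
      wPer S w (perturbedBall S η ε) < ⊤ ∧
      |(wPer S w (perturbedBall S η ε)).toReal - (wPer S w (ball 0 1 ∩ S)).toReal|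
        ≤ C * ε ^ 2 := by
  have hfin := hw.isFiniteMeasure_sphereMeasure
  obtain ⟨C, hC0, hC⟩ := hη.exists_integral_rpow hw hS hM ((n : ℝ) + α - 1)
  set Q := ∫ θ : sphere (0 : EuclideanSpace ℝ (Fin n)) 1,
    ‖fderiv ℝ (radialExt η) θ‖ ^ 2 ∂(sphereMeasure S w) with hQ
  have hQ0 : 0 ≤ Q := integral_nonneg fun θ => by positivity
  -- The 4 comes from 2ρ³ ≥ 1/4, as ρ ≥ 1/2; the power from ρ ≤ 3/2.
  set A : ℝ := 4 * (3 / 2 : ℝ) ^ ((n : ℝ) + α) with hA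
  have hA0 : 0 ≤ A := by positivity
  refine ⟨C + A * Q, by positivity, fun ε hε hεM => ?_⟩
  have hρ := hη.isRadialFunction hM hε hεM
  set ρ : EuclideanSpace ℝ (Fin n) → ℝ := fun x => 1 + ε * radialExt η x with hρdef
  have hfd : ∀ x ∈ S, ‖fderiv ℝ ρ x‖ ^ 2 = ε ^ 2 * ‖fderiv ℝ (radialExt η) x‖ ^ 2 := by
    intro x hx
    have hd : DifferentiableAt ℝ (radialExt η) x :=
      (hη.smooth.contDiffAt (hS.isOpen.mem_nhds hx)).differentiableAt (by simp)
    have h1 : HasFDerivAt ρ (ε • fderiv ℝ (radialExt η) x) x :=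
      (hd.hasFDerivAt.const_smul ε).const_add 1
    rw [h1.fderiv, norm_smul, mul_pow, Real.norm_eq_abs, sq_abs]
  have hi1 : Integrable (fun θ : sphere (0 : EuclideanSpace ℝ (Fin n)) 1 =>
      ρ θ ^ ((n : ℝ) + α - 1)) (sphereMeasure S w) := by
    refine Integrable.of_bound ((aemeasurable_sphereMeasure hw hS
      hρ.contDiffOn.continuousOn).pow_const _).aestronglyMeasurable
      ((3 / 2 : ℝ) ^ ((n : ℝ) + α - 1)) ?_
    filter_upwards [hw.ae_mem_sphereMeasure hS] with θ hθ
    have h1 := (hρ.pos hθ).le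
    have hn1 : (1 : ℝ) ≤ n := by exact_mod_cast hn
    rw [Real.norm_eq_abs, abs_of_nonneg (by positivity)]
    exact Real.rpow_le_rpow h1 (hρ.upper _ hθ) (by linarith)
  have hi2 := (hη.integrable_energy hw hS).const_mul (A * ε ^ 2)
  have hpt : ∀ θ ∈ S, 0 ≤ ρ θ ^ ((n : ℝ) + α) * ((ρ θ)⁻¹ + ‖fderiv ℝ ρ θ‖ ^ 2 / (2 * ρ θ ^ 3)) ∧
      ρ θ ^ ((n : ℝ) + α) * ((ρ θ)⁻¹ + ‖fderiv ℝ ρ θ‖ ^ 2 / (2 * ρ θ ^ 3)) ≤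
      ρ θ ^ ((n : ℝ) + α - 1) + A * ε ^ 2 * ‖fderiv ℝ (radialExt η) θ‖ ^ 2 := by
    intro θ hθ
    have hp := hρ.pos hθ
    refine ⟨by positivity, ?_⟩
    rw [mul_add, Real.rpow_sub_one hp.ne', div_eq_mul_inv, hfd θ hθ]
    refine add_le_add_right ?_ _
    have e1 : ρ θ ^ ((n : ℝ) + α) ≤ (3 / 2 : ℝ) ^ ((n : ℝ) + α) :=
      Real.rpow_le_rpow hp.le (hρ.upper θ hθ) (by positivity)
    have e2 : (1 / 4 : ℝ) ≤ 2 * ρ θ ^ 3 := by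
      have := pow_le_pow_left₀ (by norm_num) (hρ.lower θ hθ) 3
      norm_num at this
      linarith
    calc ρ θ ^ ((n : ℝ) + α) * (ε ^ 2 * ‖fderiv ℝ (radialExt η) θ‖ ^ 2 / (2 * ρ θ ^ 3))
        ≤ (3 / 2 : ℝ) ^ ((n : ℝ) + α) * (ε ^ 2 * ‖fderiv ℝ (radialExt η) θ‖ ^ 2 / (1 / 4)) := by
          gcongr
      _ = A * ε ^ 2 * ‖fderiv ℝ (radialExt η) θ‖ ^ 2 := by rw [hA]; ring
  have hi : Integrable (fun θ : sphere (0 : EuclideanSpace ℝ (Fin n)) 1 =>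
      ρ θ ^ ((n : ℝ) + α) * ((ρ θ)⁻¹ + ‖fderiv ℝ ρ θ‖ ^ 2 / (2 * ρ θ ^ 3)))
      (sphereMeasure S w) := by
    refine (hi1.add hi2).mono' ?_ ?_
    · have h1 := aemeasurable_sphereMeasure hw hS hρ.contDiffOn.continuousOn
      have h2 := aemeasurable_sphereMeasure hw hS
        (hρ.contDiffOn.continuousOn_fderiv_of_isOpen hS.isOpen le_rfl).norm
      exact ((h1.pow_const _).mul (h1.inv.add ((h2.pow_const 2).div
        ((h1.pow_const 3).const_mul 2)))).aestronglyMeasurable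
    · filter_upwards [hw.ae_mem_sphereMeasure hS] with θ hθ
      rw [Real.norm_eq_abs, abs_of_nonneg (hpt θ hθ).1]
      exact (hpt θ hθ).2
  have hup := hw.wPer_starBody_le hS hn hα h0 hρ hi
  have hlow := hw.le_wPer_starBody hS hn hα h0 hρ
  rw [← perturbedBall_eq_starBody hS h0] at hup hlow
  have hlt : wPer S w (perturbedBall S η ε) < ⊤ := hup.trans_lt ENNReal.ofReal_lt_top
  refine ⟨hlt, ?_⟩
  rw [hw.wPer_ball hS hn hα h0, ENNReal.toReal_ofReal measureReal_nonneg]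
  have hCε := abs_le.1 (hC ε hε hεM)
  have hnn : 0 ≤ ∫ θ : sphere (0 : EuclideanSpace ℝ (Fin n)) 1,
      ρ θ ^ ((n : ℝ) + α) * ((ρ θ)⁻¹ + ‖fderiv ℝ ρ θ‖ ^ 2 / (2 * ρ θ ^ 3))
      ∂(sphereMeasure S w) := by
    refine integral_nonneg_of_ae ?_
    filter_upwards [hw.ae_mem_sphereMeasure hS] with θ hθ using (hpt θ hθ).1
  have hu : (wPer S w (perturbedBall S η ε)).toReal ≤
      ∫ θ : sphere (0 : EuclideanSpace ℝ (Fin n)) 1, ρ θ ^ ((n : ℝ) + α - 1) ∂(sphereMeasure S w)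
        + A * ε ^ 2 * Q := by
    refine (ENNReal.toReal_le_of_le_ofReal hnn hup).trans ?_
    rw [hQ, ← integral_const_mul, ← integral_add hi1 hi2]
    refine integral_mono_ae hi (hi1.add hi2) ?_
    filter_upwards [hw.ae_mem_sphereMeasure hS] with θ hθ using (hpt θ hθ).2
  have hl : ∫ θ : sphere (0 : EuclideanSpace ℝ (Fin n)) 1, ρ θ ^ ((n : ℝ) + α - 1)
      ∂(sphereMeasure S w) ≤ (wPer S w (perturbedBall S η ε)).toReal :=
    (ENNReal.ofReal_le_iff_le_toReal hlt.ne).1 hlow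
  have hAQ : 0 ≤ A * Q * ε ^ 2 := by positivity
  rw [abs_le]
  constructor <;> nlinarith [hCε.1, hCε.2]

/-- With relative errors v of the perimeter and u of the volume, both O(ε²), the quotient is (1 +
v)(1 + u)^(-q). -/
theorem exists_deficit_bound {P₀ V₀ C : ℝ} (hP₀ : 0 < P₀) (hV₀ : 0 < V₀) (hC : 0 ≤ C) (q : ℝ) :
    ∃ κ C' : ℝ, 0 < κ ∧ ∀ ε P V : ℝ, 0 < ε → ε < κ → |P - P₀| ≤ C * ε ^ 2 →
      |V - V₀| ≤ C * ε ^ 2 → |P / (P₀ / V₀ ^ q * V ^ q) - 1| ≤ C' * ε ^ 2 := by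
  obtain ⟨K, hK0, hK⟩ := exists_rpow_taylor (-q)
  set c := C / P₀ with hc
  set d := C / V₀ with hd
  have hc0 : 0 ≤ c := by positivity
  have hd0 : 0 ≤ d := by positivity
  set L := (|q| + K) * d with hL
  have hL0 : 0 ≤ L := by positivity
  -- The bound ε < 1 gives ε⁴ ≤ ε²; the second bound gives |u| ≤ 1/2, the range of the Taylor
  -- estimate.
  refine ⟨min 1 (1 / (2 * (d + 1))), c + L + c * L, by positivity,
    fun ε P V hε hεκ hP hV => ?_⟩
  have hε1 : ε ≤ 1 := hεκ.le.trans (min_le_left _ _)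
  have hε2 : ε ^ 2 ≤ ε := by nlinarith
  have hεd : d * ε ^ 2 ≤ 1 / 2 := by
    have h1 : ε ≤ 1 / (2 * (d + 1)) := hεκ.le.trans (min_le_right _ _)
    rw [le_div_iff₀ (by positivity)] at h1
    nlinarith
  set v := P / P₀ - 1 with hv
  set u := V / V₀ - 1 with hu
  have hv1 : |v| ≤ c * ε ^ 2 := by
    rw [hv, div_sub_one hP₀.ne', abs_div, abs_of_pos hP₀, hc, div_mul_eq_mul_div]
    gcongr
  have hu1 : |u| ≤ d * ε ^ 2 := by
    rw [hu, div_sub_one hV₀.ne', abs_div, abs_of_pos hV₀, hd, div_mul_eq_mul_div]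
    gcongr
  have hu2 : |u| ≤ 1 / 2 := hu1.trans hεd
  have hVeq : V = V₀ * (1 + u) := by rw [hu]; field_simp; ring
  have hu3 : 0 < 1 + u := by linarith [(abs_le.1 hu2).1]
  set y := (1 + u) ^ (-q) - 1 with hy
  have hy1 : |y| ≤ L * ε ^ 2 := by
    have h1 := hK u hu2
    have h2 : |y| ≤ |(1 + u) ^ (-q) - 1 - -q * u| + |-q * u| := by
      have : y = ((1 + u) ^ (-q) - 1 - -q * u) + -q * u := by rw [hy]; ring
      rw [this]
      exact abs_add_le _ _
    have h3 : u ^ 2 ≤ |u| := by rw [← sq_abs]; nlinarith [abs_nonneg u]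
    rw [abs_mul, abs_neg] at h2
    calc |y| ≤ K * u ^ 2 + |q| * |u| := by linarith
      _ ≤ K * |u| + |q| * |u| := by gcongr
      _ = (|q| + K) * |u| := by ring
      _ ≤ (|q| + K) * (d * ε ^ 2) := by gcongr
      _ = L * ε ^ 2 := by rw [hL]; ring
  have hquot : P / (P₀ / V₀ ^ q * V ^ q) = (1 + v) * (1 + y) := by
    have e1 : 0 < V₀ ^ q := Real.rpow_pos_of_pos hV₀ q
    have e2 : 0 < (1 + u) ^ q := Real.rpow_pos_of_pos hu3 q
    have hPeq : P = P₀ * (1 + v) := by rw [hv]; field_simp; ring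
    have hyeq : 1 + y = ((1 + u) ^ q)⁻¹ := by rw [hy, Real.rpow_neg hu3.le]; ring
    rw [hyeq, hPeq, hVeq]
    clear_value u v
    rw [Real.mul_rpow hV₀.le hu3.le]
    field_simp
  rw [hquot]
  have e : (1 + v) * (1 + y) - 1 = v + y + v * y := by ring
  rw [e]
  calc |v + y + v * y| ≤ |v| + |y| + |v * y| := (abs_add_le _ _).trans
        (add_le_add_left (abs_add_le _ _) _)
    _ ≤ c * ε ^ 2 + L * ε ^ 2 + (c * ε ^ 2) * (L * ε ^ 2) := by
        rw [abs_mul]; gcongr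
    _ ≤ (c + L + c * L) * ε ^ 2 := by
        have : ε ^ 2 * ε ^ 2 ≤ ε ^ 2 * 1 := by gcongr; nlinarith
        nlinarith [mul_nonneg hc0 hL0]

end Perturbation

/-! ### Symmetric differences tested by bounded functions. -/

section SymmDiff

/-- The difference of the integrals of a bounded function over two sets is controlled by the
measure of their symmetric difference. -/
theorem abs_setIntegral_sub_le {Ω : Type*} [MeasurableSpace Ω] {μ : Measure Ω} {A B : Set Ω}
    (hA : MeasurableSet A) (hB : MeasurableSet B) (hAμ : μ A < ⊤) (hBμ : μ B < ⊤) {f : Ω → ℝ}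
    (hfA : IntegrableOn f A μ) (hfB : IntegrableOn f B μ) {M : ℝ}
    (hM : ∀ x ∈ A ∪ B, |f x| ≤ M) :
    |∫ x in A, f x ∂μ - ∫ x in B, f x ∂μ| ≤ M * μ.real (A ∆ B) := by
  have hAB : MeasurableSet (A ∆ B) := hA.symmDiff hB
  have hABμ : μ (A ∆ B) < ⊤ :=
    (measure_mono symmDiff_le_sup).trans_lt ((measure_union_le A B).trans_lt
      (ENNReal.add_lt_top.2 ⟨hAμ, hBμ⟩))
  rw [← integral_indicator hA, ← integral_indicator hB,
    ← integral_sub ((integrable_indicator_iff hA).2 hfA) ((integrable_indicator_iff hB).2 hfB)]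
  have h : ∫ x, (A ∆ B).indicator (fun _ => M) x ∂μ = M * μ.real (A ∆ B) := by
    rw [integral_indicator hAB, setIntegral_const, smul_eq_mul, mul_comm]
  rw [← h, ← Real.norm_eq_abs]
  refine norm_integral_le_of_norm_le ((integrable_indicator_iff hAB).2
    (integrableOn_const hABμ.ne)) (ae_of_all _ fun x => ?_)
  by_cases hxA : x ∈ A <;> by_cases hxB : x ∈ B
  · simp [hxA, hxB, mem_symmDiff]
  · simpa [hxA, hxB, mem_symmDiff] using hM x (Or.inl hxA)
  · simpa [hxA, hxB, mem_symmDiff] using hM x (Or.inr hxB)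
  · simp [hxA, hxB, mem_symmDiff]

end SymmDiff

/-! ### Translated balls and their first moments. -/

section Translation

variable {n : ℕ} {S : Set (EuclideanSpace ℝ (Fin n))} {α : ℝ}
  {w : EuclideanSpace ℝ (Fin n) → ℝ}

/-- The measure `w dx` is invariant under the translations preserving the cone. -/
theorem IsAdmissibleWeight.measurePreserving_add (hw : IsAdmissibleWeight S α w)
    (hS : IsOpenConvexCone S) (hα : 0 < α) {v : EuclideanSpace ℝ (Fin n)}
    (hv : ∀ x ∈ S, ∀ t : ℝ, x + t • v ∈ S) :
    MeasurePreserving (fun x => x + v) (coneMeasure S w) (coneMeasure S w) := by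
  have hm := hw.measurable_coneDensity hS
  have hdens : ∀ x, coneDensity S w (x + v) = coneDensity S w x := by
    intro x
    by_cases hx : x ∈ S
    · have hxv : x + v ∈ S := by simpa using hv x hx 1
      rw [coneDensity, coneDensity, indicator_of_mem hx, indicator_of_mem hxv,
        hw.add_eq hα (hv x hx)]
    · have hxv : x + v ∉ S := fun h => hx (by simpa using hv _ h (-1))
      rw [coneDensity, coneDensity, indicator_of_notMem hx, indicator_of_notMem hxv]
  refine ⟨by fun_prop, Measure.ext_of_lintegral _ fun f hf => ?_⟩
  have hfv : Measurable fun x => f (x + v) := hf.comp (by fun_prop)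
  rw [lintegral_map hf (by fun_prop), coneMeasure, lintegral_withDensity_eq_lintegral_mul _ hm hfv,
    lintegral_withDensity_eq_lintegral_mul _ hm hf,
    ← lintegral_add_right_eq_self (coneDensity S w * f) v]
  exact lintegral_congr fun x => by simp only [Pi.mul_apply, hdens]

/-- Integrate ⟨v, x⟩ over both balls. Translation by v raises the integral by |v|² times the volume,
while the function is at most |v|(r + |v|) on their union; cancel one factor |v|. -/
theorem IsAdmissibleWeight.norm_mul_le_symmDiff_ball (hw : IsAdmissibleWeight S α w)
    (hS : IsOpenConvexCone S) (hn : 1 ≤ n) (hα : 0 < α) {v : EuclideanSpace ℝ (Fin n)}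
    (hv : ∀ x ∈ S, ∀ t : ℝ, x + t • v ∈ S) {r : ℝ} (hr : 0 ≤ r) :
    coneMeasure S w (ball v r ∩ S) = coneMeasure S w (ball 0 r ∩ S) ∧
    ‖v‖ * (coneMeasure S w).real (ball 0 r ∩ S) ≤
      (r + ‖v‖) * (coneMeasure S w).real ((ball v r ∩ S) ∆ (ball 0 r ∩ S)) := by
  have hmp := hw.measurePreserving_add hS hα hv
  have hpre : (fun x => x + v) ⁻¹' (ball v r ∩ S) = ball 0 r ∩ S := by
    ext x
    have : x + v ∈ S ↔ x ∈ S :=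
      ⟨fun h => by simpa using hv _ h (-1), fun h => by simpa using hv x h 1⟩
    simp [this]
  have hmA : ∀ z : EuclideanSpace ℝ (Fin n), MeasurableSet (ball z r ∩ S) := fun z =>
    measurableSet_ball.inter hS.isOpen.measurableSet
  have heq : coneMeasure S w (ball v r ∩ S) = coneMeasure S w (ball 0 r ∩ S) := by
    rw [← hpre, hmp.measure_preimage (hmA v).nullMeasurableSet]
  refine ⟨heq, ?_⟩
  have hlt := hw.coneMeasure_ball_lt_top hS hn hα r
  have hbd : ∀ z : EuclideanSpace ℝ (Fin n), ‖z‖ ≤ ‖v‖ → ∀ x ∈ ball z r ∩ S,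
      |inner ℝ v x| ≤ ‖v‖ * (r + ‖v‖) := by
    intro z hz x hx
    refine (abs_real_inner_le_norm v x).trans (mul_le_mul_of_nonneg_left ?_ (norm_nonneg v))
    have h1 : ‖x - z‖ < r := by simpa [dist_eq_norm] using hx.1
    calc ‖x‖ = ‖(x - z) + z‖ := by rw [sub_add_cancel]
      _ ≤ ‖x - z‖ + ‖z‖ := norm_add_le _ _
      _ ≤ r + ‖v‖ := by linarith
  have hint : ∀ z : EuclideanSpace ℝ (Fin n), ‖z‖ ≤ ‖v‖ → coneMeasure S w (ball z r ∩ S) < ⊤ →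
      IntegrableOn (fun x => inner ℝ v x) (ball z r ∩ S) (coneMeasure S w) := by
    intro z hz hfin
    refine IntegrableOn.of_bound hfin (by fun_prop) (‖v‖ * (r + ‖v‖)) ?_
    filter_upwards [ae_restrict_mem (hmA z)] with x hx using hbd z hz x hx
  have h0 := hint 0 (by simp) hlt
  have h1 := hint v le_rfl (heq ▸ hlt)
  have hmom : ∫ x in ball v r ∩ S, inner ℝ v x ∂(coneMeasure S w) =
      ∫ x in ball 0 r ∩ S, inner ℝ v x ∂(coneMeasure S w) +
        ‖v‖ ^ 2 * (coneMeasure S w).real (ball 0 r ∩ S) := by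
    have hemb : MeasurableEmbedding fun x : EuclideanSpace ℝ (Fin n) => x + v :=
      (Homeomorph.addRight v).measurableEmbedding
    rw [← hmp.setIntegral_preimage_emb hemb, hpre]
    simp only [inner_add_right, real_inner_self_eq_norm_sq]
    rw [integral_add h0 (integrableOn_const hlt.ne), setIntegral_const, smul_eq_mul, mul_comm]
  have hdiff := abs_setIntegral_sub_le (hmA v) (hmA 0) (heq ▸ hlt) hlt h1 h0
    (M := ‖v‖ * (r + ‖v‖)) (by
      rintro x (hx | hx)
      · exact hbd v le_rfl x hx
      · exact hbd 0 (by simp) x hx)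
  rw [hmom, add_sub_cancel_left, abs_of_nonneg (by positivity)] at hdiff
  rcases (norm_nonneg v).eq_or_lt with h | h
  · rw [← h, zero_mul]
    have := measureReal_nonneg (μ := coneMeasure S w) (s := (ball v r ∩ S) ∆ (ball 0 r ∩ S))
    positivity
  · refine le_of_mul_le_mul_left ?_ h
    linarith

end Translation

/-! ### Balls containing the origin as star-shaped bodies. -/

section RadialBall

variable {n : ℕ} {S : Set (EuclideanSpace ℝ (Fin n))}

/-- The radial function of a ball containing the origin. -/
noncomputable def ballRadial (v : EuclideanSpace ℝ (Fin n)) (r : ℝ)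
    (θ : EuclideanSpace ℝ (Fin n)) : ℝ :=
  inner ℝ v θ + √(r ^ 2 - ‖v‖ ^ 2 + inner ℝ v θ ^ 2)

theorem measurable_ballRadial (v : EuclideanSpace ℝ (Fin n)) (r : ℝ) :
    Measurable (ballRadial v r) := by
  unfold ballRadial; fun_prop

theorem ballRadial_pos {v θ : EuclideanSpace ℝ (Fin n)} {r : ℝ} (hv : ‖v‖ < r) :
    |inner ℝ v θ| < √(r ^ 2 - ‖v‖ ^ 2 + inner ℝ v θ ^ 2) := by
  refine Real.lt_sqrt_of_sq_lt ?_
  rw [sq_abs]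
  have : ‖v‖ ^ 2 < r ^ 2 := pow_lt_pow_left₀ hv (norm_nonneg v) two_ne_zero
  linarith

/-- The ray through θ leaves the ball at a root of the quadratic |tθ - v|² = r². As |v| < r, one
root is negative and the other is the radial function. -/
theorem ball_inter_eq_starBody_ballRadial (h0 : (0 : EuclideanSpace ℝ (Fin n)) ∉ S)
    {v : EuclideanSpace ℝ (Fin n)} {r : ℝ} (hv : ‖v‖ < r) :
    ball v r ∩ S = starBody S (ballRadial v r) := by
  ext x
  simp only [starBody, mem_inter_iff, mem_ofPred_eq, and_comm (a := x ∈ ball v r)]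
  refine and_congr_right fun hx => ?_
  have hx0 : x ≠ 0 := fun h => h0 (h ▸ hx)
  have hr : 0 < r := (norm_nonneg v).trans_lt hv
  have hinner : inner ℝ v x = ‖x‖ * inner ℝ v (dir x) := by
    conv_lhs => rw [← norm_smul_dir x, inner_smul_right]
  set s := inner ℝ v (dir x) with hs
  have hsq := ballRadial_pos (θ := dir x) hv
  rw [← hs] at hsq
  have hrad : 0 ≤ r ^ 2 - ‖v‖ ^ 2 + s ^ 2 := by
    have : ‖v‖ ^ 2 < r ^ 2 := pow_lt_pow_left₀ hv (norm_nonneg v) two_ne_zero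
    positivity [sub_pos.2 this]
  rw [mem_ball, dist_eq_norm, ballRadial, ← hs, ← sub_lt_iff_lt_add']
  rw [← pow_lt_pow_iff_left₀ (norm_nonneg _) hr.le two_ne_zero, norm_sub_sq_real,
    real_inner_comm, hinner]
  have hs' := abs_lt.1 hsq
  constructor
  · intro h
    refine Real.lt_sqrt_of_sq_lt ?_
    nlinarith
  · intro h
    have h2 : (‖x‖ - s) ^ 2 < r ^ 2 - ‖v‖ ^ 2 + s ^ 2 := by
      rw [← Real.sq_sqrt hrad]
      refine sq_lt_sq' ?_ h
      linarith [norm_nonneg x]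
    nlinarith

/-- To first order, moving the centre by v adds the linear function ⟨v, θ⟩ to the radial function.
The remainder is √q - 1, bounded by |q - 1|, and r + 1 ≤ 3 yields the factor 3. -/
theorem abs_ballRadial_sub_le {v θ : EuclideanSpace ℝ (Fin n)} {r : ℝ} (hv : ‖v‖ < r)
    (hr : r ≤ 2) (hθ : ‖θ‖ = 1) :
    |ballRadial v r θ - 1 - inner ℝ v θ| ≤ 3 * |r - 1| + ‖v‖ ^ 2 := by
  set s := inner ℝ v θ with hs
  have hs2 : s ^ 2 ≤ ‖v‖ ^ 2 := by
    have := abs_real_inner_le_norm v θ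
    rw [hθ, mul_one] at this
    rw [← sq_abs]
    exact pow_le_pow_left₀ (abs_nonneg _) this 2
  have hr0 : 0 < r := (norm_nonneg v).trans_lt hv
  have hvr : ‖v‖ ^ 2 < r ^ 2 := pow_lt_pow_left₀ hv (norm_nonneg v) two_ne_zero
  set q := r ^ 2 - ‖v‖ ^ 2 + s ^ 2 with hq
  have hq0 : 0 ≤ q := by nlinarith [sq_nonneg s]
  have e : ballRadial v r θ - 1 - s = √q - 1 := by rw [ballRadial]; ring
  have h1 : |√q - 1| ≤ |q - 1| := by
    have : q - 1 = (√q - 1) * (√q + 1) := by nlinarith [Real.sq_sqrt hq0]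
    rw [this, abs_mul]
    refine le_mul_of_one_le_right (abs_nonneg _) ?_
    rw [abs_of_nonneg (by positivity)]
    linarith [Real.sqrt_nonneg q]
  rw [e]
  refine h1.trans ?_
  have h2 : q - 1 = (r - 1) * (r + 1) + (s ^ 2 - ‖v‖ ^ 2) := by rw [hq]; ring
  rw [h2]
  refine (abs_add_le _ _).trans (add_le_add ?_ ?_)
  · rw [abs_mul, mul_comm, abs_of_pos (show 0 < r + 1 by linarith)]
    exact mul_le_mul_of_nonneg_right (by linarith) (abs_nonneg _)
  · rw [abs_le]
    constructor <;> nlinarith [sq_nonneg s, sq_nonneg ‖v‖]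

end RadialBall

/-! ### Projection onto the linear functions generated by translations. -/

section Projection

variable {n : ℕ} {S : Set (EuclideanSpace ℝ (Fin n))} {α : ℝ}
  {w η : EuclideanSpace ℝ (Fin n) → ℝ}

theorem IsAdmissibleWeight.integrable_of_continuousOn (hw : IsAdmissibleWeight S α w)
    (hS : IsOpenConvexCone S) {f : EuclideanSpace ℝ (Fin n) → ℝ} (hf : ContinuousOn f S) {M : ℝ}
    (hM : ∀ x ∈ S, ‖x‖ = 1 → |f x| ≤ M) :
    Integrable (fun θ : sphere (0 : EuclideanSpace ℝ (Fin n)) 1 => f θ) (sphereMeasure S w) := by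
  have hfin := hw.isFiniteMeasure_sphereMeasure
  refine Integrable.of_bound (aemeasurable_sphereMeasure hw hS hf).aestronglyMeasurable M ?_
  filter_upwards [hw.ae_mem_sphereMeasure hS] with θ hθ using hM θ hθ (by simp)

/-- Orthogonal projection, in the weighted `L²` space of the sphere, onto the linear functions
with gradient in a subspace of directions preserving the cone. -/
theorem IsAdmissibleWeight.exists_linear_projection (hw : IsAdmissibleWeight S α w)
    (hS : IsOpenConvexCone S) (hα : 0 < α) (h0 : (0 : EuclideanSpace ℝ (Fin n)) ∉ S)
    (L : Submodule ℝ (EuclideanSpace ℝ (Fin n))) (hL : ∀ x ∈ S, ∀ v ∈ L, x + v ∈ S)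
    {h : EuclideanSpace ℝ (Fin n) → ℝ} (hh : ContinuousOn h S) {M : ℝ}
    (hM : ∀ x ∈ S, |h x| ≤ M) :
    ∃ ℓ ∈ L, ∀ v ∈ L, ∫ θ : sphere (0 : EuclideanSpace ℝ (Fin n)) 1,
      (inner ℝ v (θ : EuclideanSpace ℝ (Fin n))) * (h θ - inner ℝ ℓ (θ : EuclideanSpace ℝ (Fin n)))
        ∂(sphereMeasure S w) = 0 := by
  have hvb : ∀ v x : EuclideanSpace ℝ (Fin n), ‖x‖ = 1 → |inner ℝ v x| ≤ ‖v‖ := fun v x hx => by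
    simpa [hx] using abs_real_inner_le_norm v x
  have hi2 : ∀ u v : EuclideanSpace ℝ (Fin n),
      Integrable (fun θ : sphere (0 : EuclideanSpace ℝ (Fin n)) 1 =>
        inner ℝ u (θ : EuclideanSpace ℝ (Fin n)) * inner ℝ v (θ : EuclideanSpace ℝ (Fin n)))
        (sphereMeasure S w) := fun u v =>
    hw.integrable_of_continuousOn hS (f := fun x => inner ℝ u x * inner ℝ v x)
      (by fun_prop) (M := ‖u‖ * ‖v‖) fun x _ hx => by
        rw [abs_mul]
        exact mul_le_mul (hvb u x hx) (hvb v x hx) (abs_nonneg _) (norm_nonneg _)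
  have hih : ∀ v : EuclideanSpace ℝ (Fin n),
      Integrable (fun θ : sphere (0 : EuclideanSpace ℝ (Fin n)) 1 =>
        inner ℝ v (θ : EuclideanSpace ℝ (Fin n)) * h θ) (sphereMeasure S w) := fun v =>
    hw.integrable_of_continuousOn hS (f := fun x => inner ℝ v x * h x)
      (by fun_prop) (M := ‖v‖ * M) fun x hxS hx => by
        rw [abs_mul]
        exact mul_le_mul (hvb v x hx) (hM x hxS) (abs_nonneg _) (norm_nonneg _)
  let B : L →ₗ[ℝ] Module.Dual ℝ L := LinearMap.mk₂ ℝ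
    (fun u v => ∫ θ : sphere (0 : EuclideanSpace ℝ (Fin n)) 1,
      inner ℝ (u : EuclideanSpace ℝ (Fin n)) (θ : EuclideanSpace ℝ (Fin n)) *
        inner ℝ (v : EuclideanSpace ℝ (Fin n)) (θ : EuclideanSpace ℝ (Fin n)) ∂(sphereMeasure S w))
    (fun u u' v => by
      simp only [Submodule.coe_add, inner_add_left, add_mul]
      exact integral_add (hi2 _ _) (hi2 _ _))
    (fun c u v => by
      simp only [Submodule.coe_smul, real_inner_smul_left, mul_assoc, smul_eq_mul]
      exact integral_const_mul _ _)
    (fun u v v' => by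
      simp only [Submodule.coe_add, inner_add_left, mul_add]
      exact integral_add (hi2 _ _) (hi2 _ _))
    (fun c u v => by
      simp only [Submodule.coe_smul, real_inner_smul_left, mul_left_comm _ c, smul_eq_mul]
      exact integral_const_mul _ _)
  -- If ⟨u, ·⟩ has zero weighted L² norm, it vanishes on the cone; comparing x with x + u, both in
  -- the cone, gives |u|² = 0. In finite dimension the Gram form is then onto the dual, which
  -- provides the projection.
  have hinj : Function.Injective B := by
    rw [← LinearMap.ker_eq_bot, LinearMap.ker_eq_bot']
    intro u hu
    have hu' : ∫ θ : sphere (0 : EuclideanSpace ℝ (Fin n)) 1,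
      inner ℝ (u : EuclideanSpace ℝ (Fin n)) (θ : EuclideanSpace ℝ (Fin n)) *
        inner ℝ (u : EuclideanSpace ℝ (Fin n)) (θ : EuclideanSpace ℝ (Fin n))
        ∂(sphereMeasure S w) = 0 := LinearMap.congr_fun hu u
    rw [integral_eq_zero_iff_of_nonneg (fun θ => mul_self_nonneg _) (hi2 _ _)] at hu'
    have hz : ∀ x ∈ S, inner ℝ (u : EuclideanSpace ℝ (Fin n)) x = 0 := by
      intro x hx
      have hx0 : x ≠ 0 := fun h => h0 (h ▸ hx)
      have := hw.eq_zero_of_ae hS hα (f := fun x => inner ℝ (u : EuclideanSpace ℝ (Fin n)) x)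
        (by fun_prop) (by
          filter_upwards [hu'] with θ hθ
          simpa using hθ) (hS.dir_mem h0 hx) (norm_dir hx0)
      rw [← norm_smul_dir x, inner_smul_right, this, mul_zero]
    obtain ⟨x, hx, -⟩ := hw.exists_unit_mem hS h0
    have h1 := hz x hx
    have h2 := hz _ (hL x hx u u.2)
    rw [inner_add_right, h1, zero_add, real_inner_self_eq_norm_sq] at h2
    simpa using h2
  have hsurj : Function.Surjective B :=
    (LinearMap.injective_iff_surjective_of_finrank_eq_finrank
      Subspace.dual_finrank_eq.symm).1 hinj
  let F : Module.Dual ℝ L :=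
    { toFun := fun v => ∫ θ : sphere (0 : EuclideanSpace ℝ (Fin n)) 1,
        inner ℝ (v : EuclideanSpace ℝ (Fin n)) (θ : EuclideanSpace ℝ (Fin n)) * h θ
          ∂(sphereMeasure S w)
      map_add' := fun v v' => by
        simp only [Submodule.coe_add, inner_add_left, add_mul]
        exact integral_add (hih _) (hih _)
      map_smul' := fun c v => by
        simp only [Submodule.coe_smul, real_inner_smul_left, mul_assoc, smul_eq_mul,
          RingHom.id_apply]
        exact integral_const_mul _ _ }
  obtain ⟨ℓ, hℓ⟩ := hsurj F
  refine ⟨ℓ, ℓ.2, fun v hv => ?_⟩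
  have := LinearMap.congr_fun hℓ ⟨v, hv⟩
  have e1 : ∫ θ : sphere (0 : EuclideanSpace ℝ (Fin n)) 1,
      inner ℝ (ℓ : EuclideanSpace ℝ (Fin n)) (θ : EuclideanSpace ℝ (Fin n)) *
        inner ℝ v (θ : EuclideanSpace ℝ (Fin n)) ∂(sphereMeasure S w) =
      ∫ θ : sphere (0 : EuclideanSpace ℝ (Fin n)) 1,
        inner ℝ v (θ : EuclideanSpace ℝ (Fin n)) * h θ ∂(sphereMeasure S w) := this
  simp only [mul_sub]
  rw [integral_sub (hih v) (hi2 v ℓ), ← e1, sub_eq_zero]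
  exact integral_congr_ae (ae_of_all _ fun θ => mul_comm _ _)

end Projection

/-! ### First-order lower bound for the asymmetry. -/

section Asymmetry

variable {n : ℕ} {S : Set (EuclideanSpace ℝ (Fin n))} {α : ℝ}
  {w η : EuclideanSpace ℝ (Fin n) → ℝ}

theorem abs_sub_one_le_abs_rpow_sub_one {D r : ℝ} (hD : 1 ≤ D) (hr : 0 < r) :
    |r - 1| ≤ |r ^ D - 1| := by
  rcases le_total 1 r with h | h
  · have h1 : r ≤ r ^ D := by
      simpa using Real.rpow_le_rpow_of_exponent_le h hD
    rw [abs_of_nonneg (by linarith), abs_of_nonneg (by linarith)]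
    linarith
  · have h1 : r ^ D ≤ r := by
      simpa using Real.rpow_le_rpow_of_exponent_ge hr h hD
    rw [abs_of_nonpos (by linarith), abs_of_nonpos (by linarith)]
    linarith

theorem coneMeasure_perturbedBall_lt_top (hη : IsAdmissiblePerturbation S w η)
    (hw : IsAdmissibleWeight S α w) (hS : IsOpenConvexCone S) (hn : 1 ≤ n) (hα : 0 < α)
    (h0 : (0 : EuclideanSpace ℝ (Fin n)) ∉ S)
    {M : ℝ} (hM : ∀ x ∈ S, |radialExt η x| ≤ M) {ε : ℝ} (hε : 0 < ε) (hεM : ε * M ≤ 1 / 2) :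
    coneMeasure S w (perturbedBall S η ε) < ⊤ := by
  have hρ := hη.isRadialFunction hM hε hεM
  rw [perturbedBall_eq_starBody hS h0]
  exact hw.coneMeasure_starBody_lt_top hS hn hα (hρ.measurable_indicator hS) hρ.indicator_nonneg
    (M := 3 / 2) fun θ hθ _ => by rw [indicator_of_mem hθ]; exact hρ.upper θ hθ

theorem measurableSet_perturbedBall (hη : IsAdmissiblePerturbation S w η)
    (hS : IsOpenConvexCone S) (h0 : (0 : EuclideanSpace ℝ (Fin n)) ∉ S)
    {M : ℝ} (hM : ∀ x ∈ S, |radialExt η x| ≤ M) {ε : ℝ} (hε : 0 < ε) (hεM : ε * M ≤ 1 / 2) :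
    MeasurableSet (perturbedBall S η ε) := by
  rw [perturbedBall_eq_starBody hS h0]
  exact measurableSet_starBody hS ((hη.isRadialFunction hM hε hεM).measurable_indicator hS)

/-- The perturbed ball is close to the centred ball of the same volume. -/
theorem IsAdmissiblePerturbation.exists_near_ball (hη : IsAdmissiblePerturbation S w η)
    (hw : IsAdmissibleWeight S α w) (hS : IsOpenConvexCone S) (hn : 1 ≤ n) (hα : 0 < α)
    (h0 : (0 : EuclideanSpace ℝ (Fin n)) ∉ S) {M : ℝ} (hM0 : 0 < M)
    (hM : ∀ x ∈ S, |radialExt η x| ≤ M) :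
    ∃ C ε₀ : ℝ, 0 ≤ C ∧ 0 < ε₀ ∧ ∀ ε : ℝ, 0 < ε → ε < ε₀ → ∀ r : ℝ, 0 < r →
      coneMeasure S w (perturbedBall S η ε) = coneMeasure S w (ball 0 r ∩ S) →
      |r - 1| ≤ C * ε ^ 2 ∧
      (coneMeasure S w).real (perturbedBall S η ε ∆ (ball 0 r ∩ S)) ≤ C * ε ∧
      (coneMeasure S w).real (ball 0 1 ∩ S) / 2 ≤ (coneMeasure S w).real (ball 0 r ∩ S) := by
  have hn1 : (1 : ℝ) ≤ n := by exact_mod_cast hn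
  have hD1 : 1 ≤ (n : ℝ) + α := by linarith
  set D := (n : ℝ) + α with hDdef
  have hball : ∀ s : ℝ, 0 ≤ s → (coneMeasure S w).real (ball 0 s ∩ S) =
      s ^ D * (coneMeasure S w).real (ball 0 1 ∩ S) := fun s hs => by
    rw [hw.coneMeasure_real_ball hS hn hα hs, hw.coneMeasure_real_ball hS hn hα zero_le_one,
      Real.one_rpow, one_mul]
  have hm0 : 0 < (coneMeasure S w).real (ball 0 1 ∩ S) := by
    rw [hw.coneMeasure_real_ball hS hn hα zero_le_one, Real.one_rpow, one_mul]
    exact div_pos (hw.sphereMeasure_real_pos hS hα h0) (by linarith)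
  set m₀ := (coneMeasure S w).real (ball 0 1 ∩ S) with hm₀
  obtain ⟨C, hC0, hC⟩ := hη.exists_volume_bound hw hS hn hα h0 hM
  obtain ⟨K, hK0, hK⟩ := exists_rpow_taylor D
  set C₁ := C / m₀ with hC₁
  have hC₁0 : 0 ≤ C₁ := by positivity
  -- With κ = εM₁, both ε|η| ≤ κ and |r - 1| ≤ κ hold, so the symmetric difference lies in the
  -- annulus between 1 - κ and 1 + κ.
  set M₁ := M + C₁ with hM₁
  have hM₁0 : 0 < M₁ := by positivity
  refine ⟨max C₁ ((2 * D + K) * M₁ * m₀), min 1 (1 / (2 * M₁)), le_max_of_le_left hC₁0,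
    by positivity, fun ε hε hε' r hr heq => ?_⟩
  have hε1 : ε ≤ 1 := hε'.le.trans (min_le_left _ _)
  have hεM₁ : ε * M₁ ≤ 1 / 2 := by
    have := hε'.le.trans (min_le_right _ _)
    rw [le_div_iff₀ (by positivity)] at this
    linarith
  have hεM : ε * M ≤ 1 / 2 := le_trans (by rw [hM₁]; nlinarith) hεM₁
  have hvol := hC ε hε hεM
  rw [measureReal_def, heq, ← measureReal_def, hball r hr.le, ← sub_one_mul, abs_mul,
    abs_of_pos hm0] at hvol
  have hrD : |r ^ D - 1| ≤ C₁ * ε ^ 2 := by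
    rw [hC₁, div_mul_eq_mul_div, le_div_iff₀ hm0]
    exact hvol
  have hr1 : |r - 1| ≤ C₁ * ε ^ 2 := (abs_sub_one_le_abs_rpow_sub_one hD1 hr).trans hrD
  have hε2 : ε ^ 2 ≤ ε := by nlinarith
  have hC₁ε : C₁ * ε ^ 2 ≤ ε * M₁ := by
    rw [hM₁]; nlinarith
  refine ⟨hr1.trans (mul_le_mul_of_nonneg_right (le_max_left _ _) (by positivity)), ?_, ?_⟩
  · set κ := ε * M₁ with hκ
    have hκ0 : 0 < κ := by positivity
    have hrκ := abs_le.1 (hr1.trans hC₁ε)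
    have hηκ : ∀ x ∈ S, 1 - κ ≤ 1 + ε * radialExt η x ∧ 1 + ε * radialExt η x ≤ 1 + κ := by
      intro x hx
      have h1 := abs_le.1 (hM x hx)
      rw [hκ, hM₁]
      constructor <;> nlinarith
    have hsub : perturbedBall S η ε ∆ (ball 0 r ∩ S) ⊆
        (ball 0 (1 + κ) ∩ S) \ (ball 0 (1 - κ) ∩ S) := by
      rw [perturbedBall_eq_starBody hS h0]
      rintro x (⟨⟨hxS, hx⟩, hx'⟩ | ⟨⟨hx, hxS⟩, hx'⟩)
      · have hd := hS.dir_mem h0 hxS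
        rw [indicator_of_mem hd] at hx
        refine ⟨⟨by simpa using hx.trans_le (hηκ _ hd).2, hxS⟩, fun h => hx' ⟨?_, hxS⟩⟩
        have := h.1
        simp only [mem_ball, dist_zero_right] at this ⊢
        linarith
      · have hd := hS.dir_mem h0 hxS
        simp only [mem_ball, dist_zero_right] at hx
        refine ⟨⟨?_, hxS⟩, fun h => hx' ⟨hxS, ?_⟩⟩
        · simp only [mem_ball, dist_zero_right]
          linarith
        · rw [indicator_of_mem hd]
          have := h.1
          simp only [mem_ball, dist_zero_right] at this
          linarith [(hηκ _ hd).1]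
    have hfin := hw.coneMeasure_ball_lt_top hS hn hα (1 + κ)
    refine (measureReal_mono hsub ((measure_mono sdiff_subset).trans_lt hfin).ne).trans ?_
    rw [measureReal_sdiff (inter_subset_inter_left _ (ball_subset_ball (by linarith)))
      (measurableSet_ball.inter hS.isOpen.measurableSet)
      (hw.coneMeasure_ball_lt_top hS hn hα _).ne, hball _ (by linarith), hball _ (by linarith)]
    have h1 := abs_le.1 (hK κ (by rw [abs_of_pos hκ0]; exact hεM₁))
    have h2 := abs_le.1 (hK (-κ) (by rw [abs_neg, abs_of_pos hκ0]; exact hεM₁))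
    rw [← sub_eq_add_neg] at h2
    have h3 : (1 + κ) ^ D - (1 - κ) ^ D ≤ (2 * D + K) * κ := by nlinarith
    calc (1 + κ) ^ D * m₀ - (1 - κ) ^ D * m₀ = ((1 + κ) ^ D - (1 - κ) ^ D) * m₀ := by ring
      _ ≤ (2 * D + K) * κ * m₀ := by gcongr
      _ = (2 * D + K) * M₁ * m₀ * ε := by rw [hκ]; ring
      _ ≤ _ := mul_le_mul_of_nonneg_right (le_max_right _ _) hε.le
  · rw [hball r hr.le]
    have h1 := (abs_le.1 (hrD.trans (hC₁ε.trans hεM₁))).1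
    nlinarith

/-- A bounded function of the direction which detects the perturbation and is orthogonal to the
linear functions coming from translations. -/
theorem IsAdmissiblePerturbation.exists_dual_function (hη : IsAdmissiblePerturbation S w η)
    (hw : IsAdmissibleWeight S α w) (hS : IsOpenConvexCone S) (hα : 0 < α)
    (h0 : (0 : EuclideanSpace ℝ (Fin n)) ∉ S)
    (L : Submodule ℝ (EuclideanSpace ℝ (Fin n))) (hL : ∀ x ∈ S, ∀ v ∈ L, x + v ∈ S)
    (hne : ¬ ∃ ℓ ∈ L, ∀ θ ∈ sphere (0 : EuclideanSpace ℝ (Fin n)) 1 ∩ S, η θ = inner ℝ ℓ θ) :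
    ∃ (g : EuclideanSpace ℝ (Fin n) → ℝ) (B : ℝ), Measurable g ∧ 0 < B ∧ (∀ x, |g x| ≤ B) ∧
      (∀ v ∈ L, ∫ θ : sphere (0 : EuclideanSpace ℝ (Fin n)) 1,
        inner ℝ v (θ : EuclideanSpace ℝ (Fin n)) * g θ ∂(sphereMeasure S w) = 0) ∧
      0 < ∫ θ : sphere (0 : EuclideanSpace ℝ (Fin n)) 1,
        radialExt η θ * g θ ∂(sphereMeasure S w) := by
  have hfin := hw.isFiniteMeasure_sphereMeasure
  obtain ⟨M, hM0, hM⟩ := hη.exists_bound hS h0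
  have hhc := hη.smooth.continuousOn
  obtain ⟨ℓ, hℓL, hℓ⟩ := hw.exists_linear_projection hS hα h0 L hL hhc hM
  have hdc : ContinuousOn (dir : EuclideanSpace ℝ (Fin n) → _) S :=
    (continuousOn_id.norm.inv₀ fun x hx => norm_ne_zero_iff.2 fun h => h0 (h ▸ hx)).smul
      continuousOn_id
  -- ψ is η minus its projection. Orthogonality to ℓ turns ∫ ηψ into ∫ ψ².
  let ψ : EuclideanSpace ℝ (Fin n) → ℝ := fun x => radialExt η x - inner ℝ ℓ (dir x)
  have hψc : ContinuousOn ψ S := hhc.sub (continuousOn_const.inner hdc)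
  have hB0 : 0 < M + ‖ℓ‖ := by positivity
  have hψb : ∀ x ∈ S, |ψ x| ≤ M + ‖ℓ‖ := fun x hx => by
    refine (abs_sub _ _).trans (add_le_add (hM x hx) ?_)
    have := abs_real_inner_le_norm ℓ (dir x)
    rwa [norm_dir fun h => h0 (h ▸ hx), mul_one] at this
  have hψθ : ∀ θ : sphere (0 : EuclideanSpace ℝ (Fin n)) 1,
      ψ θ = radialExt η θ - inner ℝ ℓ (θ : EuclideanSpace ℝ (Fin n)) := fun θ => by
    simp only [ψ]
    rw [dir_of_norm_eq_one (x := (θ : EuclideanSpace ℝ (Fin n))) (by simp)]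
  have hgψ : ∀ᵐ θ : sphere (0 : EuclideanSpace ℝ (Fin n)) 1 ∂(sphereMeasure S w),
      S.indicator ψ θ = radialExt η θ - inner ℝ ℓ (θ : EuclideanSpace ℝ (Fin n)) := by
    filter_upwards [hw.ae_mem_sphereMeasure hS] with θ hθ
    rw [indicator_of_mem hθ, hψθ]
  have hlin0 : ∀ v ∈ L, ∫ θ : sphere (0 : EuclideanSpace ℝ (Fin n)) 1,
      inner ℝ v (θ : EuclideanSpace ℝ (Fin n)) * S.indicator ψ θ ∂(sphereMeasure S w) = 0 :=
    fun v hv => by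
      rw [← hℓ v hv]
      refine integral_congr_ae ?_
      filter_upwards [hgψ] with θ hθ
      rw [hθ]
  refine ⟨S.indicator ψ, M + ‖ℓ‖, measurable_indicator_of_continuousOn hS.isOpen hψc, hB0,
    fun x => ?_, hlin0, ?_⟩
  · by_cases hx : x ∈ S
    · rw [indicator_of_mem hx]; exact hψb x hx
    · rw [indicator_of_notMem hx, abs_zero]; exact hB0.le
  have hsq : Integrable (fun θ : sphere (0 : EuclideanSpace ℝ (Fin n)) 1 => ψ θ * ψ θ)
      (sphereMeasure S w) :=
    hw.integrable_of_continuousOn hS (f := fun θ => ψ θ * ψ θ) (hψc.mul hψc)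
      (M := (M + ‖ℓ‖) * (M + ‖ℓ‖)) fun x hx _ => by
        rw [abs_mul]
        exact mul_le_mul (hψb x hx) (hψb x hx) (abs_nonneg _) hB0.le
  have hlin : Integrable (fun θ : sphere (0 : EuclideanSpace ℝ (Fin n)) 1 =>
        inner ℝ ℓ (θ : EuclideanSpace ℝ (Fin n)) * ψ θ) (sphereMeasure S w) :=
    hw.integrable_of_continuousOn hS (f := fun θ => inner ℝ ℓ θ * ψ θ)
      (ContinuousOn.mul (by fun_prop) hψc) (M := ‖ℓ‖ * (M + ‖ℓ‖)) fun x hx hx1 => by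
        rw [abs_mul]
        refine mul_le_mul ?_ (hψb x hx) (abs_nonneg _) (norm_nonneg _)
        simpa [hx1] using abs_real_inner_le_norm ℓ x
  have h1 : ∫ θ : sphere (0 : EuclideanSpace ℝ (Fin n)) 1, radialExt η θ * S.indicator ψ θ
      ∂(sphereMeasure S w) = ∫ θ : sphere (0 : EuclideanSpace ℝ (Fin n)) 1,
        (ψ θ * ψ θ + inner ℝ ℓ (θ : EuclideanSpace ℝ (Fin n)) * ψ θ) ∂(sphereMeasure S w) := by
    refine integral_congr_ae ?_
    filter_upwards [hgψ] with θ hθ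
    rw [hθ, hψθ]
    ring
  have h2 : ∫ θ : sphere (0 : EuclideanSpace ℝ (Fin n)) 1,
      inner ℝ ℓ (θ : EuclideanSpace ℝ (Fin n)) * ψ θ ∂(sphereMeasure S w) = 0 := by
    simp only [hψθ]
    exact hℓ ℓ hℓL
  rw [h1, integral_add hsq hlin, h2, add_zero]
  -- If ∫ ψ² were zero, continuity would make η equal to ⟨ℓ, ·⟩ on the sphere, the excluded case.
  refine lt_of_le_of_ne (integral_nonneg fun θ => mul_self_nonneg _) fun h => hne ⟨ℓ, hℓL, ?_⟩
  have h' := (integral_eq_zero_iff_of_nonneg (fun θ => mul_self_nonneg _) hsq).1 h.symm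
  rintro θ ⟨hθ1, hθ⟩
  have hθ1' : ‖θ‖ = 1 := by simpa using hθ1
  have := hw.eq_zero_of_ae hS hα hψc (by
    filter_upwards [h'] with y hy
    simpa using hy) hθ hθ1'
  have h3 := hψθ ⟨θ, hθ1⟩
  simp only [this] at h3
  rw [← radialExt_of_norm_eq_one η hθ1']
  exact (sub_eq_zero.1 h3.symm)

/-- First order expansion of integrals of functions of the direction over the perturbed ball. -/
theorem IsAdmissiblePerturbation.exists_integral_perturbedBall
    (hη : IsAdmissiblePerturbation S w η)
    (hw : IsAdmissibleWeight S α w) (hS : IsOpenConvexCone S) (hn : 1 ≤ n) (hα : 0 < α)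
    (h0 : (0 : EuclideanSpace ℝ (Fin n)) ∉ S) {M : ℝ} (hM : ∀ x ∈ S, |radialExt η x| ≤ M)
    {g : EuclideanSpace ℝ (Fin n) → ℝ} (hg : Measurable g) {B : ℝ} (hB : ∀ x, |g x| ≤ B) :
    ∃ C : ℝ, 0 ≤ C ∧ ∀ ε : ℝ, 0 < ε → ε * M ≤ 1 / 2 →
      |((n : ℝ) + α) * ∫ x in perturbedBall S η ε, g (dir x) ∂(coneMeasure S w)
        - ∫ θ : sphere (0 : EuclideanSpace ℝ (Fin n)) 1, g θ ∂(sphereMeasure S w)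
        - ((n : ℝ) + α) * (ε * ∫ θ : sphere (0 : EuclideanSpace ℝ (Fin n)) 1,
          radialExt η θ * g θ ∂(sphereMeasure S w))| ≤ C * ε ^ 2 := by
  have hfin := hw.isFiniteMeasure_sphereMeasure
  have hD : 0 < (n : ℝ) + α := by positivity
  obtain ⟨C, hC0, hC⟩ := exists_integral_rpow_taylor (sphereMeasure S w) ((n : ℝ) + α)
    (ψ := fun θ => g θ) (hg.comp measurable_subtype_coe).aestronglyMeasurable
    (ae_of_all _ fun θ => hB θ)
  refine ⟨C * M ^ 2, by positivity, fun ε hε hεM => ?_⟩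
  have hρ := hη.isRadialFunction hM hε hεM
  have h := hC (fun θ => ε * radialExt η θ) (ε * M)
    ((aemeasurable_sphereMeasure hw hS hη.smooth.continuousOn).const_mul ε) hεM (by
      filter_upwards [hw.ae_mem_sphereMeasure hS] with θ hθ
      rw [abs_mul, abs_of_pos hε]
      exact mul_le_mul_of_nonneg_left (hM θ hθ) hε.le)
  simp only [mul_assoc ε, integral_const_mul] at h
  rw [perturbedBall_eq_starBody hS h0, hw.integral_starBody hS hn hα (hρ.measurable_indicator hS)
    hρ.indicator_nonneg hg, ← integral_const_mul]
  have h1 : ∫ θ : sphere (0 : EuclideanSpace ℝ (Fin n)) 1, ((n : ℝ) + α) *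
      (S.indicator (fun x => 1 + ε * radialExt η x) θ ^ ((n : ℝ) + α) / ((n : ℝ) + α) * g θ)
      ∂(sphereMeasure S w) = ∫ θ : sphere (0 : EuclideanSpace ℝ (Fin n)) 1,
        (1 + ε * radialExt η θ) ^ ((n : ℝ) + α) * g θ ∂(sphereMeasure S w) := by
    refine integral_congr_ae ?_
    filter_upwards [hw.ae_mem_sphereMeasure hS] with θ hθ
    rw [indicator_of_mem hθ]
    field_simp
  rw [h1]
  refine h.trans (le_of_eq ?_)
  ring

/-- Integrals of functions of the direction over balls with a centre near the origin, at first
order. -/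
theorem IsAdmissibleWeight.exists_integral_ball
    (hw : IsAdmissibleWeight S α w) (hS : IsOpenConvexCone S) (hn : 1 ≤ n) (hα : 0 < α)
    (h0 : (0 : EuclideanSpace ℝ (Fin n)) ∉ S)
    {g : EuclideanSpace ℝ (Fin n) → ℝ} (hg : Measurable g) {B : ℝ} (hB : ∀ x, |g x| ≤ B) :
    ∃ C : ℝ, 0 ≤ C ∧ ∀ (v : EuclideanSpace ℝ (Fin n)) (r κ : ℝ), ‖v‖ < r → r ≤ 2 → 0 ≤ κ →
      ‖v‖ + κ ≤ 1 / 2 → 3 * |r - 1| + ‖v‖ ^ 2 ≤ κ →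
      ∫ θ : sphere (0 : EuclideanSpace ℝ (Fin n)) 1,
        inner ℝ v (θ : EuclideanSpace ℝ (Fin n)) * g θ ∂(sphereMeasure S w) = 0 →
      |((n : ℝ) + α) * ∫ x in ball v r ∩ S, g (dir x) ∂(coneMeasure S w)
        - ∫ θ : sphere (0 : EuclideanSpace ℝ (Fin n)) 1, g θ ∂(sphereMeasure S w)|
        ≤ C * ((‖v‖ + κ) ^ 2 + κ) := by
  have hfin := hw.isFiniteMeasure_sphereMeasure
  have hD : 0 < (n : ℝ) + α := by positivity
  have hB0 : 0 ≤ B := (abs_nonneg _).trans (hB 0)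
  obtain ⟨C, hC0, hC⟩ := exists_integral_rpow_taylor (sphereMeasure S w) ((n : ℝ) + α)
    (ψ := fun θ => g θ) (hg.comp measurable_subtype_coe).aestronglyMeasurable
    (ae_of_all _ fun θ => hB θ)
  set C' := ((n : ℝ) + α) * (B * (sphereMeasure S w).real univ) with hC'
  have hC'0 : 0 ≤ C' := by positivity
  refine ⟨C + C', by positivity, fun v r κ hv hr hκ0 hκ hκ' horth => ?_⟩
  have hR0 : ∀ θ ∈ S, ‖θ‖ = 1 → 0 ≤ ballRadial v r θ := fun θ _ _ => by
    have := (abs_lt.1 (ballRadial_pos (θ := θ) hv)).1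
    rw [ballRadial]
    linarith
  have hRs : ∀ θ : sphere (0 : EuclideanSpace ℝ (Fin n)) 1,
      |ballRadial v r θ - 1 - inner ℝ v (θ : EuclideanSpace ℝ (Fin n))| ≤ κ := fun θ =>
    (abs_ballRadial_sub_le hv hr (by simp)).trans hκ'
  have hin : ∀ θ : sphere (0 : EuclideanSpace ℝ (Fin n)) 1,
      |inner ℝ v (θ : EuclideanSpace ℝ (Fin n))| ≤ ‖v‖ := fun θ => by
    simpa using abs_real_inner_le_norm v (θ : EuclideanSpace ℝ (Fin n))
  have hRu : ∀ θ : sphere (0 : EuclideanSpace ℝ (Fin n)) 1, |ballRadial v r θ - 1| ≤ ‖v‖ + κ := by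
    intro θ
    have h2 : |ballRadial v r θ - 1| ≤
        |ballRadial v r θ - 1 - inner ℝ v (θ : EuclideanSpace ℝ (Fin n))| +
          |inner ℝ v (θ : EuclideanSpace ℝ (Fin n))| := by
      simpa using abs_add_le (ballRadial v r θ - 1 - inner ℝ v (θ : EuclideanSpace ℝ (Fin n)))
        (inner ℝ v (θ : EuclideanSpace ℝ (Fin n)))
    linarith [hRs θ, hin θ]
  have hRm : Measurable fun θ : sphere (0 : EuclideanSpace ℝ (Fin n)) 1 => ballRadial v r θ :=
    (measurable_ballRadial v r).comp measurable_subtype_coe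
  have hgm : Measurable fun θ : sphere (0 : EuclideanSpace ℝ (Fin n)) 1 => g θ :=
    hg.comp measurable_subtype_coe
  have h := hC (fun θ => ballRadial v r θ - 1) (‖v‖ + κ) (hRm.sub_const 1).aemeasurable hκ
    (ae_of_all _ hRu)
  simp only [add_sub_cancel] at h
  have h1 : ((n : ℝ) + α) * ∫ x in ball v r ∩ S, g (dir x) ∂(coneMeasure S w) =
      ∫ θ : sphere (0 : EuclideanSpace ℝ (Fin n)) 1, ballRadial v r θ ^ ((n : ℝ) + α) * g θ
        ∂(sphereMeasure S w) := by
    rw [ball_inter_eq_starBody_ballRadial h0 hv,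
      hw.integral_starBody hS hn hα (measurable_ballRadial v r) hR0 hg, ← integral_const_mul]
    refine integral_congr_ae (ae_of_all _ fun θ => ?_)
    simp only
    field_simp
  have hi1 : Integrable (fun θ : sphere (0 : EuclideanSpace ℝ (Fin n)) 1 =>
      inner ℝ v (θ : EuclideanSpace ℝ (Fin n)) * g θ) (sphereMeasure S w) := by
    refine Integrable.of_bound (Measurable.aestronglyMeasurable (by fun_prop)) (‖v‖ * B)
      (ae_of_all _ fun θ => ?_)
    rw [norm_mul]
    exact mul_le_mul (hin θ) (hB θ) (norm_nonneg _) (norm_nonneg _)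
  have hi2 : Integrable (fun θ : sphere (0 : EuclideanSpace ℝ (Fin n)) 1 =>
      (ballRadial v r θ - 1) * g θ) (sphereMeasure S w) := by
    refine Integrable.of_bound (Measurable.aestronglyMeasurable (by fun_prop)) ((‖v‖ + κ) * B)
      (ae_of_all _ fun θ => ?_)
    rw [norm_mul]
    exact mul_le_mul (hRu θ) (hB θ) (norm_nonneg _) (by positivity)
  have h2 : |∫ θ : sphere (0 : EuclideanSpace ℝ (Fin n)) 1, (ballRadial v r θ - 1) * g θ
      ∂(sphereMeasure S w)| ≤ κ * B * (sphereMeasure S w).real univ := by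
    -- Orthogonality of g to ⟨v, ·⟩ permits subtracting that function from the radial function minus
    -- one, leaving an integrand of size κ instead of |v| + κ.
    rw [← sub_zero (∫ θ : sphere (0 : EuclideanSpace ℝ (Fin n)) 1, _ ∂_), ← horth,
      ← integral_sub hi2 hi1, ← Real.norm_eq_abs]
    refine norm_integral_le_of_norm_le_const (ae_of_all _ fun θ => ?_)
    rw [← sub_mul, norm_mul]
    exact mul_le_mul (hRs θ) (hB θ) (norm_nonneg _) hκ0
  rw [h1]
  set I₁ := ∫ θ : sphere (0 : EuclideanSpace ℝ (Fin n)) 1,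
    ballRadial v r θ ^ ((n : ℝ) + α) * g θ ∂(sphereMeasure S w)
  set I₂ := ∫ θ : sphere (0 : EuclideanSpace ℝ (Fin n)) 1, g θ ∂(sphereMeasure S w)
  set I₃ := ∫ θ : sphere (0 : EuclideanSpace ℝ (Fin n)) 1, (ballRadial v r θ - 1) * g θ
      ∂(sphereMeasure S w)
  have h3 : |I₁ - I₂| ≤ |I₁ - I₂ - ((n : ℝ) + α) * I₃| + |((n : ℝ) + α) * I₃| := by
    simpa using abs_add_le (I₁ - I₂ - ((n : ℝ) + α) * I₃) (((n : ℝ) + α) * I₃)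
  have h4 : |((n : ℝ) + α) * I₃| ≤ C' * κ := by
    rw [abs_mul, abs_of_pos hD, hC']
    calc ((n : ℝ) + α) * |I₃| ≤ ((n : ℝ) + α) * (κ * B * (sphereMeasure S w).real univ) := by
          gcongr
      _ = _ := by ring
  have h5 : 0 ≤ C * κ := by positivity
  have h6 : 0 ≤ C' * (‖v‖ + κ) ^ 2 := by positivity
  linarith

/-- A ball of the same volume which overlaps well with the perturbed ball has its centre near the
origin. -/
theorem IsAdmissibleWeight.norm_center_le
    (hw : IsAdmissibleWeight S α w) (hS : IsOpenConvexCone S) (hn : 1 ≤ n) (hα : 0 < α)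
    {v : EuclideanSpace ℝ (Fin n)} (hv : ∀ x ∈ S, ∀ t : ℝ, x + t • v ∈ S) {r m₀ a b : ℝ}
    (hr : 0 ≤ r) (hr2 : r ≤ 3 / 2) (hm₀ : 0 < m₀)
    (hm : m₀ / 2 ≤ (coneMeasure S w).real (ball 0 r ∩ S)) {E : Set (EuclideanSpace ℝ (Fin n))}
    (hEfin : coneMeasure S w E ≠ ⊤)
    (ha : (coneMeasure S w).real (E ∆ (ball v r ∩ S)) ≤ a)
    (hb : (coneMeasure S w).real (E ∆ (ball 0 r ∩ S)) ≤ b) (hab : a + b ≤ m₀ / 4) :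
    ‖v‖ ≤ 6 * (a + b) / m₀ := by
  obtain ⟨hBv, hmom⟩ := hw.norm_mul_le_symmDiff_ball hS hn hα hv hr
  have hB0 := hw.coneMeasure_ball_lt_top hS hn hα r
  have htri := measureReal_symmDiff_le (μ := coneMeasure S w) (s := ball v r ∩ S) (t := E)
    (ball 0 r ∩ S) (hBv ▸ hB0.ne) hEfin
  rw [symmDiff_comm (ball v r ∩ S) E] at htri
  have h1 : ‖v‖ * (m₀ / 2) ≤ (3 / 2 + ‖v‖) * (a + b) := by
    calc ‖v‖ * (m₀ / 2) ≤ ‖v‖ * (coneMeasure S w).real (ball 0 r ∩ S) := by gcongr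
      _ ≤ (r + ‖v‖) * (coneMeasure S w).real ((ball v r ∩ S) ∆ (ball 0 r ∩ S)) := hmom
      _ ≤ (r + ‖v‖) * (a + b) := by gcongr; linarith
      _ ≤ (3 / 2 + ‖v‖) * (a + b) := by
        have : 0 ≤ a + b := add_nonneg (measureReal_nonneg.trans ha) (measureReal_nonneg.trans hb)
        gcongr
  rw [le_div_iff₀ hm₀]
  -- As a + b ≤ m₀/4, the term |v|(a + b) is absorbed in |v| m₀/2, leaving |v| m₀/4 ≤ (3/2)(a + b).
  nlinarith [norm_nonneg v]

/-- The symmetric difference between the perturbed ball and the balls centred in the invariant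
directions is at least of order `ε`. -/
theorem IsAdmissiblePerturbation.exists_symmDiff_ge (hη : IsAdmissiblePerturbation S w η)
    (hw : IsAdmissibleWeight S α w) (hS : IsOpenConvexCone S) (hn : 1 ≤ n) (hα : 0 < α)
    (h0 : (0 : EuclideanSpace ℝ (Fin n)) ∉ S)
    (L : Submodule ℝ (EuclideanSpace ℝ (Fin n))) (hL : ∀ x ∈ S, ∀ v ∈ L, x + v ∈ S)
    (hne : ¬ ∃ ℓ ∈ L, ∀ θ ∈ sphere (0 : EuclideanSpace ℝ (Fin n)) 1 ∩ S, η θ = inner ℝ ℓ θ) :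
    ∃ c ε₀ : ℝ, 0 < c ∧ 0 < ε₀ ∧ ∀ ε : ℝ, 0 < ε → ε < ε₀ → ∀ r : ℝ, 0 < r →
      coneMeasure S w (perturbedBall S η ε) = coneMeasure S w (ball 0 r ∩ S) → ∀ v ∈ L,
      c * ε ≤ (coneMeasure S w).real (perturbedBall S η ε ∆ (ball v r ∩ S)) := by
  have hD : 0 < (n : ℝ) + α := by positivity
  obtain ⟨M, hM0, hM⟩ := hη.exists_bound hS h0
  obtain ⟨C, ε₁, hC0, hε₁, hnear⟩ := hη.exists_near_ball hw hS hn hα h0 hM0 hM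
  obtain ⟨g, B, hg, hB0, hB, horth, hc₁⟩ := hη.exists_dual_function hw hS hα h0 L hL hne
  obtain ⟨C₁, hC₁0, hC₁⟩ := hη.exists_integral_perturbedBall hw hS hn hα h0 hM hg hB
  obtain ⟨C₂, hC₂0, hC₂⟩ := hw.exists_integral_ball hS hn hα h0 hg hB
  have hm0 : 0 < (coneMeasure S w).real (ball 0 1 ∩ S) := by
    rw [hw.coneMeasure_real_ball hS hn hα zero_le_one, Real.one_rpow, one_mul]
    exact div_pos (hw.sphereMeasure_real_pos hS hα h0) hD
  generalize (coneMeasure S w).real (ball 0 1 ∩ S) = m₀ at hnear hm0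
  generalize ∫ θ : sphere (0 : EuclideanSpace ℝ (Fin n)) 1, radialExt η θ * g θ
    ∂(sphereMeasure S w) = c₁ at hc₁ hC₁
  generalize ∫ θ : sphere (0 : EuclideanSpace ℝ (Fin n)) 1, g θ ∂(sphereMeasure S w) = I₀
    at hC₁ hC₂
  generalize hDD : (n : ℝ) + α = D at *
  -- `K` bounds |v|/ε through `norm_center_le` with a = ε and b = Cε; `K₃` bounds (3|r - 1| +
  -- |v|²)/ε²; `K₄` collects the second-order errors of the two expansions.
  obtain ⟨K, hK⟩ : ∃ K, K = 6 * (1 + C) / m₀ := ⟨_, rfl⟩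
  have hK0 : 0 < K := by rw [hK]; positivity
  obtain ⟨K₃, hK₃⟩ : ∃ K₃, K₃ = 3 * C + K ^ 2 := ⟨_, rfl⟩
  have hK₃0 : 0 < K₃ := by rw [hK₃]; positivity
  obtain ⟨K₄, hK₄⟩ : ∃ K₄, K₄ = C₁ + C₂ * ((K + K₃) ^ 2 + K₃) := ⟨_, rfl⟩
  have hK₄0 : 0 ≤ K₄ := by rw [hK₄]; positivity
  refine ⟨min 1 (c₁ / (2 * B)), min (min ε₁ 1) (min (min (1 / (2 * M)) (1 / (2 * (K + K₃))))
    (min (min (m₀ / (4 * (1 + C))) (1 / (2 * (C + 1)))) (D * c₁ / (2 * (K₄ + 1))))),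
    by positivity, by positivity, fun ε hε hε' r hr heq v hvL => ?_⟩
  simp only [lt_min_iff] at hε'
  obtain ⟨⟨e1, e2⟩, ⟨e3, e4⟩, ⟨e5, e6⟩, e7⟩ := hε'
  rw [lt_div_iff₀ (by positivity)] at e3 e4 e5 e6 e7
  have hεM : ε * M ≤ 1 / 2 := by linarith only [e3]
  have hε2 : ε ^ 2 ≤ ε := by nlinarith only [hε, e2]
  obtain ⟨hr1, hsd, hmr⟩ := hnear ε hε e1 r hr heq
  have hCε2 : C * ε ^ 2 ≤ C * ε := mul_le_mul_of_nonneg_left hε2 hC0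
  have hr' := abs_le.1 (hr1.trans (show C * ε ^ 2 ≤ 1 / 2 by linarith only [hCε2, e6, hε]))
  have hEm := measurableSet_perturbedBall hη hS h0 hM hε hεM
  have hEfin := coneMeasure_perturbedBall_lt_top hη hw hS hn hα h0 hM hε hεM
  have hvS : ∀ x ∈ S, ∀ t : ℝ, x + t • v ∈ S := fun x hx t => hL x hx _ (L.smul_mem t hvL)
  have hBvfin : coneMeasure S w (ball v r ∩ S) < ⊤ := by
    rw [(hw.norm_mul_le_symmDiff_ball hS hn hα hvS hr.le).1]
    exact hw.coneMeasure_ball_lt_top hS hn hα r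
  -- Suppose the symmetric difference τ is below min(1, c₁/(2B)) ε. The 1 forces |v| ≤ Kε, so both
  -- expansions apply and D c₁ ε ≤ DBτ + K₄ε². The other entry gives Bτ < c₁ε/2, and the choice of
  -- ε₀ gives K₄ε² ≤ D c₁ ε/2, a contradiction.
  by_contra! hlt
  have hτε := hlt.le.trans (mul_le_of_le_one_left hε.le (min_le_left 1 (c₁ / (2 * B))))
  have hτc := hlt.trans_le (mul_le_mul_of_nonneg_right (min_le_right 1 (c₁ / (2 * B))) hε.le)
  have hvK : ‖v‖ ≤ K * ε := by
    have := hw.norm_center_le hS hn hα hvS hr.le (by linarith only [hr'.2]) hm0 hmr hEfin.ne hτε hsd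
      (by nlinarith only [e5, hCε2, hε])
    refine this.trans (le_of_eq ?_)
    rw [hK]
    ring
  have hsmall : 3 * |r - 1| + ‖v‖ ^ 2 ≤ K₃ * ε ^ 2 := by
    have := pow_le_pow_left₀ (norm_nonneg v) hvK 2
    rw [hK₃]
    linarith only [this, hr1]
  have hsum : ‖v‖ + K₃ * ε ^ 2 ≤ (K + K₃) * ε := by
    have := mul_le_mul_of_nonneg_left hε2 hK₃0.le
    linarith only [this, hvK]
  have hBall := hC₂ v r (K₃ * ε ^ 2) (by
      have : 0 ≤ K₃ * ε ^ 2 := by positivity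
      linarith only [this, hsum, e4, hr'.1]) (by linarith only [hr'.2]) (by positivity)
      (by linarith only [hsum, e4]) hsmall (horth v hvL)
  have hPert := hC₁ ε hε hεM
  have hbd := abs_setIntegral_sub_le (μ := coneMeasure S w) hEm
    (measurableSet_ball.inter hS.isOpen.measurableSet) hEfin hBvfin
    (f := fun x => g (dir x))
    (IntegrableOn.of_bound hEfin (hg.comp measurable_dir).aestronglyMeasurable B
      (ae_of_all _ fun x => hB _))
    (IntegrableOn.of_bound hBvfin (hg.comp measurable_dir).aestronglyMeasurable B
      (ae_of_all _ fun x => hB _)) (fun x _ => hB (dir x))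
  generalize (coneMeasure S w).real (perturbedBall S η ε ∆ (ball v r ∩ S)) = τ at *
  generalize ∫ x in perturbedBall S η ε, g (dir x) ∂(coneMeasure S w) = I₁ at *
  generalize ∫ x in ball v r ∩ S, g (dir x) ∂(coneMeasure S w) = I₂ at *
  have hq : (‖v‖ + K₃ * ε ^ 2) ^ 2 + K₃ * ε ^ 2 ≤ ((K + K₃) ^ 2 + K₃) * ε ^ 2 := by
    have h0' : 0 ≤ ‖v‖ + K₃ * ε ^ 2 := by positivity
    have := pow_le_pow_left₀ h0' hsum 2
    linarith only [this]
  have hBall' := (abs_le.1 (hBall.trans (mul_le_mul_of_nonneg_left hq hC₂0))).2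
  have hPert' := (abs_le.1 hPert).1
  have hbd' := mul_le_mul_of_nonneg_left ((le_abs_self _).trans hbd) hD.le
  have hτB : B * τ < c₁ * ε / 2 := by
    have := mul_lt_mul_of_pos_left hτc hB0
    refine this.trans_le (le_of_eq ?_)
    field_simp
  have hτD := mul_lt_mul_of_pos_left hτB hD
  have hK₄ε : K₄ * ε ^ 2 ≤ D * c₁ * ε / 2 := by
    nlinarith only [e7, hε]
  rw [hK₄] at hK₄ε
  linarith only [hBall', hPert', hbd', hτD, hK₄ε]

end Asymmetry

/-! ### Assembly of the bounds, and a perturbation that always exists. -/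

section Sharpness

variable {n : ℕ} {S : Set (EuclideanSpace ℝ (Fin n))} {α : ℝ} {w η : EuclideanSpace ℝ (Fin n) → ℝ}

theorem perturbedBall_subset (hS : IsOpenConvexCone S) (η : EuclideanSpace ℝ (Fin n) → ℝ) (ε : ℝ) :
    perturbedBall S η ε ⊆ S := by
  rintro _ ⟨θ, ⟨-, hθ⟩, t, ht, -, rfl⟩
  exact hS.smul_mem t ht θ hθ

/-- A set of finite positive measure has a comparison ball of the same measure. -/
theorem IsAdmissibleWeight.exists_ball_coneMeasure_eq
    (hw : IsAdmissibleWeight S α w) (hS : IsOpenConvexCone S) (hn : 1 ≤ n) (hα : 0 < α)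
    (h0 : (0 : EuclideanSpace ℝ (Fin n)) ∉ S) {E : Set (EuclideanSpace ℝ (Fin n))}
    (hE0 : 0 < (coneMeasure S w).real E) (hE : coneMeasure S w E ≠ ⊤) :
    ∃ r : ℝ, 0 < r ∧ coneMeasure S w E = coneMeasure S w (ball 0 r ∩ S) := by
  have hD : 0 < (n : ℝ) + α := by positivity
  have hm : 0 < (sphereMeasure S w).real univ / ((n : ℝ) + α) :=
    div_pos (hw.sphereMeasure_real_pos hS hα h0) hD
  set q := (coneMeasure S w).real E / ((sphereMeasure S w).real univ / ((n : ℝ) + α)) with hq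
  have hq0 : 0 < q := div_pos hE0 hm
  refine ⟨q ^ ((n : ℝ) + α)⁻¹, by positivity, ?_⟩
  rw [← ENNReal.toReal_eq_toReal_iff' hE (hw.coneMeasure_ball_lt_top hS hn hα _).ne]
  change (coneMeasure S w).real E = (coneMeasure S w).real _
  rw [hw.coneMeasure_real_ball hS hn hα (by positivity), Real.rpow_inv_rpow hq0.le hD.ne', hq,
    div_mul_cancel₀ _ hm.ne']

/-- A lower bound for the asymmetry. -/
theorem IsAdmissibleWeight.le_asymmetry
    (hw : IsAdmissibleWeight S α w) (hS : IsOpenConvexCone S) (hn : 1 ≤ n) (hα : 0 < α)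
    (h0 : (0 : EuclideanSpace ℝ (Fin n)) ∉ S) {L : Set (EuclideanSpace ℝ (Fin n))}
    (hL0 : (0 : EuclideanSpace ℝ (Fin n)) ∈ L) {E : Set (EuclideanSpace ℝ (Fin n))}
    (hEm : MeasurableSet E) (hES : E ⊆ S) (hE0 : 0 < (coneMeasure S w).real E)
    (hE : coneMeasure S w E ≠ ⊤) {a : ℝ} (ha : ∀ r : ℝ, 0 < r →
      coneMeasure S w E = coneMeasure S w (ball 0 r ∩ S) → ∀ v ∈ L,
      a * (coneMeasure S w).real E ≤ (coneMeasure S w).real (E ∆ (ball v r ∩ S))) :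
    a ≤ (asymmetry S L w E).toReal := by
  have hB : ∀ (v : EuclideanSpace ℝ (Fin n)) (r : ℝ),
      MeasurableSet (ball v r ∩ S) := fun v r => measurableSet_ball.inter hS.isOpen.measurableSet
  have hvol : wVol w E = coneMeasure S w E := wVol_eq_coneMeasure hEm hES
  have hvolB : ∀ r, wVol w (ball 0 r ∩ S) = coneMeasure S w (ball 0 r ∩ S) := fun r =>
    wVol_eq_coneMeasure (hB 0 r) inter_subset_right
  have hvolD : ∀ v r, wVol w (E ∆ (ball v r ∩ S)) = coneMeasure S w (E ∆ (ball v r ∩ S)) :=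
    fun v r => wVol_eq_coneMeasure (hEm.symmDiff (hB v r))
      (symmDiff_subset_union.trans (union_subset hES inter_subset_right))
  have hE0' : coneMeasure S w E ≠ 0 := fun h => by simp [Measure.real, h] at hE0
  -- Finiteness is needed since `toReal` sends ⊤ to zero; the centred ball of equal volume is a
  -- competitor.
  have htop : asymmetry S L w E ≠ ⊤ := by
    obtain ⟨r, hr, hEr⟩ := hw.exists_ball_coneMeasure_eq hS hn hα h0 hE0 hE
    refine ne_top_of_le_ne_top (b := wVol w (E ∆ (ball 0 r ∩ S)) / wVol w E) ?_
      (iInf₂_le_of_le r ⟨hr, by rw [hvol, hvolB, hEr]⟩ (iInf₂_le 0 hL0))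
    rw [hvol, hvolD]
    refine ENNReal.div_ne_top (measure_ne_top_of_subset symmDiff_subset_union ?_) hE0'
    exact (measure_union_lt_top hE.lt_top (hw.coneMeasure_ball_lt_top hS hn hα r)).ne
  rw [← ENNReal.ofReal_le_iff_le_toReal htop]
  refine le_iInf₂ fun r hr => le_iInf₂ fun v hv => ?_
  rw [hvol, hvolB] at hr
  rw [hvol, hvolD, ENNReal.le_div_iff_mul_le (Or.inl hE0') (Or.inl hE),
    ← ENNReal.ofReal_toReal hE, ← ENNReal.ofReal_mul' ENNReal.toReal_nonneg]
  exact (ENNReal.ofReal_le_ofReal (ha r hr.1 hr.2 v hv)).trans ENNReal.ofReal_toReal_le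

/-- Perturbed balls have deficit of second order and asymmetry of first order. -/
theorem IsAdmissiblePerturbation.exists_sharp_bounds (hη : IsAdmissiblePerturbation S w η)
    (hw : IsAdmissibleWeight S α w) (hS : IsOpenConvexCone S) (hn : 1 ≤ n) (hα : 0 < α)
    (h0 : (0 : EuclideanSpace ℝ (Fin n)) ∉ S)
    (L : Submodule ℝ (EuclideanSpace ℝ (Fin n))) (hL : ∀ x ∈ S, ∀ v ∈ L, x + v ∈ S)
    (hne : ¬ ∃ ℓ ∈ L, ∀ θ ∈ sphere (0 : EuclideanSpace ℝ (Fin n)) 1 ∩ S, η θ = inner ℝ ℓ θ) :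
    ∃ ε₀ C c : ℝ, 0 < ε₀ ∧ 0 < c ∧ ∀ ε : ℝ, 0 < ε → ε < ε₀ →
      (∀ θ ∈ sphere (0 : EuclideanSpace ℝ (Fin n)) 1 ∩ S, 0 < 1 + ε * η θ) ∧
      MeasurableSet (perturbedBall S η ε) ∧ perturbedBall S η ε ⊆ S ∧
      0 < wVol w (perturbedBall S η ε) ∧ wVol w (perturbedBall S η ε) < ⊤ ∧
      wPer S w (perturbedBall S η ε) < ⊤ ∧
      |(wVol w (perturbedBall S η ε)).toReal - (wVol w (ball 0 1 ∩ S)).toReal| ≤ C * ε ^ 2 ∧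
      |(wPer S w (perturbedBall S η ε)).toReal - (wPer S w (ball 0 1 ∩ S)).toReal|
        ≤ C * ε ^ 2 ∧
      |deficit S α w (perturbedBall S η ε)| ≤ C * ε ^ 2 ∧
      c * ε ≤ (asymmetry S (L : Set (EuclideanSpace ℝ (Fin n))) w (perturbedBall S η ε)).toReal := by
  have hfin := hw.isFiniteMeasure_sphereMeasure
  have hD : 0 < (n : ℝ) + α := by positivity
  obtain ⟨M, hM0, hM⟩ := hη.exists_bound hS h0
  obtain ⟨C₁, hC₁0, hC₁⟩ := hη.exists_volume_bound hw hS hn hα h0 hM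
  obtain ⟨C₂, hC₂0, hC₂⟩ := hη.exists_perimeter_bound hw hS hn hα h0 hM
  obtain ⟨c, ε₁, hc0, hε₁, hc⟩ := hη.exists_symmDiff_ge hw hS hn hα h0 L hL hne
  have hV₀ : 0 < (coneMeasure S w).real (ball 0 1 ∩ S) := by
    rw [hw.coneMeasure_real_ball hS hn hα zero_le_one, Real.one_rpow, one_mul]
    exact div_pos (hw.sphereMeasure_real_pos hS hα h0) hD
  have hP₀ : 0 < (wPer S w (ball 0 1 ∩ S)).toReal := by
    rw [hw.wPer_ball hS hn hα h0, ENNReal.toReal_ofReal measureReal_nonneg]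
    exact hw.sphereMeasure_real_pos hS hα h0
  obtain ⟨κ, C₃, hκ0, hC₃⟩ := exists_deficit_bound hP₀ hV₀ (hC₁0.trans (le_max_left C₁ C₂))
    (((n : ℝ) + α - 1) / ((n : ℝ) + α))
  have hvolB : wVol w (ball 0 1 ∩ S) = coneMeasure S w (ball 0 1 ∩ S) :=
    wVol_eq_coneMeasure (measurableSet_ball.inter hS.isOpen.measurableSet) inter_subset_right
  obtain ⟨m₀, hm₀⟩ : ∃ m₀, m₀ = (coneMeasure S w).real (ball 0 1 ∩ S) := ⟨_, rfl⟩
  rw [← hm₀] at hV₀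
  -- The last bound on ε keeps the volume of E_ε between m₀/2 and 2m₀, whence the normalization
  -- c/(2m₀).
  refine ⟨min (min (min ε₁ κ) 1) (min (1 / (2 * M)) (m₀ / (2 * (C₁ + 1)))), max (max C₁ C₂) C₃,
    c / (2 * m₀), by positivity, by positivity, fun ε hε hε' => ?_⟩
  simp only [lt_min_iff] at hε'
  obtain ⟨⟨⟨e1, e2⟩, e3⟩, e4, e5⟩ := hε'
  rw [lt_div_iff₀ (by positivity)] at e4 e5
  have hεM : ε * M ≤ 1 / 2 := by linarith only [e4]
  have hEm := measurableSet_perturbedBall hη hS h0 hM hε hεM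
  have hES := perturbedBall_subset hS η ε
  have hEfin := coneMeasure_perturbedBall_lt_top hη hw hS hn hα h0 hM hε hεM
  have hvol : wVol w (perturbedBall S η ε) = coneMeasure S w (perturbedBall S η ε) :=
    wVol_eq_coneMeasure hEm hES
  have hV := hC₁ ε hε hεM
  obtain ⟨hPfin, hP⟩ := hC₂ ε hε hεM
  have hV' := abs_le.1 hV
  rw [← hm₀] at hV'
  have hCε : C₁ * ε ^ 2 ≤ m₀ / 2 := by
    have : C₁ * ε ^ 2 ≤ C₁ * ε := mul_le_mul_of_nonneg_left (by nlinarith only [hε, e3]) hC₁0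
    linarith only [this, e5, hε]
  have hE0 : 0 < (coneMeasure S w).real (perturbedBall S η ε) := by
    linarith only [hV'.1, hCε, hV₀]
  have hE2 : (coneMeasure S w).real (perturbedBall S η ε) ≤ 2 * m₀ := by
    linarith only [hV'.2, hCε, hV₀]
  have hmono : ∀ {a b : ℝ}, a ≤ b → a * ε ^ 2 ≤ b * ε ^ 2 := fun h =>
    mul_le_mul_of_nonneg_right h (sq_nonneg ε)
  have h12 := le_max_left (max C₁ C₂) C₃
  refine ⟨fun θ hθ => ?_, hEm, hES, ?_, hvol ▸ hEfin, hPfin, ?_,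
    hP.trans (hmono ((le_max_right _ _).trans h12)), ?_, ?_⟩
  · have hθ1 : ‖θ‖ = 1 := by simpa using hθ.1
    have h1 := hM θ hθ.2
    rw [radialExt_of_norm_eq_one η hθ1] at h1
    have h2 := mul_le_mul_of_nonneg_left (abs_le.1 h1).1 hε.le
    linarith only [h2, hεM]
  · rw [hvol]
    exact (ENNReal.toReal_pos_iff.1 hE0).1
  · rw [hvol, hvolB]
    exact hV.trans (hmono ((le_max_left _ _).trans h12))
  · rw [deficit, isopConst, hvol, hvolB]
    exact (hC₃ ε _ _ hε e2 (hP.trans (hmono (le_max_right _ _)))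
      (hV.trans (hmono (le_max_left _ _)))).trans (hmono (le_max_right _ _))
  · refine hw.le_asymmetry hS hn hα h0 L.zero_mem hEm hES hE0 hEfin.ne fun r hr heq v hv =>
      le_trans ?_ (hc ε hε e1 r hr heq v hv)
    calc c / (2 * m₀) * ε * (coneMeasure S w).real (perturbedBall S η ε)
        ≤ c / (2 * m₀) * ε * (2 * m₀) := by gcongr
      _ = c * ε := by field_simp

/-- A quantity of second order, raised to an exponent larger than one half, is smaller than first
order. -/
theorem exists_mul_rpow_lt_of_sq_bound {c C ε₀ β : ℝ} (hc : 0 < c) (hε₀ : 0 < ε₀) (hβ : 1 / 2 < β)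
    {d : ℝ → ℝ} (hd : ∀ ε, 0 < ε → ε < ε₀ → |d ε| ≤ C * ε ^ 2) (K : ℝ) :
    ∃ ε, 0 < ε ∧ ε < ε₀ ∧ K * d ε ^ β < c * ε := by
  have hβ0 : 0 < β := by linarith
  have hlim : Tendsto (fun ε : ℝ => |K| * |C| ^ β * ε ^ (2 * β - 1)) (𝓝[>] 0) (𝓝 0) := by
    have h1 := (Real.continuousAt_rpow_const 0 (2 * β - 1) (Or.inr (by linarith))).tendsto
    rw [Real.zero_rpow (by linarith)] at h1
    simpa using (h1.mono_left nhdsWithin_le_nhds).const_mul (|K| * |C| ^ β)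
  obtain ⟨ε, hεc, hε0, hε⟩ := ((hlim.eventually_lt_const hc).and
    (Ioo_mem_nhdsGT hε₀)).exists
  refine ⟨ε, hε0, hε, ?_⟩
  have hCε : |d ε| ≤ |C| * ε ^ 2 := (hd ε hε0 hε).trans
    (mul_le_mul_of_nonneg_right (le_abs_self C) (sq_nonneg ε))
  have hpow : ε ^ (2 * β) = ε ^ (2 * β - 1) * ε := by
    rw [← Real.rpow_add_one hε0.ne', sub_add_cancel]
  -- |x^β| ≤ |x|^β also holds for the default value of a real power at negative x, so the sign of
  -- the deficit is irrelevant.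
  calc K * d ε ^ β ≤ |K| * |d ε| ^ β := by
        refine (le_abs_self _).trans ?_
        rw [abs_mul]
        exact mul_le_mul_of_nonneg_left (Real.abs_rpow_le_abs_rpow _ _) (abs_nonneg K)
    _ ≤ |K| * (|C| * ε ^ 2) ^ β := by gcongr
    _ = |K| * |C| ^ β * ε ^ (2 * β - 1) * ε := by
        rw [Real.mul_rpow (abs_nonneg C) (sq_nonneg ε), ← Real.rpow_natCast ε 2,
          ← Real.rpow_mul hε0.le, Nat.cast_ofNat, hpow]
        ring
    _ < c * ε := mul_lt_mul_of_pos_right hεc hε0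

/-- A linear function minus its mean is an admissible perturbation. -/
theorem IsAdmissibleWeight.exists_linear_perturbation
    (hw : IsAdmissibleWeight S α w) (hS : IsOpenConvexCone S) (hα : 0 < α)
    (h0 : (0 : EuclideanSpace ℝ (Fin n)) ∉ S) (e : EuclideanSpace ℝ (Fin n)) :
    ∃ c : ℝ, IsAdmissiblePerturbation S w (fun x => inner ℝ e x - c) := by
  have hfin := hw.isFiniteMeasure_sphereMeasure
  have hν := hw.sphereMeasure_real_pos hS hα h0
  have hb : ∀ x : EuclideanSpace ℝ (Fin n), ‖x‖ = 1 → |inner ℝ e x| ≤ ‖e‖ := fun x hx => by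
    simpa [hx] using abs_real_inner_le_norm e x
  set c := (∫ θ : sphere (0 : EuclideanSpace ℝ (Fin n)) 1,
    inner ℝ e (θ : EuclideanSpace ℝ (Fin n)) ∂(sphereMeasure S w)) / (sphereMeasure S w).real univ
    with hc
  have hsm : ContDiffOn ℝ ∞ (radialExt fun x => inner ℝ e x - c)
      ({0}ᶜ : Set (EuclideanSpace ℝ (Fin n))) := by
    intro x hx
    have hn0 : ‖x‖ ≠ 0 := norm_ne_zero_iff.2 hx
    have h1 : ContDiffAt ℝ ∞ (fun x : EuclideanSpace ℝ (Fin n) => ‖x‖⁻¹ • x) x :=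
      ((contDiffAt_norm ℝ hx).inv hn0).smul contDiffAt_id
    exact ((contDiffAt_const.inner ℝ h1).sub contDiffAt_const).contDiffWithinAt
  have hsub : S ⊆ {0}ᶜ := fun x hx h => h0 (h ▸ hx)
  have hsub' : sphere (0 : EuclideanSpace ℝ (Fin n)) 1 ⊆ {0}ᶜ := fun x hx h => by
    rw [mem_singleton_iff.1 h] at hx
    simp at hx
  have hcont := hsm.continuousOn_fderiv_of_isOpen isOpen_compl_singleton
    (by exact_mod_cast le_top)
  -- The extension is smooth off the origin, so its gradient is bounded on the whole compact sphere
  -- and the energy is finite.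
  obtain ⟨G, hG⟩ := (isCompact_sphere (0 : EuclideanSpace ℝ (Fin n)) 1).exists_bound_of_continuousOn
    (hcont.mono hsub')
  refine ⟨c, hsm.mono hsub, ⟨‖e‖ + |c|, fun θ hθ => ?_⟩, ?_, ?_⟩
  · exact (abs_sub _ _).trans (add_le_add (hb θ (by simpa using hθ.1)) le_rfl)
  · rw [← hw.integrable_sphereMeasure_iff hS fun θ =>
      ‖fderiv ℝ (radialExt fun x => inner ℝ e x - c) (θ : EuclideanSpace ℝ (Fin n))‖ ^ 2]
    refine hw.integrable_of_continuousOn hS (f := fun x =>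
      ‖fderiv ℝ (radialExt fun x => inner ℝ e x - c) x‖ ^ 2) ((hcont.mono hsub).norm.pow 2)
      (M := G ^ 2) fun x _ hx => ?_
    rw [abs_of_nonneg (by positivity)]
    exact pow_le_pow_left₀ (norm_nonneg _) (hG x (by simpa using hx)) 2
  · rw [← hw.integral_sphereMeasure hS fun θ => inner ℝ e (θ : EuclideanSpace ℝ (Fin n)) - c,
      integral_sub (hw.integrable_of_continuousOn hS (f := fun x => inner ℝ e x) (by fun_prop)
        fun x _ hx => hb x hx) (integrable_const c), integral_const, smul_eq_mul, hc,
      mul_div_cancel₀ _ hν.ne', sub_self]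

/-- On an open set in dimension at least two, an affine function of the direction which is linear
has no constant term. -/
theorem eq_of_inner_sub_eq (hS : IsOpenConvexCone S) (hn : 2 ≤ n) (hne : S.Nonempty)
    (h0 : (0 : EuclideanSpace ℝ (Fin n)) ∉ S) {e ℓ : EuclideanSpace ℝ (Fin n)} {c : ℝ}
    (h : ∀ θ ∈ sphere (0 : EuclideanSpace ℝ (Fin n)) 1 ∩ S, inner ℝ e θ - c = inner ℝ ℓ θ) :
    e = ℓ := by
  have hlin : ∀ x ∈ S, inner ℝ (e - ℓ) x = c * ‖x‖ := by
    intro x hx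
    have hx0 : ‖x‖ ≠ 0 := norm_ne_zero_iff.2 fun h => h0 (h ▸ hx)
    have h1 := h (dir x) ⟨by simpa using norm_dir (norm_ne_zero_iff.1 hx0), hS.dir_mem h0 hx⟩
    rw [dir, inner_smul_right, inner_smul_right] at h1
    rw [inner_sub_left]
    field_simp at h1
    linarith
  obtain ⟨x, hx⟩ := hne
  have hx0 : x ≠ 0 := fun h => h0 (h ▸ hx)
  have hnear : ∀ v : EuclideanSpace ℝ (Fin n), ∀ᶠ t : ℝ in 𝓝[>] 0, x + t • v ∈ S := by
    intro v
    have hc : Tendsto (fun t : ℝ => x + t • v) (𝓝 0) (𝓝 x) := by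
      have : Continuous fun t : ℝ => x + t • v := by fun_prop
      simpa using this.tendsto 0
    exact (hc.eventually (hS.isOpen.mem_nhds hx)).filter_mono nhdsWithin_le_nhds
  -- The hypothesis extends to ⟨e - ℓ, x⟩ = c|x| on the cone. With v orthogonal to x, available as n
  -- ≥ 2, the points x ± tv have equal norm, strictly larger than |x|, while the linear left side
  -- averages to its value at x. So c = 0.
  have hc : c = 0 := by
    obtain ⟨v, hv, hv0⟩ : ∃ v : EuclideanSpace ℝ (Fin n), inner ℝ x v = 0 ∧ v ≠ 0 := by
      have hlt : Module.finrank ℝ (Submodule.span ℝ {x}) < Module.finrank ℝ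
          (EuclideanSpace ℝ (Fin n)) := by
        rw [finrank_span_singleton hx0, finrank_euclideanSpace_fin]
        omega
      have : (Submodule.span ℝ {x})ᗮ ≠ ⊥ := fun hb => by
        rw [Submodule.orthogonal_eq_bot_iff] at hb
        rw [hb, finrank_top] at hlt
        exact lt_irrefl _ hlt
      obtain ⟨v, hv, hv0⟩ := Submodule.exists_mem_ne_zero_of_ne_bot this
      exact ⟨v, Submodule.mem_orthogonal_singleton_iff_inner_right.1 hv, hv0⟩
    obtain ⟨t, ⟨ht1, ht2⟩, ht⟩ :=
      (((hnear v).and (hnear (-v))).and self_mem_nhdsWithin).exists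
    have ht0 : (0 : ℝ) < t := ht
    have h1 := hlin _ ht1
    have h2 := hlin _ ht2
    have h3 := hlin x hx
    have hpyth : ∀ s : ℝ, ‖x + s • v‖ ^ 2 = ‖x‖ ^ 2 + s ^ 2 * ‖v‖ ^ 2 := fun s => by
      rw [norm_add_sq_real, inner_smul_right, hv, norm_smul, Real.norm_eq_abs, mul_pow, sq_abs]
      ring
    have hsame : ‖x + t • -v‖ = ‖x + t • v‖ := by
      have h5 := hpyth (-t)
      rw [neg_smul, ← smul_neg] at h5
      refine (sq_eq_sq₀ (norm_nonneg _) (norm_nonneg _)).1 ?_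
      rw [h5, hpyth, neg_sq]
    have hgt : ‖x‖ < ‖x + t • v‖ := by
      refine lt_of_pow_lt_pow_left₀ 2 (norm_nonneg _) ?_
      rw [hpyth]
      have : 0 < t ^ 2 * ‖v‖ ^ 2 := by positivity
      linarith
    rw [hsame] at h2
    rw [inner_add_right, inner_smul_right] at h1 h2
    rw [inner_neg_right] at h2
    have h4 : c * (‖x + t • v‖ - ‖x‖) = 0 := by linarith
    exact (mul_eq_zero.1 h4).resolve_right (sub_pos.2 hgt).ne'
  rw [hc] at hlin
  -- The function ⟨e - ℓ, ·⟩ vanishes at x and at x + t(e - ℓ), so |e - ℓ|² = 0.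
  obtain ⟨t, ht1, ht⟩ := ((hnear (e - ℓ)).and self_mem_nhdsWithin).exists
  have ht0 : (0 : ℝ) < t := ht
  have h1 := hlin _ ht1
  have h2 := hlin x hx
  rw [inner_add_right, h2, zero_mul, zero_add, zero_mul, inner_smul_right] at h1
  exact sub_eq_zero.1 (inner_self_eq_zero.1 ((mul_eq_zero.1 h1).resolve_left ht0.ne'))

end Sharpness

end WeightedIsop

theorem mainTheorem9 (k m : ℕ) (hm : 1 ≤ m) (hn : 2 ≤ k + m) (α : ℝ) (hα : 0 < α)
    (T : Set (EuclideanSpace ℝ (Fin m)))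
    (hT : WeightedIsop.IsOpenConvexCone T) (hTl : WeightedIsop.ContainsNoLine T)
    (S : Set (EuclideanSpace ℝ (Fin (k + m)))) (hS : S = WeightedIsop.prodCone k T)
    (w : EuclideanSpace ℝ (Fin (k + m)) → ℝ)
    (hw : WeightedIsop.IsAdmissibleWeight S α w) :
    -- no exponent larger than one half is possible
    (∀ β : ℝ, 1 / 2 < β → ¬ ∃ C : ℝ, ∀ E : Set (EuclideanSpace ℝ (Fin (k + m))),
      MeasurableSet E → E ⊆ S → 0 < WeightedIsop.wVol w E → WeightedIsop.wVol w E < ⊤ →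
      WeightedIsop.wPer S w E < ⊤ →
      (WeightedIsop.asymmetry S (WeightedIsop.lineSpace k m) w E).toReal
        ≤ C * WeightedIsop.deficit S α w E ^ β) ∧
    -- the radial perturbations are witnesses
    (∀ η : EuclideanSpace ℝ (Fin (k + m)) → ℝ,
      WeightedIsop.IsAdmissiblePerturbation S w η →
      (¬ ∃ ℓ ∈ WeightedIsop.lineSpace k m,
        ∀ θ ∈ sphere (0 : EuclideanSpace ℝ (Fin (k + m))) 1 ∩ S, η θ = inner ℝ ℓ θ) →
      ∃ ε₀ C c : ℝ, 0 < ε₀ ∧ 0 < c ∧ ∀ ε : ℝ, 0 < ε → ε < ε₀ →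
        (∀ θ ∈ sphere (0 : EuclideanSpace ℝ (Fin (k + m))) 1 ∩ S, 0 < 1 + ε * η θ) ∧
        MeasurableSet (WeightedIsop.perturbedBall S η ε) ∧
        WeightedIsop.perturbedBall S η ε ⊆ S ∧
        0 < WeightedIsop.wVol w (WeightedIsop.perturbedBall S η ε) ∧
        WeightedIsop.wVol w (WeightedIsop.perturbedBall S η ε) < ⊤ ∧
        WeightedIsop.wPer S w (WeightedIsop.perturbedBall S η ε) < ⊤ ∧
        |(WeightedIsop.wVol w (WeightedIsop.perturbedBall S η ε)).toReal
          - (WeightedIsop.wVol w (ball 0 1 ∩ S)).toReal| ≤ C * ε ^ 2 ∧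
        |(WeightedIsop.wPer S w (WeightedIsop.perturbedBall S η ε)).toReal
          - (WeightedIsop.wPer S w (ball 0 1 ∩ S)).toReal| ≤ C * ε ^ 2 ∧
        |WeightedIsop.deficit S α w (WeightedIsop.perturbedBall S η ε)| ≤ C * ε ^ 2 ∧
        c * ε ≤ (WeightedIsop.asymmetry S (WeightedIsop.lineSpace k m) w
          (WeightedIsop.perturbedBall S η ε)).toReal) := by
  subst hS
  have hSc := WeightedIsop.isOpenConvexCone_prodCone (k := k) hT
  have h0 := WeightedIsop.zero_notMem_prodCone (k := k) hm hT hTl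
  have hL : ∀ x ∈ WeightedIsop.prodCone k T, ∀ v ∈ WeightedIsop.lineSubmodule k m,
      x + v ∈ WeightedIsop.prodCone k T := fun x hx v hv => WeightedIsop.add_mem_prodCone hx hv
  have hn1 : 1 ≤ k + m := by omega
  refine ⟨fun β hβ => ?_, fun η hη hne =>
    hη.exists_sharp_bounds hw hSc hn1 hα h0 (WeightedIsop.lineSubmodule k m) hL hne⟩
  rintro ⟨K, hK⟩
  -- A coordinate direction of the second factor. If ⟨e, ·⟩ - c₀ agreed with an admissible linear
  -- function, e would lie in ℝ^k × {0}, although one of its last m coordinates is 1.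
  let e : EuclideanSpace ℝ (Fin (k + m)) := EuclideanSpace.single (Fin.natAdd k ⟨0, hm⟩) 1
  obtain ⟨c₀, hη⟩ := hw.exists_linear_perturbation hSc hα h0 e
  obtain ⟨θ₀, hθ₀, -⟩ := hw.exists_unit_mem hSc h0
  have hne : ¬ ∃ ℓ ∈ WeightedIsop.lineSubmodule k m,
      ∀ θ ∈ sphere (0 : EuclideanSpace ℝ (Fin (k + m))) 1 ∩ WeightedIsop.prodCone k T,
        inner ℝ e θ - c₀ = inner ℝ ℓ θ := by
    rintro ⟨ℓ, hℓ, h⟩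
    have heℓ := WeightedIsop.eq_of_inner_sub_eq hSc hn ⟨θ₀, hθ₀⟩ h0 h
    have h1 : ℓ (Fin.natAdd k ⟨0, hm⟩) = 0 := hℓ ⟨0, hm⟩
    simp [← heℓ, e] at h1
  obtain ⟨ε₀, C, c, hε₀, hc, hE⟩ :=
    hη.exists_sharp_bounds hw hSc hn1 hα h0 (WeightedIsop.lineSubmodule k m) hL hne
  obtain ⟨ε, hε0, hε, hlt⟩ := WeightedIsop.exists_mul_rpow_lt_of_sq_bound hc hε₀ hβ
    (fun ε h1 h2 => (hE ε h1 h2).2.2.2.2.2.2.2.2.1) K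
  obtain ⟨-, h1, h2, h3, h4, h5, -, -, -, h6⟩ := hE ε hε0 hε
  exact absurd (h6.trans (hK _ h1 h2 h3 h4 h5)) hlt.not_ge
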